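/- Manifolds are smooth, Hausdorff, second countable and without boundary. A contact form on a manifold of dimension $2n+1$ is a smooth $1$-form $\alpha$ with $\alpha\wedge(d\alpha)^n$ nowhere zero. Let $n\ge 0$, let $(M,\alpha)$ be a $(2n+1)$-dimensional manifold with a contact form, let $S^1\subset\mathbb{C}$ act smoothly on $M$ preserving $\alpha$, let $X$ be the vector field $X(m)=\frac{d}{dt}\big|_{t=0}e^{it}\cdot m$, and let $f=\alpha(X):M\to\mathbb{R}$ be the moment map. Suppose that $S^1$ acts freely on $f^{-1}(0)$. Let the cut $M_{[0,\infty)}$ be the topological quotient of $\{m\in M: f(m)\ge 0\}$ by the relation that identifies two distinct points $m,m'$ if and only if $f(m)=f(m')=0$ and $m=\lambda\cdot m'$ for some $\lambda\in S^1$, and let $M_0=f^{-1}(0)/S^1$. On $M\times\mathbb{C}$ consider the action $\lambda\cdot(m,z)=(\lambda\cdot m,\lambda^{-1}z)$, the $1$-form $A=\alpha+\frac{\sqrt{-1}}{2}(z\,d\bar z-\bar z\,dz)$ and the function $\Psi(m,z)=f(m)-|z|^2$. Then the topological spaces $M_{[0,\infty)}$ and $M_0$ carry smooth structures (making them manifolds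 of dimension $2n+1$ and $2n-1$ respectively; $M_0=\emptyset$ if $n=0$) and contact forms $\beta$ and $\alpha_0$ with the following properties. 1. $M_{[0,\infty)}$ is the contact quotient $\Psi^{-1}(0)/S^1$ of $M\times\mathbb{C}$: the set $\Psi^{-1}(0)$ is an embedded submanifold of $M\times\mathbb{C}$ of dimension $2n+2$, and there is a submersion $q:\Psi^{-1}(0)\to M_{[0,\infty)}$ such that two points have the same image under $q$ if and only if they lie on the same $S^1$-orbit, $q(m,\sqrt{f(m)})=[m]$ whenever $f(m)\ge 0$, and $q^*\beta=A|_{\Psi^{-1}(0)}$. 2. $(M_0,\alpha_0)$ is the contact quotient of $(M,\alpha)$: the set $f^{-1}(0)$ is an embedded submanifold of $M$ of dimension $2n$, the orbit map $\pi:f^{-1}(0)\to M_0$ is a submersion, and $\pi^*\alpha_0=\alpha|_{f^{-1}(0)}$. 3. The natural map $\iota:M_0\to M_{[0,\infty)}$, $[m]\mapsto[m]$, is a smooth embedding and $\iota^*\beta=\alpha_0$; thus $M_0$ is a contact submanifold of the cut. 4. The set $M_{[0,\infty)}\smallsetminus\iota(M_0)$ is open, and $m\mapsto[m]$ is a diffeomorphism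 from the open subset $\{m\in M: f(m)>0\}$ of $M$ onto it that pulls $\beta$ back to $\alpha$; in particular it is a contactomorphism. -/

import Mathlib

open scoped Manifold ContDiff
open Set

noncomputable section

namespace ContactCut

section Forms

variable {E : Type*} [NormedAddCommGroup E] [NormedSpace ℝ E] {H : Type*} [TopologicalSpace H]
  {E' : Type*} [NormedAddCommGroup E'] [NormedSpace ℝ E'] {H' : Type*} [TopologicalSpace H']

/-- A (not necessarily smooth) `1`-form on `M`: a covector at every point. -/
abbrev OneForm (I : ModelWithCorners ℝ E H) (M : Type*) [TopologicalSpace M] [ChartedSpace H M] :=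
  ∀ x : M, TangentSpace I x →L[ℝ] ℝ

variable (I : ModelWithCorners ℝ E H) (J : ModelWithCorners ℝ E' H')
  {M : Type*} [TopologicalSpace M] [ChartedSpace H M]
  {N : Type*} [TopologicalSpace N] [ChartedSpace H' N]

/-- Smoothness of a `1`-form, as a section of the bundle with fibres `T_x M →L[ℝ] ℝ`. -/
def IsSmoothForm [IsManifold I ∞ M] (α : OneForm I M) : Prop :=
  ContMDiff I (I.prod 𝓘(ℝ, E →L[ℝ] ℝ)) ∞
    (fun x ↦ Bundle.TotalSpace.mk' (E →L[ℝ] ℝ) (E := fun x : M ↦ TangentSpace I x →L[ℝ] ℝ) x (α x))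

/-- The pullback `φ^* β`. -/
def pullback (φ : M → N) (β : OneForm J N) : OneForm I M :=
  fun x ↦ (β (φ x)).comp (mfderiv I J φ x)

/-- The expression of `α` in the preferred chart around `x`, as a `1`-form on (an open subset of)
the model vector space. -/
def formInChart (α : OneForm I M) (x : M) : E → E [⋀^Fin 1]→L[ℝ] ℝ :=
  fun y ↦ ContinuousAlternatingMap.ofSubsingleton ℝ E ℝ (0 : Fin 1)
    (pullback 𝓘(ℝ, E) I (extChartAt I x).symm α y)

/-- The exterior derivative `dα` at `x`, computed in the preferred chart around `x`. -/
def extDerivForm (α : OneForm I M) (x : M) : TangentSpace I x [⋀^Fin 2]→L[ℝ] ℝ :=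
  (extDeriv (formInChart I α x) (extChartAt I x x)).compContinuousLinearMap
    (mfderiv I 𝓘(ℝ, E) (extChartAt I x) x)

end Forms

/-- The value `(a ∧ b ∧ ⋯ ∧ b)(v₀, …, v₂ₙ)`, with `n` factors `b`, of the wedge product of a linear
form `a` and an alternating bilinear form `b`. -/
def wedgePow {V : Type*} [TopologicalSpace V] [AddCommGroup V] [Module ℝ V] (n : ℕ)
    (a : V →L[ℝ] ℝ) (b : V [⋀^Fin 2]→L[ℝ] ℝ) (v : Fin (2 * n + 1) → V) : ℝ :=
  (1 / 2 ^ n) * ∑ σ : Equiv.Perm (Fin (2 * n + 1)), ((Equiv.Perm.sign σ : ℤ) : ℝ) *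
    (a (v (σ 0)) * ∏ i : Fin n,
      b ![v (σ ⟨2 * i + 1, by omega⟩), v (σ ⟨2 * i + 2, by omega⟩)])

/-- A contact form on a manifold of dimension `2n + 1`: a smooth `1`-form `α` such that
`α ∧ (dα)^n` vanishes nowhere. -/
structure IsContactForm (n : ℕ) {M : Type*} [TopologicalSpace M]
    [ChartedSpace (EuclideanSpace ℝ (Fin (2 * n + 1))) M] [IsManifold (𝓡 (2 * n + 1)) ∞ M]
    (α : OneForm (𝓡 (2 * n + 1)) M) : Prop where
  smooth : IsSmoothForm (𝓡 (2 * n + 1)) α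
  wedge_ne_zero : ∀ x : M, ∃ v : Fin (2 * n + 1) → TangentSpace (𝓡 (2 * n + 1)) x,
    wedgePow n (α x) (extDerivForm (𝓡 (2 * n + 1)) α x) v ≠ 0

section Action

variable {E : Type*} [NormedAddCommGroup E] [NormedSpace ℝ E] {H : Type*} [TopologicalSpace H]
  (I : ModelWithCorners ℝ E H) {M : Type*} [TopologicalSpace M] [ChartedSpace H M]
  [MulAction Circle M]

/-- The vector field generating a circle action: the velocity of `t ↦ exp (it) • m` at `t = 0`. -/
def generator (m : M) : TangentSpace I m :=
  mfderiv 𝓘(ℝ, ℝ) I (fun t : ℝ ↦ Circle.exp t • m) 0 (1 : ℝ)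

/-- The moment map `m ↦ α (generator m)`. -/
def momentMap (α : OneForm I M) (m : M) : ℝ := α m (generator I m)

/-- The circle action preserves `α`. -/
def IsInvariantForm (α : OneForm I M) : Prop :=
  ∀ c : Circle, pullback I I (fun m ↦ c • m) α = α

end Action

section Cut

variable {M : Type*} [MulAction Circle M]

/-- On `{f ≥ 0}`: distinct points are identified iff they lie in `f⁻¹(0)` and on one circle orbit. -/
def cutSetoid (f : M → ℝ) : Setoid {m : M // 0 ≤ f m} where
  r x y := x = y ∨ (f x = 0 ∧ f y = 0 ∧ ∃ c : Circle, (x : M) = c • (y : M))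
  iseqv := by
    refine ⟨fun x ↦ Or.inl rfl, ?_, ?_⟩
    · rintro x y (h | ⟨hx, hy, c, hc⟩)
      · exact Or.inl h.symm
      · exact Or.inr ⟨hy, hx, c⁻¹, by rw [hc, inv_smul_smul]⟩
    · rintro x y z (h | ⟨hx, hy, c, hc⟩) (h' | ⟨hy', hz, d, hd⟩)
      · exact Or.inl (h.trans h')
      · exact Or.inr ⟨by rw [h]; exact hy', hz, d, by rw [h]; exact hd⟩
      · exact Or.inr ⟨hx, by rw [← h']; exact hy, c, by rw [← h']; exact hc⟩
      · exact Or.inr ⟨hx, hz, c * d, by rw [hc, hd, mul_smul]⟩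

/-- The cut `M_{[0,∞)}`. -/
def Cut (f : M → ℝ) : Type _ := Quotient (cutSetoid f)

/-- The class in the cut of a point with `0 ≤ f m`. -/
def Cut.mk (f : M → ℝ) (m : M) (hm : 0 ≤ f m) : Cut f := Quotient.mk (cutSetoid f) ⟨m, hm⟩

instance (f : M → ℝ) [TopologicalSpace M] : TopologicalSpace (Cut f) :=
  inferInstanceAs (TopologicalSpace (Quotient (cutSetoid f)))

/-- On the level set `f⁻¹(0)`: being on the same circle orbit. -/
def levelSetoid (f : M → ℝ) : Setoid {m : M | f m = 0} where
  r x y := ∃ c : Circle, (x : M) = c • (y : M)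
  iseqv := by
    refine ⟨fun x ↦ ⟨1, (one_smul _ _).symm⟩, ?_, ?_⟩
    · rintro x y ⟨c, hc⟩
      exact ⟨c⁻¹, by rw [hc, inv_smul_smul]⟩
    · rintro x y z ⟨c, hc⟩ ⟨d, hd⟩
      exact ⟨c * d, by rw [hc, hd, mul_smul]⟩

/-- The reduced space `M₀ = f⁻¹(0)/S¹`. -/
def ReducedSpace (f : M → ℝ) : Type _ := Quotient (levelSetoid f)

/-- The orbit map `f⁻¹(0) → f⁻¹(0)/S¹`. -/
def ReducedSpace.mk (f : M → ℝ) (m : {m : M | f m = 0}) : ReducedSpace f :=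
  Quotient.mk (levelSetoid f) m

instance (f : M → ℝ) [TopologicalSpace M] : TopologicalSpace (ReducedSpace f) :=
  inferInstanceAs (TopologicalSpace (Quotient (levelSetoid f)))

/-- The natural map `f⁻¹(0)/S¹ → M_{[0,∞)}`, `[m] ↦ [m]`. -/
def reducedToCut (f : M → ℝ) : ReducedSpace f → Cut f :=
  Quotient.lift (s := levelSetoid f) (fun m ↦ Cut.mk f m (le_of_eq m.2.symm))
    (fun x y h ↦ Quotient.sound (s := cutSetoid f) (Or.inr ⟨x.2, y.2, h⟩))

/-- The level set `Ψ⁻¹(0) ⊆ M × ℂ` of `Ψ (m, z) = f m - |z|²`. -/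
def extendedLevel (f : M → ℝ) : Set (M × ℂ) := {p | f p.1 - ‖p.2‖ ^ 2 = 0}

end Cut

/-- The real `1`-form `(√-1 / 2) (z dz̄ - z̄ dz) = x dy - y dx` on `ℂ`. -/
def planeForm : OneForm 𝓘(ℝ, ℂ) ℂ := fun z ↦
  Complex.reCLM.comp ((Complex.I / 2) •
    (z • (Complex.conjCLE : ℂ →L[ℝ] ℂ) - (starRingEnd ℂ z) • ContinuousLinearMap.id ℝ ℂ))

/-- The `1`-form `α + (√-1 / 2) (z dz̄ - z̄ dz)` on `M × ℂ`. -/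
def extendedForm {E : Type*} [NormedAddCommGroup E] [NormedSpace ℝ E] {H : Type*}
    [TopologicalSpace H] (I : ModelWithCorners ℝ E H) {M : Type*} [TopologicalSpace M]
    [ChartedSpace H M] (α : OneForm I M) : OneForm (I.prod 𝓘(ℝ, ℂ)) (M × ℂ) := fun p ↦
  pullback (I.prod 𝓘(ℝ, ℂ)) I Prod.fst α p +
    pullback (I.prod 𝓘(ℝ, ℂ)) 𝓘(ℝ, ℂ) Prod.snd planeForm p

/-- The restriction to `Z` of a `1`-form `A` on `N` descends to `β` along `q : Z → Q`: the set `Z`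
is an embedded submanifold of `N`, the map `q` is a submersion with one-dimensional fibres from this
submanifold to `Q`, and `q^* β = A|_Z`. -/
def DescendsTo {E : Type*} [NormedAddCommGroup E] [NormedSpace ℝ E] {H : Type*}
    [TopologicalSpace H] (I : ModelWithCorners ℝ E H) {N : Type*} [TopologicalSpace N]
    [ChartedSpace H N] (A : OneForm I N) (Z : Set N) {d : ℕ} {Q : Type*} [TopologicalSpace Q]
    [ChartedSpace (EuclideanSpace ℝ (Fin d)) Q] (q : Z → Q) (β : OneForm (𝓡 d) Q) : Prop :=
  ∃ (_ : ChartedSpace (EuclideanSpace ℝ (Fin (d + 1))) Z),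
    IsManifold (𝓡 (d + 1)) ∞ Z ∧
    Manifold.IsSmoothEmbedding (𝓡 (d + 1)) I ∞ (Subtype.val : Z → N) ∧
    Manifold.IsSubmersion (𝓡 (d + 1)) (𝓡 d) ∞ q ∧
    pullback (𝓡 (d + 1)) (𝓡 d) q β = pullback (𝓡 (d + 1)) I (Subtype.val : Z → N) A

end ContactCut

end

/-! Both $M_0$ and the cut are instances of one construction: the quotient of the zero level of a
moment map $\Psi$ by a circle action preserving a 1-form (`HamAction`, `Reduction`). It is applied
to $f$ on $M$ and to $f-|z|^2$ on $M\times\mathbb{C}$.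

In coordinates $(t,y)\mapsto e^{it}\kappa(y)$ the invariant form is $\Psi\,dt+\kappa^*\alpha$, with
coefficients independent of $t$ (`HamAction.localForm_exp`). Hence $d\alpha(X,\cdot)=-d\Psi$
(`HamAction.extD_localForm_exp`). At a point of $f^{-1}(0)$ freeness gives $X\ne 0$. If $df$
vanished there, $X$ would lie in the kernels of both $\alpha$ and $d\alpha$, which is impossible for
a contact form (`HamAction.fderiv_Ψ_ne_zero`). So $0$ is a regular value, and the inverse function
theorem together with compactness of the circle yields a `Slice`: equivariant coordinates (value of
$\Psi$, invariant coordinate $w$, angle) near an orbit (`HamAction.exists_slice`).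

Slices give everything about a reduction. The pair ($w$, angle) is a chart of the level set and $w$
is a chart of the quotient, so the orbit map is a linear projection. On the level set the
$dt$-coefficient $\Psi$ is zero, so the form is pulled back through $w$ and descends
(`Slice.localForm_eq`). The quotient is Hausdorff because the circle is compact.

On $M\times\mathbb{C}$ the slices are explicit. Over $z=0$ a slice of $M$ gives one with invariant
coordinates $(w,\mathrm{ang}\cdot z)$ (`Slice.extended`). Over $z\neq 0$ each orbit is normalised to
$z>0$, which leaves a chart of $M$ (`Slice.ofChart`). The form $x\,dy-y\,dx$ vanishes on the real
axis, so in the second kind $\beta$ is $\alpha$ itself; this is the contactomorphism on $\{f>0\}$.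
In the first kind $M_0$ is the locus $z=0$, and there $\beta$ restricts to $\alpha_0$.

It remains to see that $\alpha_0$ and $\beta$ are contact. Contracting $\alpha\wedge(d\alpha)^{k+1}$
with $X$ and a vector transverse to the level leaves a nonzero multiple of
$\alpha_0\wedge(d\alpha_0)^k$ (`Slice.exists_wedgePow_κ₀_ne_zero`). At $z=0$ the differential of
$|z|^2$ vanishes, so there $d\beta=d\alpha_0+2\,dx\wedge dy$, and the same contraction formula
`wedgePow_succ` gives nondegeneracy (`Slice.exists_wedgePow_extended_ne_zero`).

The topology of the cut is that of a quotient of $\{f\ge 0\}$, so its identification with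
$\Psi^{-1}(0)/S^1$ needs an argument of its own (`continuous_cutMap`, `cutReduction`). -/

noncomputable section

namespace ContactCut

/-! ### Linear algebra of $a\wedge b^n$ -/

section Wedge

variable {V : Type*} [TopologicalSpace V] [AddCommGroup V] [Module ℝ V]

theorem form_swap (b : V [⋀^Fin 2]→L[ℝ] ℝ) (x y : V) : b ![x, y] = -b ![y, x] := by
  have h := b.toAlternatingMap.map_swap ![y, x] (i := 0) (j := 1) (by decide)
  have h' : (![y, x] : Fin 2 → V) ∘ Equiv.swap (0 : Fin 2) 1 = ![x, y] := by
    funext i; fin_cases i <;> simp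
  rw [h'] at h
  exact h

theorem form_isLinear_left (b : V [⋀^Fin 2]→L[ℝ] ℝ) (y : V) :
    IsLinearMap ℝ (fun x ↦ b ![x, y]) where
  map_add x x' := by
    have h := b.toAlternatingMap.map_update_add ![0, y] 0 x x'
    have hu : ∀ z : V, Function.update ![0, y] 0 z = ![z, y] := fun z ↦ by
      funext i; fin_cases i <;> simp
    rwa [hu, hu, hu] at h
  map_smul c x := by
    have h := b.toAlternatingMap.map_update_smul ![0, y] 0 c x
    have hu : ∀ z : V, Function.update ![0, y] 0 z = ![z, y] := fun z ↦ by
      funext i; fin_cases i <;> simp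
    rwa [hu, hu] at h

theorem form_isLinear_right (b : V [⋀^Fin 2]→L[ℝ] ℝ) (y : V) :
    IsLinearMap ℝ (fun x ↦ b ![y, x]) where
  map_add x x' := by
    rw [form_swap b y, (form_isLinear_left b y).map_add, form_swap b x, form_swap b x']; ring
  map_smul c x := by
    rw [form_swap b y, (form_isLinear_left b y).map_smul, form_swap b x]; simp

/-- The multilinear form `a ⊗ b ⊗ ⋯ ⊗ b` whose alternatization is the wedge product. -/
def tensorFun (n : ℕ) (a : V →L[ℝ] ℝ) (b : V [⋀^Fin 2]→L[ℝ] ℝ) (v : Fin (2 * n + 1) → V) : ℝ :=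
  a (v 0) * ∏ i : Fin n, b ![v ⟨2 * i + 1, by omega⟩, v ⟨2 * i + 2, by omega⟩]

theorem fin_odd_cases {n : ℕ} (j : Fin (2 * n + 1)) :
    j = 0 ∨ (∃ i : Fin n, j = ⟨2 * i + 1, by omega⟩) ∨ ∃ i : Fin n, j = ⟨2 * i + 2, by omega⟩ := by
  rcases Nat.eq_zero_or_pos j.1 with h | h
  · exact Or.inl (Fin.ext h)
  · rcases Nat.even_or_odd' j.1 with ⟨m, hm | hm⟩
    · exact Or.inr (Or.inr ⟨⟨m - 1, by omega⟩, Fin.ext (by simp; omega)⟩)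
    · exact Or.inr (Or.inl ⟨⟨m, by omega⟩, Fin.ext (by simp; omega)⟩)

theorem tensorFun_update_isLinear (n : ℕ) (a : V →L[ℝ] ℝ) (b : V [⋀^Fin 2]→L[ℝ] ℝ)
    (v : Fin (2 * n + 1) → V) (j : Fin (2 * n + 1)) :
    IsLinearMap ℝ (fun x ↦ tensorFun n a b (Function.update v j x)) := by
  have key : ∀ g : V → ℝ, IsLinearMap ℝ g → ∀ c : ℝ, IsLinearMap ℝ (fun x ↦ g x * c) :=
    fun g hg c ↦ ⟨fun x y ↦ by rw [hg.map_add, add_mul],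
      fun r x ↦ by rw [hg.map_smul, smul_mul_assoc]⟩
  rcases fin_odd_cases j with rfl | ⟨i, rfl⟩ | ⟨i, rfl⟩
  · have h : (fun x ↦ tensorFun n a b (Function.update v 0 x)) = fun x ↦ a x *
        ∏ i : Fin n, b ![v ⟨2 * i + 1, by omega⟩, v ⟨2 * i + 2, by omega⟩] := by
      funext x
      simp only [tensorFun, Function.update_self]
      congr 1
    rw [h]
    exact key a a.toLinearMap.isLinear _
  · have h : (fun x ↦ tensorFun n a b (Function.update v ⟨2 * i + 1, by omega⟩ x)) = fun x ↦
        b ![x, v ⟨2 * i + 2, by omega⟩] * (a (v 0) * ∏ l ∈ Finset.univ.erase i,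
          b ![v ⟨2 * l + 1, by omega⟩, v ⟨2 * l + 2, by omega⟩]) := by
      funext x
      simp only [tensorFun]
      rw [← Finset.mul_prod_erase _ _ (Finset.mem_univ i), Function.update_self,
        Function.update_of_ne (by simp [Fin.ext_iff]), Function.update_of_ne (by simp [Fin.ext_iff]),
        mul_left_comm]
      congr 2
      refine Finset.prod_congr rfl fun l hl ↦ ?_
      have hl' : (l : ℕ) ≠ i := fun h ↦ (Finset.ne_of_mem_erase hl) (Fin.ext h)
      rw [Function.update_of_ne (by simp [Fin.ext_iff]; omega),
        Function.update_of_ne (by simp [Fin.ext_iff]; omega)]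
    rw [h]
    exact key _ (form_isLinear_left b _) _
  · have h : (fun x ↦ tensorFun n a b (Function.update v ⟨2 * i + 2, by omega⟩ x)) = fun x ↦
        b ![v ⟨2 * i + 1, by omega⟩, x] * (a (v 0) * ∏ l ∈ Finset.univ.erase i,
          b ![v ⟨2 * l + 1, by omega⟩, v ⟨2 * l + 2, by omega⟩]) := by
      funext x
      simp only [tensorFun]
      rw [← Finset.mul_prod_erase _ _ (Finset.mem_univ i), Function.update_self,
        Function.update_of_ne (by simp [Fin.ext_iff]), Function.update_of_ne (by simp [Fin.ext_iff]),
        mul_left_comm]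
      congr 2
      refine Finset.prod_congr rfl fun l hl ↦ ?_
      have hl' : (l : ℕ) ≠ i := fun h ↦ (Finset.ne_of_mem_erase hl) (Fin.ext h)
      rw [Function.update_of_ne (by simp [Fin.ext_iff]; omega),
        Function.update_of_ne (by simp [Fin.ext_iff]; omega)]
    rw [h]
    exact key _ (form_isLinear_right b _) _

/-- `wedgePow` as an alternating map. -/
def wedgeAlt (n : ℕ) (a : V →L[ℝ] ℝ) (b : V [⋀^Fin 2]→L[ℝ] ℝ) :
    V [⋀^Fin (2 * n + 1)]→ₗ[ℝ] ℝ :=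
  (1 / 2 ^ n : ℝ) • MultilinearMap.alternatization (MultilinearMap.mk' (tensorFun n a b)
    (fun v j x y ↦ (tensorFun_update_isLinear n a b v j).map_add x y)
    (fun v j c x ↦ (tensorFun_update_isLinear n a b v j).map_smul c x))

theorem wedgePow_eq_sum (n : ℕ) (a : V →L[ℝ] ℝ) (b : V [⋀^Fin 2]→L[ℝ] ℝ)
    (v : Fin (2 * n + 1) → V) :
    wedgePow n a b v = (1 / 2 ^ n) * ∑ σ : Equiv.Perm (Fin (2 * n + 1)),
      ((Equiv.Perm.sign σ : ℤ) : ℝ) * tensorFun n a b (v ∘ σ) := rfl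

theorem wedgeAlt_apply (n : ℕ) (a : V →L[ℝ] ℝ) (b : V [⋀^Fin 2]→L[ℝ] ℝ)
    (v : Fin (2 * n + 1) → V) : wedgeAlt n a b v = wedgePow n a b v := by
  rw [wedgePow_eq_sum, wedgeAlt, AlternatingMap.smul_apply, MultilinearMap.alternatization_apply,
    smul_eq_mul]
  congr 1
  refine Finset.sum_congr rfl fun σ _ ↦ ?_
  rw [Units.smul_def, zsmul_eq_mul]
  rfl

/-- In top degree an alternating form is a multiple of the determinant of the basis, so one value
decides whether it is zero. -/
theorem wedgePow_eq_zero_of_basis {n : ℕ} {a : V →L[ℝ] ℝ} {b : V [⋀^Fin 2]→L[ℝ] ℝ}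
    (e : Module.Basis (Fin (2 * n + 1)) ℝ V) (h : wedgePow n a b e = 0)
    (v : Fin (2 * n + 1) → V) : wedgePow n a b v = 0 := by
  have : wedgeAlt n a b = 0 := by
    rw [(wedgeAlt n a b).eq_smul_basis_det e, wedgeAlt_apply, h, zero_smul]
  rw [← wedgeAlt_apply, this, AlternatingMap.zero_apply]

/-- Allows the contact condition, given by some unknown tuple, to be evaluated on a frame adapted to
the circle action. -/
theorem wedgePow_ne_zero_of_linearIndependent {n : ℕ} {a : V →L[ℝ] ℝ} {b : V [⋀^Fin 2]→L[ℝ] ℝ}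
    (hV : Module.finrank ℝ V = 2 * n + 1) {v : Fin (2 * n + 1) → V} (hv : wedgePow n a b v ≠ 0)
    {e : Fin (2 * n + 1) → V} (he : LinearIndependent ℝ e) : wedgePow n a b e ≠ 0 := by
  intro h
  have : Nonempty (Fin (2 * n + 1)) := ⟨0⟩
  refine hv (wedgePow_eq_zero_of_basis
    (basisOfLinearIndependentOfCardEqFinrank he (by simp [hV])) ?_ v)
  rwa [coe_basisOfLinearIndependentOfCardEqFinrank]

theorem tensorFun_eq_zero_of_kernel {n : ℕ} {a : V →L[ℝ] ℝ} {b : V [⋀^Fin 2]→L[ℝ] ℝ} {x : V}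
    (ha : a x = 0) (hb : ∀ y, b ![x, y] = 0) {v : Fin (2 * n + 1) → V} {j : Fin (2 * n + 1)}
    (hj : v j = x) : tensorFun n a b v = 0 := by
  rcases fin_odd_cases j with rfl | ⟨i, rfl⟩ | ⟨i, rfl⟩
  · rw [tensorFun, hj, ha, zero_mul]
  · rw [tensorFun, Finset.prod_eq_zero (Finset.mem_univ i), mul_zero]
    rw [hj, hb]
  · rw [tensorFun, Finset.prod_eq_zero (Finset.mem_univ i), mul_zero]
    rw [hj, form_swap, hb, neg_zero]

theorem wedgePow_eq_zero_of_mem_kernel {n : ℕ} {a : V →L[ℝ] ℝ} {b : V [⋀^Fin 2]→L[ℝ] ℝ}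
    {x : V} (ha : a x = 0) (hb : ∀ y, b ![x, y] = 0) {v : Fin (2 * n + 1) → V}
    {j : Fin (2 * n + 1)} (hj : v j = x) : wedgePow n a b v = 0 := by
  rw [wedgePow_eq_sum, Finset.sum_eq_zero, mul_zero]
  intro σ _
  rw [tensorFun_eq_zero_of_kernel ha hb (j := σ.symm j) (by simp [hj]), mul_zero]

/-- A nonzero vector in the kernel of `a` and of `b` makes `a ∧ bⁿ` vanish. -/
theorem wedgePow_eq_zero_of_kernel {n : ℕ} {a : V →L[ℝ] ℝ} {b : V [⋀^Fin 2]→L[ℝ] ℝ}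
    (hV : Module.finrank ℝ V = 2 * n + 1) {x : V} (hx : x ≠ 0) (ha : a x = 0)
    (hb : ∀ y, b ![x, y] = 0) (v : Fin (2 * n + 1) → V) : wedgePow n a b v = 0 := by
  have : FiniteDimensional ℝ V := Module.finite_of_finrank_pos (by omega)
  -- Complete `x` to a basis: the form vanishes on it because one argument lies in both kernels,
  -- hence it vanishes identically.
  have hli : LinearIndepOn ℝ id ({x} : Set V) := LinearIndepOn.singleton (by simpa using hx)
  let B := Module.Basis.extend hli
  have hxm : x ∈ hli.extend (subset_univ _) := hli.subset_extend _ (mem_singleton x)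
  have : Fintype (hli.extend (subset_univ _)) := FiniteDimensional.fintypeBasisIndex B
  have hc : Fintype.card (hli.extend (subset_univ _)) = Fintype.card (Fin (2 * n + 1)) := by
    rw [← Module.finrank_eq_card_basis B, hV, Fintype.card_fin]
  let ε := Fintype.equivOfCardEq hc
  refine wedgePow_eq_zero_of_basis (B.reindex ε) ?_ v
  refine wedgePow_eq_zero_of_mem_kernel ha hb (j := ε ⟨x, hxm⟩) ?_
  simp [B]

theorem swap_apply_of_val_ne {m : ℕ} {p r x : Fin m} (h : (x : ℕ) ≠ p) (h' : (x : ℕ) ≠ r) :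
    Equiv.swap p r x = x :=
  Equiv.swap_apply_of_ne_of_ne (fun e ↦ h (congrArg _ e)) (fun e ↦ h' (congrArg _ e))

/-- The sign cancels against the sign of the transposition, so signed terms are unchanged by swaps
inside a pair. -/
theorem tensorFun_comp_swap {n : ℕ} (a : V →L[ℝ] ℝ) (b : V [⋀^Fin 2]→L[ℝ] ℝ)
    (v : Fin (2 * n + 1) → V) (i : Fin n) :
    tensorFun n a b (v ∘ Equiv.swap ⟨2 * i + 1, by omega⟩ ⟨2 * i + 2, by omega⟩) =
      -tensorFun n a b v := by
  simp only [tensorFun, Function.comp]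
  rw [← Finset.mul_prod_erase _ _ (Finset.mem_univ i), ← Finset.mul_prod_erase _ _
    (Finset.mem_univ i), ← mul_neg, ← neg_mul, ← form_swap, Equiv.swap_apply_left,
    Equiv.swap_apply_right]
  congr 2
  refine Finset.prod_congr rfl fun l hl ↦ ?_
  have hl' : (l : ℕ) ≠ i := fun h ↦ (Finset.ne_of_mem_erase hl) (Fin.ext h)
  rw [swap_apply_of_val_ne (by simp; omega) (by simp; omega),
    swap_apply_of_val_ne (by simp; omega) (by simp; omega)]

/-- The permutation of `0, …, 2n` that exchanges the pairs `(2i+1, 2i+2)` and `(2j+1, 2j+2)`. -/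
def pairSwap {n : ℕ} (i j : Fin n) : Equiv.Perm (Fin (2 * n + 1)) :=
  Equiv.swap ⟨2 * i + 1, by omega⟩ ⟨2 * j + 1, by omega⟩ *
    Equiv.swap ⟨2 * i + 2, by omega⟩ ⟨2 * j + 2, by omega⟩

theorem pairSwap_zero {n : ℕ} (i j : Fin n) : pairSwap i j 0 = 0 := by
  have h := swap_apply_of_val_ne (p := (⟨2 * i + 2, by omega⟩ : Fin (2 * n + 1)))
    (r := ⟨2 * j + 2, by omega⟩) (x := 0) (by simp) (by simp)
  rw [pairSwap, Equiv.Perm.mul_apply, h, swap_apply_of_val_ne (by simp) (by simp)]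

theorem pairSwap_odd {n : ℕ} (i j l : Fin n) :
    pairSwap i j ⟨2 * l + 1, by omega⟩ = ⟨2 * (Equiv.swap i j l : Fin n) + 1, by omega⟩ := by
  have h := swap_apply_of_val_ne (p := (⟨2 * i + 2, by omega⟩ : Fin (2 * n + 1)))
    (r := ⟨2 * j + 2, by omega⟩) (x := ⟨2 * l + 1, by omega⟩) (by simp; omega) (by simp; omega)
  rw [pairSwap, Equiv.Perm.mul_apply, h]
  simp only [Equiv.swap_apply_def, Fin.ext_iff]
  split_ifs <;> simp_all

theorem pairSwap_even {n : ℕ} (i j l : Fin n) :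
    pairSwap i j ⟨2 * l + 2, by omega⟩ = ⟨2 * (Equiv.swap i j l : Fin n) + 2, by omega⟩ := by
  have h : Equiv.swap (⟨2 * i + 2, by omega⟩ : Fin (2 * n + 1)) ⟨2 * j + 2, by omega⟩
      ⟨2 * l + 2, by omega⟩ = ⟨2 * (Equiv.swap i j l : Fin n) + 2, by omega⟩ := by
    simp only [Equiv.swap_apply_def, Fin.ext_iff]
    split_ifs <;> simp_all
  rw [pairSwap, Equiv.Perm.mul_apply, h, swap_apply_of_val_ne (by simp; omega) (by simp; omega)]

theorem sign_pairSwap {n : ℕ} (i j : Fin n) : Equiv.Perm.sign (pairSwap i j) = 1 := by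
  rcases eq_or_ne i j with rfl | h
  · simp [pairSwap]
  · have h' : (i : ℕ) ≠ j := fun h' ↦ h (Fin.ext h')
    rw [pairSwap, Equiv.Perm.sign_mul, Equiv.Perm.sign_swap (by simp [Fin.ext_iff]; omega),
      Equiv.Perm.sign_swap (by simp [Fin.ext_iff]; omega)]
    simp

theorem tensorFun_comp_pairSwap {n : ℕ} (a : V →L[ℝ] ℝ) (b : V [⋀^Fin 2]→L[ℝ] ℝ)
    (v : Fin (2 * n + 1) → V) (i j : Fin n) :
    tensorFun n a b (v ∘ pairSwap i j) = tensorFun n a b v := by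
  simp only [tensorFun, Function.comp, pairSwap_zero, pairSwap_odd, pairSwap_even]
  congr 1
  exact Equiv.prod_comp (Equiv.swap i j)
    (fun l : Fin n ↦ b ![v ⟨2 * l + 1, by omega⟩, v ⟨2 * l + 2, by omega⟩])

/-- The contraction of `a ∧ b^(k+1)` with two vectors `X, Y` such that `a X = 0` and `b (X, ·)`
vanishes on the remaining arguments. -/
theorem wedgePow_succ {k : ℕ} {a : V →L[ℝ] ℝ} {b : V [⋀^Fin 2]→L[ℝ] ℝ}
    {v : Fin (2 * (k + 1) + 1) → V} {x y : V} (hx : v ⟨2 * k + 1, by omega⟩ = x)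
    (hy : v ⟨2 * k + 2, by omega⟩ = y) (ha : a x = 0)
    (hb : ∀ i : Fin (2 * k + 1), b ![x, v (i.castLE (by omega))] = 0) :
    wedgePow (k + 1) a b v =
      (k + 1) * b ![x, y] * wedgePow k a b (fun i ↦ v (i.castLE (by omega))) := by
  set X : Fin (2 * (k + 1) + 1) := ⟨2 * k + 1, by omega⟩ with hX
  set Y : Fin (2 * (k + 1) + 1) := ⟨2 * k + 2, by omega⟩ with hY
  -- The signed summand of the wedge product. It is invariant under exchanging pairs and under
  -- swapping inside a pair.
  set T : Equiv.Perm (Fin (2 * (k + 1) + 1)) → ℝ := fun σ ↦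
    ((Equiv.Perm.sign σ : ℤ) : ℝ) * tensorFun (k + 1) a b (v ∘ σ) with hT
  have hbxx : b ![x, x] = 0 := by
    have := form_swap b x x
    linarith
  have hXY : X ≠ Y := by simp [hX, hY]
  have hTp : ∀ σ i j, T (σ * pairSwap i j) = T σ := by
    intro σ i j
    simp only [hT, Equiv.Perm.sign_mul, sign_pairSwap, mul_one, Equiv.Perm.coe_mul]
    rw [← Function.comp_assoc, tensorFun_comp_pairSwap]
  have hTs : ∀ σ (i : Fin (k + 1)),
      T (σ * Equiv.swap ⟨2 * i + 1, by omega⟩ ⟨2 * i + 2, by omega⟩) = T σ := by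
    intro σ i
    simp only [hT, Equiv.Perm.sign_mul, Equiv.Perm.coe_mul]
    rw [← Function.comp_assoc, tensorFun_comp_swap, Equiv.Perm.sign_swap (by simp)]
    simp
  -- These symmetries act transitively on the positions $1,\dots,2k+2$, so every position of the
  -- argument `x` other than $0$ contributes the same amount.
  have hg : ∀ p : Fin (2 * (k + 1) + 1), p ≠ 0 → ∃ g : Equiv.Perm (Fin (2 * (k + 1) + 1)),
      g X = p ∧ ∀ σ, T (σ * g) = T σ := by
    intro p hp
    have h1 : ∀ i : Fin (k + 1), pairSwap i (Fin.last k) X = ⟨2 * i + 1, by omega⟩ := by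
      intro i
      have := pairSwap_odd i (Fin.last k) (Fin.last k)
      simpa [hX] using this
    have h2 : ∀ i : Fin (k + 1), pairSwap i (Fin.last k) Y = ⟨2 * i + 2, by omega⟩ := by
      intro i
      have := pairSwap_even i (Fin.last k) (Fin.last k)
      simpa [hY] using this
    rcases fin_odd_cases p with rfl | ⟨i, rfl⟩ | ⟨i, rfl⟩
    · exact absurd rfl hp
    · exact ⟨pairSwap i (Fin.last k), h1 i, fun σ ↦ hTp σ _ _⟩
    · refine ⟨pairSwap i (Fin.last k) * Equiv.swap X Y, ?_, fun σ ↦ ?_⟩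
      · rw [Equiv.Perm.mul_apply, Equiv.swap_apply_left, h2]
      · rw [← mul_assoc]
        exact (hTs _ (Fin.last k)).trans (hTp σ _ _)
  have hfib : ∀ p : Fin (2 * (k + 1) + 1), p ≠ 0 →
      ∑ σ with σ.symm X = p, T σ = ∑ σ with σ X = X, T σ := by
    intro p hp
    obtain ⟨g, hgX, hgT⟩ := hg p hp
    refine Finset.sum_bij' (fun σ _ ↦ σ * g) (fun σ _ ↦ σ * g⁻¹) ?_ ?_ (by simp) (by simp)
      (fun σ _ ↦ (hgT σ).symm)
    · intro σ hσ
      simp only [Finset.mem_filter, Finset.mem_univ, true_and] at hσ ⊢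
      rw [Equiv.Perm.mul_apply, hgX, ← hσ, Equiv.apply_symm_apply]
    · intro σ hσ
      simp only [Finset.mem_filter, Finset.mem_univ, true_and] at hσ ⊢
      rw [Equiv.symm_apply_eq, Equiv.Perm.mul_apply, ← hgX, Equiv.Perm.inv_def,
        Equiv.symm_apply_apply, hσ]
  -- With `x` in position $0$ the factor $a(x)=0$ appears.
  have hfib0 : ∑ σ with σ.symm X = 0, T σ = 0 := by
    refine Finset.sum_eq_zero fun σ hσ ↦ ?_
    simp only [Finset.mem_filter, Finset.mem_univ, true_and] at hσ
    rw [Equiv.symm_apply_eq] at hσ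
    simp only [hT, tensorFun, Function.comp, ← hσ, hx, ha, zero_mul, mul_zero]
  have hsum : ∑ σ, T σ = (2 * k + 2) * ∑ σ with σ X = X, T σ := by
    rw [← Finset.sum_fiberwise Finset.univ (fun σ : Equiv.Perm (Fin (2 * (k + 1) + 1)) ↦ σ.symm X),
      Fin.sum_univ_succ, hfib0, Finset.sum_congr rfl (fun p _ ↦ hfib _ (Fin.succ_ne_zero p))]
    simp [mul_add]
  -- With `x` in the first slot of the last pair, its partner is `y` or one of the first $2k+1$
  -- vectors; the latter are killed by $b(x,\cdot)$.
  have hsub : ∑ σ with σ X = X, T σ = ∑ σ with σ X = X ∧ σ Y = Y, T σ := by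
    symm
    refine Finset.sum_subset (fun σ hσ ↦ ?_) (fun σ hσ hσ' ↦ ?_)
    · simp only [Finset.mem_filter, Finset.mem_univ, true_and] at hσ ⊢
      exact hσ.1
    · simp only [Finset.mem_filter, Finset.mem_univ, true_and, not_and] at hσ hσ'
      have h1 : σ Y ≠ X := fun h ↦ hXY (σ.injective (hσ.trans h.symm))
      have h2 := hσ' hσ
      have hlt : (σ Y : ℕ) < 2 * k + 1 := by
        have := (σ Y).2
        have h1' : (σ Y : ℕ) ≠ 2 * k + 1 := fun h ↦ h1 (Fin.ext h)
        have h2' : (σ Y : ℕ) ≠ 2 * k + 2 := fun h ↦ h2 (Fin.ext h)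
        omega
      have h3 : b ![x, v (σ Y)] = 0 := hb ⟨σ Y, hlt⟩
      have h4 : tensorFun (k + 1) a b (v ∘ σ) = 0 := by
        rw [tensorFun, Finset.prod_eq_zero (Finset.mem_univ (Fin.last k)), mul_zero]
        have : b ![v (σ X), v (σ Y)] = 0 := by rw [hσ, hx, h3]
        exact this
      simp only [hT, h4, mul_zero]
  have hbij : ∑ σ with σ X = X ∧ σ Y = Y, T σ = b ![x, y] *
      ∑ ρ : Equiv.Perm (Fin (2 * k + 1)), ((Equiv.Perm.sign ρ : ℤ) : ℝ) *
        tensorFun k a b ((fun i ↦ v (i.castLE (by omega))) ∘ ρ) := by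
    -- Permutations fixing the last two indices are exactly the `ρ ⊕ 1` with `ρ` a permutation of
    -- the first $2k+1$.
    let e : Fin (2 * k + 1) ⊕ Fin 2 ≃ Fin (2 * (k + 1) + 1) := finSumFinEquiv
    have heX : e (Sum.inr 0) = X := rfl
    have heY : e (Sum.inr 1) = Y := rfl
    have hel : ∀ i, e (Sum.inl i) = i.castLE (by omega) := fun i ↦ rfl
    have hφr : ∀ (ρ : Equiv.Perm (Fin (2 * k + 1))) j,
        e.permCongr (Equiv.Perm.sumCongr ρ 1) (e (Sum.inr j)) = e (Sum.inr j) := by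
      intro ρ j; simp [Equiv.permCongr_apply]
    have hφl : ∀ (ρ : Equiv.Perm (Fin (2 * k + 1))) j,
        e.permCongr (Equiv.Perm.sumCongr ρ 1) (j.castLE (by omega)) =
          (ρ j).castLE (by omega) := by
      intro ρ j; rw [← hel, ← hel]; simp [Equiv.permCongr_apply]
    rw [Finset.mul_sum]
    symm
    refine Finset.sum_bij (fun ρ _ ↦ e.permCongr (Equiv.Perm.sumCongr ρ 1)) ?_ ?_ ?_ ?_
    · intro ρ _
      simp only [Finset.mem_filter, Finset.mem_univ, true_and]
      rw [← heX, ← heY]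
      exact ⟨hφr ρ 0, hφr ρ 1⟩
    · intro ρ _ ρ' _ h
      ext j
      have := congrArg (fun g : Equiv.Perm (Fin (2 * (k + 1) + 1)) ↦ g (j.castLE (by omega))) h
      simp only [hφl] at this
      simpa [Fin.ext_iff] using this
    · intro σ hσ
      simp only [Finset.mem_filter, Finset.mem_univ, true_and] at hσ
      set τ := e.symm.permCongr σ with hτ
      have hτr : ∀ j, τ (Sum.inr j) = Sum.inr j := by
        intro j
        rw [hτ, Equiv.permCongr_apply, Equiv.symm_symm, Equiv.symm_apply_eq]
        fin_cases j
        · exact hσ.1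
        · exact hσ.2
      have hmaps : MapsTo τ (range (Sum.inl : Fin (2 * k + 1) → Fin (2 * k + 1) ⊕ Fin 2))
          (range Sum.inl) := by
        rintro _ ⟨j, rfl⟩
        rcases h : τ (Sum.inl j) with i | i
        · exact ⟨i, rfl⟩
        · exact absurd (τ.injective (h.trans (hτr i).symm)) (by simp)
      obtain ⟨⟨ρ, ρ'⟩, hρ⟩ := Equiv.Perm.mem_sumCongrHom_range_of_perm_mapsTo_inl hmaps
      have hρ1 : ρ' = 1 := by
        ext1 j
        have := hτr j
        rw [← hρ] at this
        simpa using this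
      refine ⟨ρ, Finset.mem_univ _, ?_⟩
      have h1 : Equiv.Perm.sumCongr ρ 1 = τ := by
        rw [← hρ, hρ1]; rfl
      rw [h1, hτ]
      ext j; simp [Equiv.permCongr_apply]
    · intro ρ _
      simp only [hT, Equiv.Perm.sign_permCongr, Equiv.Perm.sign_sumCongr, Equiv.Perm.sign_one,
        mul_one]
      rw [mul_left_comm]
      congr 1
      simp only [tensorFun]
      rw [Fin.prod_univ_castSucc, ← mul_assoc (a _), mul_comm (b ![x, y])]
      have hl : b ![(v ∘ e.permCongr (Equiv.Perm.sumCongr ρ 1)) X,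
          (v ∘ e.permCongr (Equiv.Perm.sumCongr ρ 1)) Y] = b ![x, y] := by
        simp only [Function.comp]
        rw [← heX, ← heY, hφr, hφr, heX, heY, hx, hy]
      have h0 : (v ∘ e.permCongr (Equiv.Perm.sumCongr ρ 1)) 0 =
          v ((ρ 0).castLE (by omega)) := by
        simp only [Function.comp]
        rw [← hφl ρ 0]; rfl
      have h1 : ∀ j : Fin (2 * k + 1), (v ∘ e.permCongr (Equiv.Perm.sumCongr ρ 1))
          (j.castLE (by omega)) = v ((ρ j).castLE (by omega)) := by
        intro j
        simp only [Function.comp]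
        rw [hφl]
      refine congrArg₂ (· * ·) ?_ hl.symm
      refine congrArg₂ (· * ·) (congrArg a h0.symm) ?_
      refine Finset.prod_congr rfl fun i _ ↦ ?_
      refine congrArg b ?_
      refine congrArg₂ (fun p q ↦ ![p, q]) (h1 _).symm (h1 _).symm
  rw [wedgePow_eq_sum, wedgePow_eq_sum]
  change 1 / 2 ^ (k + 1) * ∑ σ, T σ = _
  -- The constant is $(2k+2)/2^{k+1}=(k+1)/2^k$.
  rw [hsum, hsub, hbij]
  field_simp
  ring

end Wedge

end ContactCut

end

/-! ### 1-forms in coordinates and naturality of the exterior derivative -/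

noncomputable section

namespace ContactCut

section Forms

open Filter Topology Bundle

variable {E : Type*} [NormedAddCommGroup E] [NormedSpace ℝ E] {H : Type*} [TopologicalSpace H]
  {I : ModelWithCorners ℝ E H} {M : Type*} [TopologicalSpace M] [ChartedSpace H M]
  {E' : Type*} [NormedAddCommGroup E'] [NormedSpace ℝ E'] {H' : Type*} [TopologicalSpace H']
  {J : ModelWithCorners ℝ E' H'} {N : Type*} [TopologicalSpace N] [ChartedSpace H' N]
  {E'' : Type*} [NormedAddCommGroup E''] [NormedSpace ℝ E''] {H'' : Type*} [TopologicalSpace H'']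
  {K : ModelWithCorners ℝ E'' H''} {P : Type*} [TopologicalSpace P] [ChartedSpace H'' P]
  {F : Type*} [NormedAddCommGroup F] [NormedSpace ℝ F]
  {F' : Type*} [NormedAddCommGroup F'] [NormedSpace ℝ F']

theorem pullback_apply (φ : M → N) (β : OneForm J N) (x : M) (v : TangentSpace I x) :
    pullback I J φ β x v = β (φ x) (mfderiv I J φ x v) := rfl

theorem pullback_comp (g : N → P) (f : M → N) (γ : OneForm K P) {x : M}
    (hg : MDifferentiableAt J K g (f x)) (hf : MDifferentiableAt I J f x) :
    pullback I K (g ∘ f) γ x = (pullback J K g γ (f x)).comp (mfderiv I J f x) := by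
  ext v
  rw [pullback_apply, mfderiv_comp x hg hf]
  rfl

theorem pullback_congr {f g : M → N} (β : OneForm J N) {x : M} (h : f =ᶠ[𝓝 x] g) :
    pullback I J f β x = pullback I J g β x := by
  have h1 : (mfderiv I J f x : E →L[ℝ] E') = mfderiv I J g x := h.mfderiv_eq
  have h2 : ∀ y, y = f x → (β y : E' →L[ℝ] ℝ) = β (f x) := fun y hy ↦ by rw [hy]
  change (β (f x) : E' →L[ℝ] ℝ).comp (mfderiv I J f x : E →L[ℝ] E') =
    (β (g x) : E' →L[ℝ] ℝ).comp (mfderiv I J g x : E →L[ℝ] E')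
  rw [h1, h2 _ h.eq_of_nhds.symm]
  rfl

variable (I) in
/-- The pullback of a `1`-form to a vector space, as a function to the dual space. -/
def localForm (κ : F → M) (α : OneForm I M) (y : F) : F →L[ℝ] ℝ := pullback 𝓘(ℝ, F) I κ α y

theorem localForm_apply (κ : F → M) (α : OneForm I M) (y v : F) :
    localForm I κ α y v = α (κ y) (mfderiv 𝓘(ℝ, F) I κ y v) := rfl

theorem localForm_congr {κ κ' : F → M} (α : OneForm I M) {y : F} (h : κ =ᶠ[𝓝 y] κ') :
    localForm I κ α y = localForm I κ' α y := pullback_congr α h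

theorem localForm_comp {κ : F → M} {g : F' → F} (α : OneForm I M) {y : F'}
    (hκ : MDifferentiableAt 𝓘(ℝ, F) I κ (g y)) (hg : DifferentiableAt ℝ g y) :
    localForm I (κ ∘ g) α y = (localForm I κ α (g y)).comp (fderiv ℝ g y) := by
  have := pullback_comp (I := 𝓘(ℝ, F')) κ g α hκ hg.mdifferentiableAt
  rw [mfderiv_eq_fderiv] at this
  exact this

/-- The exterior derivative of a `1`-form on a vector space. -/
def extD (a : F → F →L[ℝ] ℝ) (y : F) : F [⋀^Fin 2]→L[ℝ] ℝ :=
  extDeriv (fun y ↦ ContinuousAlternatingMap.ofSubsingleton ℝ F ℝ (0 : Fin 1) (a y)) y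

theorem differentiableAt_ofSubsingleton {a : F → F →L[ℝ] ℝ} {y : F} (ha : DifferentiableAt ℝ a y) :
    DifferentiableAt ℝ
      (fun y ↦ ContinuousAlternatingMap.ofSubsingleton ℝ F ℝ (0 : Fin 1) (a y)) y :=
  (ContinuousAlternatingMap.ofSubsingletonLIE (𝕜 := ℝ) (E := F) (F := ℝ)
    (0 : Fin 1)).differentiable.differentiableAt.comp
    y ha

/-- This fixes the convention: there is no factor $1/2$, so $d(x\,dy-y\,dx)=2\,dx\wedge dy$ later
on. -/
theorem extD_apply {a : F → F →L[ℝ] ℝ} {y : F} (ha : DifferentiableAt ℝ a y) (u v : F) :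
    extD a y ![u, v] = fderiv ℝ a y u v - fderiv ℝ a y v u := by
  have h : ∀ w : F, fderiv ℝ (fun y ↦ a y w) y = (fderiv ℝ a y).flip w := by
    intro w
    rw [fderiv_clm_apply ha (differentiableAt_const w)]
    ext; simp
  rw [extD, extDeriv_apply (differentiableAt_ofSubsingleton ha)]
  simp [Fin.sum_univ_two, Fin.removeNth, h, sub_eq_add_neg]

theorem extD_congr {a b : F → F →L[ℝ] ℝ} {y : F} (h : a =ᶠ[𝓝 y] b) : extD a y = extD b y :=
  Filter.EventuallyEq.extDeriv_eq (h.fun_comp _)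

theorem extD_add {a b : F → F →L[ℝ] ℝ} {y : F} (ha : DifferentiableAt ℝ a y)
    (hb : DifferentiableAt ℝ b y) : extD (fun y ↦ a y + b y) y = extD a y + extD b y := by
  rw [extD, extD, extD, ← extDeriv_fun_add (differentiableAt_ofSubsingleton ha)
    (differentiableAt_ofSubsingleton hb)]
  rfl

theorem extD_pullback {a : F → F →L[ℝ] ℝ} {g : F' → F} {y : F'} (ha : DifferentiableAt ℝ a (g y))
    (hg : ContDiffAt ℝ ∞ g y) :
    extD (fun y ↦ (a (g y)).comp (fderiv ℝ g y)) y =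
      (extD a (g y)).compContinuousLinearMap (fderiv ℝ g y) := by
  rw [extD, extD, ← extDeriv_pullback (differentiableAt_ofSubsingleton ha) hg
    (by simpa using ENat.LEInfty.out)]
  rfl

theorem extDerivForm_eq (α : OneForm I M) (x : M) : extDerivForm I α x =
    (extD (localForm I (extChartAt I x).symm α) (extChartAt I x x)).compContinuousLinearMap
      (mfderiv I 𝓘(ℝ, E) (extChartAt I x) x) := rfl

theorem contDiffAt_chart_comp [IsManifold I ∞ M] {κ : F → M} {y : F}
    (hκ : ContMDiffAt 𝓘(ℝ, F) I ∞ κ y) : ContDiffAt ℝ ∞ (extChartAt I (κ y) ∘ κ) y :=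
  contMDiffAt_iff_contDiffAt.1 (contMDiffAt_extChartAt.comp y hκ)

variable [I.Boundaryless]

theorem contMDiffAt_extChartAt_symm [IsManifold I ∞ M] (x : M) {y : E}
    (hy : y ∈ (extChartAt I x).target) :
    ContMDiffAt 𝓘(ℝ, E) I ∞ (extChartAt I x).symm y :=
  (contMDiffOn_extChartAt_symm x).contMDiffAt ((isOpen_extChartAt_target x).mem_nhds hy)

/-- The trivialization of the tangent bundle at `x` is inverted by the derivative of the inverse
chart, so the coordinate expression of the section `α` is its pullback to the chart. -/
theorem contMDiffAt_form_iff [IsManifold I ∞ M] (α : OneForm I M) (x : M) :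
    ContMDiffAt I (I.prod 𝓘(ℝ, E →L[ℝ] ℝ)) ∞
    (fun x ↦ Bundle.TotalSpace.mk' (E →L[ℝ] ℝ) (E := fun x : M ↦ TangentSpace I x →L[ℝ] ℝ) x (α x))
      x ↔ ContDiffAt ℝ ∞ (localForm I (extChartAt I x).symm α) (extChartAt I x x) := by
  rw [contMDiffAt_hom_bundle]
  have h1 : ∀ᶠ y in 𝓝 x, ContinuousLinearMap.inCoordinates E (TangentSpace I) ℝ
      (fun _ : M ↦ ℝ) x y x y (α y) =
      localForm I (extChartAt I x).symm α (extChartAt I x y) := by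
    filter_upwards [(chartAt H x).open_source.mem_nhds (mem_chart_source H x)] with y hy
    have h2 : ∀ z, z = y → (α z : E →L[ℝ] ℝ) = α y := fun z hz ↦ by rw [hz]
    have h3 : (extChartAt I x).symm (extChartAt I x y) = y :=
      (extChartAt I x).left_inv (by simpa using hy)
    have h4 := TangentBundle.symmL_trivializationAt (I := I) hy
    rw [I.range_eq_univ, mfderivWithin_univ] at h4
    change ((trivializationAt ℝ (Bundle.Trivial M ℝ) x).continuousLinearMapAt ℝ y).comp
      ((α y : E →L[ℝ] ℝ).comp ((trivializationAt E (TangentSpace I) x).symmL ℝ y)) = _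
    have h5 : (trivializationAt ℝ (Bundle.Trivial M ℝ) x).continuousLinearMapAt ℝ y =
        ContinuousLinearMap.id ℝ ℝ := Bundle.Trivial.continuousLinearMapAt_trivialization ℝ M ℝ y
    rw [h4, h5]
    change (α y : E →L[ℝ] ℝ).comp _ = (α _ : E →L[ℝ] ℝ).comp _
    rw [h2 _ h3]
    rfl
  have h0 : ContMDiffAt I I ∞ (fun y : M ↦ y) x := contMDiffAt_id
  change (ContMDiffAt I I ∞ (fun y : M ↦ y) x ∧ ContMDiffAt I 𝓘(ℝ, E →L[ℝ] ℝ) ∞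
    (fun y ↦ ContinuousLinearMap.inCoordinates E (TangentSpace I) ℝ (fun _ : M ↦ ℝ) x y x y (α y)) x)
      ↔ _
  rw [and_iff_right h0, Filter.EventuallyEq.contMDiffAt_iff h1, ← contMDiffAt_iff_contDiffAt]
  constructor
  · intro h
    rw [contMDiffAt_iff_source, I.range_eq_univ, contMDiffWithinAt_univ] at h
    refine h.congr_of_eventuallyEq ?_
    filter_upwards [(isOpen_extChartAt_target x).mem_nhds (mem_extChartAt_target (I := I) x)]
      with y hy
    change _ = localForm I _ α (extChartAt I x ((extChartAt I x).symm y))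
    rw [(extChartAt I x).right_inv hy]
  · intro h
    exact ContMDiffAt.comp x h contMDiffAt_extChartAt

theorem isSmoothForm_iff [IsManifold I ∞ M] {α : OneForm I M} : IsSmoothForm I α ↔
    ∀ x, ContDiffAt ℝ ∞ (localForm I (extChartAt I x).symm α) (extChartAt I x x) :=
  forall_congr' fun x ↦ contMDiffAt_form_iff α x

/-- Near `y` one factors `κ` through the chart at `κ y`; this reduces statements about arbitrary
parametrizations to the preferred chart, in which `extDerivForm` is defined. -/
theorem localForm_eventuallyEq [IsManifold I ∞ M] (α : OneForm I M) {κ : F → M} {y : F}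
    (hκ : ContMDiffAt 𝓘(ℝ, F) I ∞ κ y) :
    localForm I κ α =ᶠ[𝓝 y] fun z ↦
      (localForm I (extChartAt I (κ y)).symm α (extChartAt I (κ y) (κ z))).comp
        (fderiv ℝ (extChartAt I (κ y) ∘ κ) z) := by
  have hs : ∀ᶠ z in 𝓝 y, κ z ∈ (extChartAt I (κ y)).source :=
    hκ.continuousAt.eventually_mem (extChartAt_source_mem_nhds (I := I) (κ y))
  have h1 : ∀ᶠ z in 𝓝 y, ContMDiffAt 𝓘(ℝ, F) I 1 κ z :=
    (contMDiffAt_iff_contMDiffAt_nhds (by simp)).1 (hκ.of_le (by simp))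
  filter_upwards [hs.eventually_nhds, h1] with z hz hκz
  have hzs := hz.self_of_nhds
  have h2 : ContMDiffAt I 𝓘(ℝ, E) 1 (extChartAt I (κ y)) (κ z) :=
    contMDiffAt_extChartAt' (by simpa using hzs)
  have h3 : κ =ᶠ[𝓝 z] (extChartAt I (κ y)).symm ∘ (extChartAt I (κ y) ∘ κ) := by
    filter_upwards [hz] with w hw
    exact ((extChartAt I (κ y)).left_inv hw).symm
  rw [localForm_congr α h3, localForm_comp]
  · rfl
  · exact (contMDiffAt_extChartAt_symm _ ((extChartAt I (κ y)).map_source hzs)).mdifferentiableAt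
      (by simp)
  · exact ((contMDiffAt_iff_contDiffAt.1 (h2.comp z hκz)).differentiableAt (by simp))

theorem contDiffAt_localForm [IsManifold I ∞ M] {α : OneForm I M} (hα : IsSmoothForm I α)
    {κ : F → M} {y : F} (hκ : ContMDiffAt 𝓘(ℝ, F) I ∞ κ y) :
    ContDiffAt ℝ ∞ (localForm I κ α) y := by
  refine ContDiffAt.congr_of_eventuallyEq ?_ (localForm_eventuallyEq α hκ)
  exact ((isSmoothForm_iff.1 hα (κ y)).comp y (contDiffAt_chart_comp hκ)).clm_comp
    ((contDiffAt_chart_comp hκ).fderiv_right (m := ∞) (by simp))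

/-- The exterior derivative is natural. -/
theorem extD_localForm [IsManifold I ∞ M] {α : OneForm I M} (hα : IsSmoothForm I α)
    {κ : F → M} {y : F} (hκ : ContMDiffAt 𝓘(ℝ, F) I ∞ κ y) :
    extD (localForm I κ α) y = (extDerivForm I α (κ y)).compContinuousLinearMap
      (mfderiv 𝓘(ℝ, F) I κ y) := by
  rw [extD_congr (localForm_eventuallyEq α hκ)]
  have h1 := extD_pullback (g := extChartAt I (κ y) ∘ κ) (y := y)
    (((isSmoothForm_iff.1 hα (κ y))).differentiableAt (by simp)) (contDiffAt_chart_comp hκ)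
  have h2 : fderiv ℝ (extChartAt I (κ y) ∘ κ) y =
      (mfderiv I 𝓘(ℝ, E) (extChartAt I (κ y)) (κ y)).comp (mfderiv 𝓘(ℝ, F) I κ y) := by
    rw [← mfderiv_eq_fderiv]
    exact mfderiv_comp y (contMDiffAt_extChartAt.mdifferentiableAt (n := ∞) (by simp))
      (hκ.mdifferentiableAt (by simp))
  refine h1.trans ?_
  rw [h2, extDerivForm_eq]
  rfl

/-- Moves the contact condition between a manifold and a parametrization by a vector space; all
nondegeneracy computations below happen on the vector space side. -/
theorem wedgePow_localForm [IsManifold I ∞ M] {α : OneForm I M} (hα : IsSmoothForm I α)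
    {κ : F → M} {y : F} (hκ : ContMDiffAt 𝓘(ℝ, F) I ∞ κ y) (n : ℕ) (v : Fin (2 * n + 1) → F) :
    wedgePow n (localForm I κ α y) (extD (localForm I κ α) y) v =
      wedgePow n (α (κ y)) (extDerivForm I α (κ y)) (fun i ↦ mfderiv 𝓘(ℝ, F) I κ y (v i)) := by
  rw [extD_localForm hα hκ]
  simp only [wedgePow]
  congr 1
  refine Finset.sum_congr rfl fun σ _ ↦ ?_
  congr 2
  refine Finset.prod_congr rfl fun i _ ↦ ?_
  change extDerivForm I α (κ y) _ = _
  congr 1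
  funext j
  fin_cases j <;> rfl

/-- Smoothness of a form may be tested in any parametrization with a smooth local right inverse `e`:
the preferred chart factors as `κ ∘ (e ∘ φ.symm)`. -/
theorem contMDiffAt_form_of_localForm [IsManifold I ∞ M] {α : OneForm I M} {x : M} {κ : F → M}
    {e : M → F} (he : ContMDiffAt I 𝓘(ℝ, F) ∞ e x) (hκ : ContMDiffAt 𝓘(ℝ, F) I ∞ κ (e x))
    (hκe : ∀ᶠ y in 𝓝 x, κ (e y) = y) (hα : ContDiffAt ℝ ∞ (localForm I κ α) (e x)) :
    ContDiffAt ℝ ∞ (localForm I (extChartAt I x).symm α) (extChartAt I x x) := by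
  set φ := extChartAt I x
  have hx : φ.symm (φ x) = x := extChartAt_to_inv x
  have hφ : ContMDiffAt 𝓘(ℝ, E) I ∞ φ.symm (φ x) :=
    contMDiffAt_extChartAt_symm x (mem_extChartAt_target x)
  have hg : ContDiffAt ℝ ∞ (e ∘ φ.symm) (φ x) := by
    refine contMDiffAt_iff_contDiffAt.1 (ContMDiffAt.comp _ ?_ hφ)
    rwa [hx]
  have h0 : (e ∘ φ.symm) (φ x) = e x := congrArg e hx
  have h1 : ∀ᶠ z in 𝓝 (φ x), κ (e (φ.symm z)) = φ.symm z := by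
    have := hφ.continuousAt.eventually (p := fun y ↦ κ (e y) = y) (by rwa [hx])
    exact this
  have h2 : ∀ᶠ z in 𝓝 (φ x), ContMDiffAt 𝓘(ℝ, F) I 1 κ ((e ∘ φ.symm) z) := by
    refine hg.continuousAt.eventually (p := fun y ↦ ContMDiffAt 𝓘(ℝ, F) I 1 κ y) ?_
    rw [h0]
    exact (contMDiffAt_iff_contMDiffAt_nhds (by simp)).1 (hκ.of_le (by simp))
  have h2' : ∀ᶠ z in 𝓝 (φ x), ContDiffAt ℝ 1 (e ∘ φ.symm) z :=
    (hg.of_le (by simp)).eventually (by simp)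
  have h3 : localForm I φ.symm α =ᶠ[𝓝 (φ x)] fun z ↦
      (localForm I κ α ((e ∘ φ.symm) z)).comp (fderiv ℝ (e ∘ φ.symm) z) := by
    filter_upwards [h1.eventually_nhds, h2, h2'] with z hz1 hz2 hz3
    have : φ.symm =ᶠ[𝓝 z] κ ∘ (e ∘ φ.symm) := by
      filter_upwards [hz1] with w hw using hw.symm
    rw [localForm_congr α this, localForm_comp α (hz2.mdifferentiableAt (by simp))
      (hz3.differentiableAt (by simp))]
  refine ContDiffAt.congr_of_eventuallyEq ?_ h3
  refine ContDiffAt.clm_comp (ContDiffAt.comp _ ?_ hg) (hg.fderiv_right (m := ∞) (by simp))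
  rwa [h0]

end Forms

end ContactCut

end

/-! ### Circle actions preserving a 1-form, and their moment maps -/

noncomputable section

namespace ContactCut

open Filter Topology

variable {E : Type*} [NormedAddCommGroup E] [NormedSpace ℝ E] {H : Type*} [TopologicalSpace H]

/-- A smooth circle action on `N` preserving a smooth `1`-form, with its moment map `Ψ`. -/
structure HamAction (I : ModelWithCorners ℝ E H) (N : Type*) [TopologicalSpace N]
    [ChartedSpace H N] [IsManifold I ∞ N] where
  act : Circle → N → N
  act_one : ∀ m, act 1 m = m
  act_mul : ∀ c d m, act (c * d) m = act c (act d m)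
  contMDiff_act : ContMDiff (𝓘(ℝ, ℝ).prod I) I ∞ (fun p : ℝ × N ↦ act (Circle.exp p.1) p.2)
  form : OneForm I N
  smooth_form : IsSmoothForm I form
  pullback_act : ∀ c, pullback I I (act c) form = form
  Ψ : N → ℝ
  form_gen : ∀ m, form m (mfderiv 𝓘(ℝ, ℝ) I (fun t : ℝ ↦ act (Circle.exp t) m) 0 (1 : ℝ)) = Ψ m

namespace HamAction

variable {I : ModelWithCorners ℝ E H} {N : Type*} [TopologicalSpace N] [ChartedSpace H N]
  [IsManifold I ∞ N] (A : HamAction I N)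
  {E' : Type*} [NormedAddCommGroup E'] [NormedSpace ℝ E'] {H' : Type*} [TopologicalSpace H']
  {J : ModelWithCorners ℝ E' H'} {P : Type*} [TopologicalSpace P] [ChartedSpace H' P]
  {F : Type*} [NormedAddCommGroup F] [NormedSpace ℝ F]

theorem act_inv_act (c : Circle) (m : N) : A.act c⁻¹ (A.act c m) = m := by
  rw [← A.act_mul, inv_mul_cancel, A.act_one]

theorem act_act_inv (c : Circle) (m : N) : A.act c (A.act c⁻¹ m) = m := by
  rw [← A.act_mul, mul_inv_cancel, A.act_one]

theorem contMDiff_act_const (c : Circle) : ContMDiff I I ∞ (A.act c) := by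
  have h : A.act c = (fun p : ℝ × N ↦ A.act (Circle.exp p.1) p.2) ∘
      fun m ↦ ((Complex.arg c : ℝ), m) := by
    funext m
    simp [Circle.exp_arg]
  rw [h]
  exact A.contMDiff_act.comp (contMDiff_const.prodMk contMDiff_id)

/-- Dividing by a base point `c₀` keeps the argument near $1$, away from the discontinuity of
`Complex.arg`. This turns smoothness in the angle into smoothness in the circle variable. -/
theorem act_eq_exp_arg (c c₀ : Circle) (m : N) :
    A.act c m = A.act (Circle.exp (Complex.arg ((c / c₀ : Circle) : ℂ))) (A.act c₀ m) := by
  rw [Circle.exp_arg, ← A.act_mul, div_mul_cancel]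

omit [IsManifold I ∞ N] in
theorem _root_.ContactCut.contDiffAt_arg {z : ℂ} (hz : z ∈ Complex.slitPlane) :
    ContDiffAt ℝ ∞ Complex.arg z := by
  have h : ContDiffAt ℝ ∞ Complex.log z := (Complex.contDiffAt_log hz).restrict_scalars ℝ
  have h' : Complex.arg = Complex.imCLM ∘ Complex.log := by
    funext z
    simp [Complex.log_im]
  rw [h']
  exact Complex.imCLM.contDiff.contDiffAt.comp z h

theorem continuous_act : Continuous (fun p : Circle × N ↦ A.act p.1 p.2) := by
  rw [continuous_iff_continuousAt]
  rintro ⟨c₀, m⟩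
  have h : (fun p : Circle × N ↦ A.act p.1 p.2) = (fun p : ℝ × N ↦ A.act (Circle.exp p.1) p.2) ∘
      fun p : Circle × N ↦ (Complex.arg ((p.1 / c₀ : Circle) : ℂ), A.act c₀ p.2) := by
    funext p
    exact A.act_eq_exp_arg _ _ _
  rw [h]
  refine A.contMDiff_act.continuous.continuousAt.comp (ContinuousAt.prodMk ?_ ?_)
  · have h1 : ContinuousAt (fun p : Circle × N ↦ ((p.1 / c₀ : Circle) : ℂ)) (c₀, m) := by
      fun_prop
    refine ContinuousAt.comp' (g := Complex.arg) ?_ h1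
    simpa using Complex.continuousAt_arg Complex.one_mem_slitPlane
  · exact ((A.contMDiff_act_const c₀).continuous.comp continuous_snd).continuousAt

/-- Smoothness at `x` of the angle, relative to its value at `x`, of a circle-valued function. -/
theorem _root_.ContactCut.contMDiffAt_arg_div {g : P → Circle} {x : P} {c : Circle}
    (hg : ContMDiffAt J 𝓘(ℝ, ℂ) ∞ (fun p ↦ (g p : ℂ)) x)
    (hc : ((g x / c : Circle) : ℂ) ∈ Complex.slitPlane) :
    ContMDiffAt J 𝓘(ℝ, ℝ) ∞ (fun p ↦ Complex.arg ((g p / c : Circle) : ℂ)) x := by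
  have h1 : ContMDiffAt J 𝓘(ℝ, ℂ) ∞ (fun p ↦ ((g p / c : Circle) : ℂ)) x := by
    have : (fun p ↦ ((g p / c : Circle) : ℂ)) = fun p ↦ (c : ℂ)⁻¹ • (g p : ℂ) := by
      funext p
      rw [Circle.coe_div, div_eq_inv_mul, smul_eq_mul]
    rw [this]
    exact ContMDiffAt.comp x (g := fun z : ℂ ↦ (c : ℂ)⁻¹ • z)
      (contDiff_id.const_smul _).contMDiff.contMDiffAt hg
  exact ContMDiffAt.comp x (g := Complex.arg) (contDiffAt_arg hc).contMDiffAt h1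

theorem contMDiffAt_act_comp {g : P → Circle} {h : P → N} {x : P}
    (hg : ContMDiffAt J 𝓘(ℝ, ℂ) ∞ (fun p ↦ (g p : ℂ)) x) (hh : ContMDiffAt J I ∞ h x) :
    ContMDiffAt J I ∞ (fun p ↦ A.act (g p) (h p)) x := by
  have h1 : (fun p ↦ A.act (g p) (h p)) = (fun p : ℝ × N ↦ A.act (Circle.exp p.1) p.2) ∘
      fun p ↦ (Complex.arg ((g p / g x : Circle) : ℂ), A.act (g x) (h p)) := by
    funext p
    exact A.act_eq_exp_arg _ _ _
  rw [h1]
  refine A.contMDiff_act.contMDiffAt.comp x (ContMDiffAt.prodMk ?_ ?_)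
  · exact contMDiffAt_arg_div hg (by simp [Complex.one_mem_slitPlane])
  · exact (A.contMDiff_act_const _).contMDiffAt.comp x hh

theorem localForm_act_const (c : Circle) {κ : F → N} {y : F}
    (hκ : MDifferentiableAt 𝓘(ℝ, F) I κ y) :
    localForm I (fun y ↦ A.act c (κ y)) A.form y = localForm I κ A.form y := by
  have h := pullback_comp (A.act c) κ A.form
    ((A.contMDiff_act_const c).mdifferentiable (by simp) _) hκ
  rw [A.pullback_act] at h
  exact h

/-- The pullback along $(t,y)\mapsto e^{it}\kappa(y)$ is $\Psi\,dt+\kappa^*A$: invariance moves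
$e^{it}$ to the identity, and in the direction $\partial_t$ the form sees the generator. -/
theorem localForm_exp {κ : F → N} {y : F} (hκ : MDifferentiableAt 𝓘(ℝ, F) I κ y) (t : ℝ)
    (v : ℝ × F) :
    localForm I (fun p : ℝ × F ↦ A.act (Circle.exp p.1) (κ p.2)) A.form (t, y) v =
      v.1 * A.Ψ (κ y) + localForm I κ A.form y v.2 := by
  set K : ℝ × F → N := fun p ↦ A.act (Circle.exp p.1) (κ p.2) with hK
  have hKd : MDifferentiableAt 𝓘(ℝ, ℝ × F) I K (t, y) := by
    have h1 : MDifferentiableAt 𝓘(ℝ, ℝ × F) (𝓘(ℝ, ℝ).prod I)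
        (fun p : ℝ × F ↦ (p.1, κ p.2)) (t, y) := by
      refine MDifferentiableAt.prodMk ?_ ?_
      · exact differentiableAt_fst.mdifferentiableAt
      · exact MDifferentiableAt.comp (t, y) (g := κ) hκ differentiableAt_snd.mdifferentiableAt
    exact MDifferentiableAt.comp (t, y) (A.contMDiff_act.mdifferentiable (by simp) _) h1
  have hv : ∀ l : ℝ × F →L[ℝ] ℝ, l v = l (v.1, 0) + l (0, v.2) := fun l ↦ by
    rw [← map_add]; simp
  rw [hv]
  congr 1
  · have h1 : localForm I (K ∘ fun s : ℝ ↦ (t + s, y)) A.form 0 =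
        (localForm I K A.form (t + 0, y)).comp (fderiv ℝ (fun s : ℝ ↦ (t + s, y)) 0) :=
      localForm_comp A.form (by simpa using hKd) (by fun_prop)
    have h2 : fderiv ℝ (fun s : ℝ ↦ (t + s, y)) 0 v.1 = (v.1, 0) := by
      have : HasFDerivAt (fun s : ℝ ↦ (t + s, y))
          ((ContinuousLinearMap.id ℝ ℝ).prod (0 : ℝ →L[ℝ] F)) 0 :=
        ((hasFDerivAt_id (0 : ℝ)).const_add t).prodMk (hasFDerivAt_const y 0)
      rw [this.fderiv]; simp
    have h3 : (K ∘ fun s : ℝ ↦ (t + s, y)) = fun s ↦ A.act (Circle.exp t)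
        ((fun s ↦ A.act (Circle.exp s) (κ y)) s) := by
      funext s
      simp [hK, Circle.exp_add, A.act_mul]
    have h4 : MDifferentiableAt 𝓘(ℝ, ℝ) I (fun s : ℝ ↦ A.act (Circle.exp s) (κ y)) 0 := by
      have : ContMDiff 𝓘(ℝ, ℝ) I ∞ (fun s : ℝ ↦ A.act (Circle.exp s) (κ y)) :=
        A.contMDiff_act.comp (contMDiff_id.prodMk contMDiff_const)
      exact this.mdifferentiable (by simp) 0
    rw [h3, A.localForm_act_const _ h4] at h1
    have h5 := congrArg (fun l : ℝ →L[ℝ] ℝ ↦ l v.1) h1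
    simp only [ContinuousLinearMap.comp_apply, h2, add_zero] at h5
    rw [← h5]
    have h6 : v.1 = v.1 • (1 : ℝ) := by simp
    have h7 : localForm I (fun s : ℝ ↦ A.act (Circle.exp s) (κ y)) A.form 0 (1 : ℝ) =
        A.Ψ (κ y) := by
      rw [← A.form_gen, localForm_apply]
      have h2 : ∀ z, z = κ y → (A.form z : E →L[ℝ] ℝ) = A.form (κ y) := fun z hz ↦ by rw [hz]
      exact congrArg (fun l : E →L[ℝ] ℝ ↦ l _) (h2 (A.act (Circle.exp 0) (κ y))
        (by rw [Circle.exp_zero, A.act_one]))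
    conv_lhs => rw [h6]
    rw [map_smul, h7]
    simp
  · have h1 : localForm I (K ∘ fun s : F ↦ (t, s)) A.form y =
        (localForm I K A.form (t, y)).comp (fderiv ℝ (fun s : F ↦ (t, s)) y) :=
      localForm_comp A.form hKd (by fun_prop)
    have h2 : fderiv ℝ (fun s : F ↦ (t, s)) y v.2 = (0, v.2) := by
      have : HasFDerivAt (fun s : F ↦ (t, s))
          ((0 : F →L[ℝ] ℝ).prod (ContinuousLinearMap.id ℝ F)) y :=
        (hasFDerivAt_const t y).prodMk (hasFDerivAt_id y)
      rw [this.fderiv]; simp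
    have h5 := congrArg (fun l : F →L[ℝ] ℝ ↦ l v.2) h1
    simp only [ContinuousLinearMap.comp_apply, h2] at h5
    rw [← h5]
    exact congrArg (fun l : F →L[ℝ] ℝ ↦ l v.2) (A.localForm_act_const (Circle.exp t) hκ)

/-- The circle is commutative, so `act c` carries the orbit curve of `m` to that of `act c m`; the
form is invariant. -/
theorem Ψ_act (c : Circle) (m : N) : A.Ψ (A.act c m) = A.Ψ m := by
  have h4 : MDifferentiableAt 𝓘(ℝ, ℝ) I (fun s : ℝ ↦ A.act (Circle.exp s) m) 0 := by
    have : ContMDiff 𝓘(ℝ, ℝ) I ∞ (fun s : ℝ ↦ A.act (Circle.exp s) m) :=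
      A.contMDiff_act.comp (contMDiff_id.prodMk contMDiff_const)
    exact this.mdifferentiable (by simp) 0
  have key : ∀ m, localForm I (fun s : ℝ ↦ A.act (Circle.exp s) m) A.form 0 (1 : ℝ) = A.Ψ m := by
    intro m
    rw [← A.form_gen, localForm_apply]
    have h2 : ∀ z, z = m → (A.form z : E →L[ℝ] ℝ) = A.form m := fun z hz ↦ by rw [hz]
    exact congrArg (fun l : E →L[ℝ] ℝ ↦ l _) (h2 (A.act (Circle.exp 0) m)
      (by rw [Circle.exp_zero, A.act_one]))
  rw [← key, ← key m, ← A.localForm_act_const c h4]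
  congr 2
  funext s
  rw [← A.act_mul, ← A.act_mul, mul_comm]

/-- In coordinates `Ψ` is the $dt$-coefficient of a smooth pulled-back form. -/
theorem contMDiff_Ψ [I.Boundaryless] : ContMDiff I 𝓘(ℝ, ℝ) ∞ A.Ψ := by
  intro m
  set φ := extChartAt I m
  have hφ : ContMDiffAt 𝓘(ℝ, E) I ∞ φ.symm (φ m) :=
    contMDiffAt_extChartAt_symm m (mem_extChartAt_target m)
  have hJ : ContMDiffAt 𝓘(ℝ, ℝ × E) I ∞
      (fun p : ℝ × E ↦ A.act (Circle.exp p.1) (φ.symm p.2)) (0, φ m) := by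
    have h1 : ContMDiffAt 𝓘(ℝ, ℝ × E) (𝓘(ℝ, ℝ).prod I) ∞
        (fun p : ℝ × E ↦ (p.1, φ.symm p.2)) (0, φ m) := by
      refine ContMDiffAt.prodMk contDiffAt_fst.contMDiffAt ?_
      exact ContMDiffAt.comp (0, φ m) (g := φ.symm) hφ contDiffAt_snd.contMDiffAt
    exact ContMDiffAt.comp (0, φ m) A.contMDiff_act.contMDiffAt h1
  have h2 := contDiffAt_localForm A.smooth_form hJ
  have h3 : ContDiffAt ℝ ∞ (fun y : E ↦ localForm I
      (fun p : ℝ × E ↦ A.act (Circle.exp p.1) (φ.symm p.2)) A.form (0, y) (1, 0)) (φ m) := by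
    refine ContDiffAt.clm_apply ?_ contDiffAt_const
    exact ContDiffAt.comp (φ m) h2 (contDiffAt_const.prodMk contDiffAt_id)
  have h4 : ContMDiffAt I 𝓘(ℝ, ℝ) ∞ ((fun y : E ↦ localForm I
      (fun p : ℝ × E ↦ A.act (Circle.exp p.1) (φ.symm p.2)) A.form (0, y) (1, 0)) ∘ φ) m :=
    ContMDiffAt.comp m h3.contMDiffAt contMDiffAt_extChartAt
  refine h4.congr_of_eventuallyEq ?_
  filter_upwards [extChartAt_source_mem_nhds (I := I) m] with y hy
  have h5 : MDifferentiableAt 𝓘(ℝ, E) I φ.symm (φ y) :=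
    (contMDiffAt_extChartAt_symm m (φ.map_source hy)).mdifferentiableAt (by simp)
  rw [Function.comp, A.localForm_exp h5]
  simp [φ.left_inv hy]

/-- `dA (X, ·) = -dΨ`, along a smooth map `κ` from a vector space. -/
theorem extD_localForm_exp [I.Boundaryless] {κ : F → N} {y : F}
    (hκ : ContMDiffAt 𝓘(ℝ, F) I ∞ κ y) (v : ℝ × F) :
    extD (localForm I (fun p : ℝ × F ↦ A.act (Circle.exp p.1) (κ p.2)) A.form) (0, y) ![(1, 0), v] =
      -fderiv ℝ (A.Ψ ∘ κ) y v.2 := by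
  set K : ℝ × F → N := fun p ↦ A.act (Circle.exp p.1) (κ p.2) with hK
  have hJ : ContMDiffAt 𝓘(ℝ, ℝ × F) I ∞ K (0, y) := by
    have h1 : ContMDiffAt 𝓘(ℝ, ℝ × F) (𝓘(ℝ, ℝ).prod I) ∞
        (fun p : ℝ × F ↦ (p.1, κ p.2)) (0, y) := by
      refine ContMDiffAt.prodMk contDiffAt_fst.contMDiffAt ?_
      exact ContMDiffAt.comp (0, y) (g := κ) hκ contDiffAt_snd.contMDiffAt
    exact ContMDiffAt.comp (0, y) A.contMDiff_act.contMDiffAt h1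
  have hd : DifferentiableAt ℝ (localForm I K A.form) (0, y) :=
    (contDiffAt_localForm A.smooth_form hJ).differentiableAt (by simp)
  have h1 : ∀ᶠ z in 𝓝 y, MDifferentiableAt 𝓘(ℝ, F) I κ z := by
    have : ∀ᶠ z in 𝓝 y, ContMDiffAt 𝓘(ℝ, F) I 1 κ z :=
      (contMDiffAt_iff_contMDiffAt_nhds (by simp)).1 (hκ.of_le (by simp))
    filter_upwards [this] with z hz using hz.mdifferentiableAt (by simp)
  have h2 : ∀ᶠ p in 𝓝 ((0 : ℝ), y), ∀ w : ℝ × F, localForm I K A.form p w =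
      w.1 * A.Ψ (κ p.2) + localForm I κ A.form p.2 w.2 := by
    have : ∀ᶠ p in 𝓝 ((0 : ℝ), y), MDifferentiableAt 𝓘(ℝ, F) I κ p.2 :=
      (continuousAt_snd (p := ((0 : ℝ), y))).eventually h1
    filter_upwards [this] with p hp w
    exact A.localForm_exp hp p.1 w
  have hflip : ∀ w : ℝ × F, fderiv ℝ (fun p ↦ localForm I K A.form p w) (0, y) =
      (fderiv ℝ (localForm I K A.form) (0, y)).flip w := by
    intro w
    rw [fderiv_clm_apply hd (differentiableAt_const w)]
    ext <;> simp
  rw [extD_apply hd]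
  -- The coefficients of $\Psi\,dt+\kappa^*A$ do not depend on $t$; this is where invariance enters
  -- Cartan's formula.
  have h3 : fderiv ℝ (localForm I K A.form) (0, y) (1, 0) v = 0 := by
    have h4 : HasFDerivAt (fun s : ℝ ↦ localForm I K A.form (s, y) v)
        (((fderiv ℝ (localForm I K A.form) (0, y)).flip v).comp
          ((ContinuousLinearMap.id ℝ ℝ).prod (0 : ℝ →L[ℝ] F))) 0 := by
      have h5 : HasFDerivAt (fun p ↦ localForm I K A.form p v)
          ((fderiv ℝ (localForm I K A.form) (0, y)).flip v) (0, y) := by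
        rw [← hflip]
        exact (hd.clm_apply (differentiableAt_const v)).hasFDerivAt
      exact HasFDerivAt.comp (0 : ℝ) (f := fun s : ℝ ↦ (s, y)) h5
        ((hasFDerivAt_id (0 : ℝ)).prodMk (hasFDerivAt_const y 0))
    have h6 : (fun s : ℝ ↦ localForm I K A.form (s, y) v) = fun s ↦
        v.1 * A.Ψ (κ y) + localForm I κ A.form y v.2 := by
      funext s
      exact A.localForm_exp h1.self_of_nhds s v
    rw [h6] at h4
    have h7 := h4.unique (hasFDerivAt_const _ _)
    have h8 := congrArg (fun l : ℝ →L[ℝ] ℝ ↦ l 1) h7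
    simpa using h8
  -- The $dt$-coefficient is `Ψ ∘ κ`, so its derivative is all that survives.
  have h4 : fderiv ℝ (localForm I K A.form) (0, y) v (1, 0) = fderiv ℝ (A.Ψ ∘ κ) y v.2 := by
    have h5 : (fun p ↦ localForm I K A.form p (1, 0)) =ᶠ[𝓝 (0, y)] (A.Ψ ∘ κ) ∘ Prod.snd := by
      filter_upwards [h2] with p hp
      rw [hp]; simp
    have h6 : DifferentiableAt ℝ (A.Ψ ∘ κ) y :=
      ((contMDiffAt_iff_contDiffAt.1 (A.contMDiff_Ψ.contMDiffAt.comp y hκ)).differentiableAt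
        (by simp))
    have h7 := congrArg (fun l : ℝ × F →L[ℝ] ℝ ↦ l v) (hflip (1, 0))
    simp only [ContinuousLinearMap.flip_apply] at h7
    rw [← h7, h5.fderiv_eq, fderiv_comp (0, y) h6 differentiableAt_snd, fderiv_snd]
    rfl
  rw [h3, h4, zero_sub]

end HamAction

end ContactCut

end

/-! ### Slices: equivariant coordinates near an orbit -/

noncomputable section

namespace ContactCut

open Filter Topology

variable {E : Type*} [NormedAddCommGroup E] [NormedSpace ℝ E] {H : Type*} [TopologicalSpace H]
  {I : ModelWithCorners ℝ E H} {N : Type*} [TopologicalSpace N] [ChartedSpace H N]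
  [IsManifold I ∞ N]

/-- An equivariant trivialization over an invariant open set `source`: a slice `κ`, parametrized by
the value of the moment map and an invariant coordinate `w`, such that `m = ang m • κ (Ψ m, w m)`. -/
structure Slice (A : HamAction I N) (F : Type*) [NormedAddCommGroup F] [NormedSpace ℝ F] where
  source : Set N
  target : Set (ℝ × F)
  κ : ℝ × F → N
  w : N → F
  ang : N → Circle
  isOpen_source : IsOpen source
  isOpen_target : IsOpen target
  contMDiffOn_κ : ContMDiffOn 𝓘(ℝ, ℝ × F) I ∞ κ target
  contMDiffOn_w : ContMDiffOn I 𝓘(ℝ, F) ∞ w source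
  contMDiffOn_ang : ContMDiffOn I 𝓘(ℝ, ℂ) ∞ (fun m ↦ (ang m : ℂ)) source
  κ_mem : ∀ b ∈ target, κ b ∈ source
  Ψ_κ : ∀ b ∈ target, A.Ψ (κ b) = b.1
  w_κ : ∀ b ∈ target, w (κ b) = b.2
  ang_κ : ∀ b ∈ target, ang (κ b) = 1
  act_mem : ∀ c, ∀ m ∈ source, A.act c m ∈ source
  w_act : ∀ c, ∀ m ∈ source, w (A.act c m) = w m
  ang_act : ∀ c, ∀ m ∈ source, ang (A.act c m) = c * ang m
  coord_mem : ∀ m ∈ source, (A.Ψ m, w m) ∈ target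
  act_ang : ∀ m ∈ source, A.act (ang m) (κ (A.Ψ m, w m)) = m

namespace Slice

variable {A : HamAction I N} {F : Type*} [NormedAddCommGroup F] [NormedSpace ℝ F] (T : Slice A F)
  {F' : Type*} [NormedAddCommGroup F'] [NormedSpace ℝ F']

/-- The slice in the zero level set. -/
def κ₀ (b : F) : N := T.κ (0, b)

/-- The domain of `κ₀`. -/
def target₀ : Set F := {b | ((0 : ℝ), b) ∈ T.target}

theorem isOpen_target₀ : IsOpen T.target₀ :=
  T.isOpen_target.preimage (Continuous.prodMk_right (0 : ℝ))

theorem contMDiffAt_κ {b : ℝ × F} (hb : b ∈ T.target) : ContMDiffAt 𝓘(ℝ, ℝ × F) I ∞ T.κ b :=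
  T.contMDiffOn_κ.contMDiffAt (T.isOpen_target.mem_nhds hb)

theorem contMDiffAt_w {m : N} (hm : m ∈ T.source) : ContMDiffAt I 𝓘(ℝ, F) ∞ T.w m :=
  T.contMDiffOn_w.contMDiffAt (T.isOpen_source.mem_nhds hm)

theorem contMDiffAt_ang {m : N} (hm : m ∈ T.source) :
    ContMDiffAt I 𝓘(ℝ, ℂ) ∞ (fun m ↦ (T.ang m : ℂ)) m :=
  T.contMDiffOn_ang.contMDiffAt (T.isOpen_source.mem_nhds hm)

theorem contMDiffAt_κ₀ {b : F} (hb : b ∈ T.target₀) : ContMDiffAt 𝓘(ℝ, F) I ∞ T.κ₀ b :=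
  ContMDiffAt.comp b (g := T.κ) (T.contMDiffAt_κ hb)
    (contDiffAt_const.prodMk contDiffAt_id).contMDiffAt

theorem κ₀_mem {b : F} (hb : b ∈ T.target₀) : T.κ₀ b ∈ T.source := T.κ_mem _ hb

theorem Ψ_κ₀ {b : F} (hb : b ∈ T.target₀) : A.Ψ (T.κ₀ b) = 0 := T.Ψ_κ _ hb

theorem w_κ₀ {b : F} (hb : b ∈ T.target₀) : T.w (T.κ₀ b) = b := T.w_κ _ hb

theorem w_mem {m : N} (hm : m ∈ T.source) (h : A.Ψ m = 0) : T.w m ∈ T.target₀ := by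
  have := T.coord_mem m hm
  rwa [h] at this

theorem act_ang₀ {m : N} (hm : m ∈ T.source) (h : A.Ψ m = 0) :
    A.act (T.ang m) (T.κ₀ (T.w m)) = m := by
  have := T.act_ang m hm
  rwa [h] at this

/-- On the zero level a map is $e^{i\theta}c_0\cdot\kappa_0(w)$. The $d\theta$ term has coefficient
$\Psi=0$ and $c_0$ preserves the form, so only the invariant coordinate matters. This makes the form
basic and the quotient form independent of the slice. -/
theorem localForm_eq {κ : F' → N} {y : F'} (hκ : ContMDiffAt 𝓘(ℝ, F') I ∞ κ y)
    (hΨ : ∀ᶠ z in 𝓝 y, A.Ψ (κ z) = 0) (hy : κ y ∈ T.source) :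
    localForm I κ A.form y =
      (localForm I T.κ₀ A.form (T.w (κ y))).comp (fderiv ℝ (T.w ∘ κ) y) := by
  set c₀ := T.ang (κ y) with hc₀
  set K : ℝ × F → N := fun p ↦ A.act (Circle.exp p.1) (A.act c₀ (T.κ₀ p.2)) with hK
  set θ : F' → ℝ := fun z ↦ Complex.arg ((T.ang (κ z) / c₀ : Circle) : ℂ) with hθ
  have hθs : ContMDiffAt 𝓘(ℝ, F') 𝓘(ℝ, ℝ) ∞ θ y := by
    refine contMDiffAt_arg_div (g := T.ang ∘ κ)
      (ContMDiffAt.comp y (g := fun m ↦ (T.ang m : ℂ)) (T.contMDiffAt_ang hy) hκ) ?_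
    simp [hc₀, Complex.one_mem_slitPlane]
  have hθ0 : θ y = 0 := by simp [hθ, hc₀]
  have hu : ContMDiffAt 𝓘(ℝ, F') 𝓘(ℝ, F) ∞ (T.w ∘ κ) y :=
    ContMDiffAt.comp y (T.contMDiffAt_w hy) hκ
  have hθd : DifferentiableAt ℝ θ y := (contMDiffAt_iff_contDiffAt.1 hθs).differentiableAt (by simp)
  have hud : DifferentiableAt ℝ (T.w ∘ κ) y :=
    (contMDiffAt_iff_contDiffAt.1 hu).differentiableAt (by simp)
  have hev : κ =ᶠ[𝓝 y] K ∘ fun z ↦ (θ z, T.w (κ z)) := by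
    filter_upwards [hΨ, hκ.continuousAt.eventually_mem (T.isOpen_source.mem_nhds hy)] with z hz hzs
    simp only [Function.comp, hK, hθ]
    rw [Circle.exp_arg, ← A.act_mul, div_mul_cancel, T.act_ang₀ hzs hz]
  have hwm : T.w (κ y) ∈ T.target₀ := T.w_mem hy hΨ.self_of_nhds
  have hκ₀ : MDifferentiableAt 𝓘(ℝ, F) I (fun b ↦ A.act c₀ (T.κ₀ b)) (T.w (κ y)) :=
    (ContMDiffAt.comp _ (A.contMDiff_act_const c₀).contMDiffAt
      (T.contMDiffAt_κ₀ hwm)).mdifferentiableAt (n := ∞) (by simp)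
  have hKd : MDifferentiableAt 𝓘(ℝ, ℝ × F) I K (θ y, T.w (κ y)) := by
    have h1 : MDifferentiableAt 𝓘(ℝ, ℝ × F) (𝓘(ℝ, ℝ).prod I)
        (fun p : ℝ × F ↦ (p.1, A.act c₀ (T.κ₀ p.2))) (θ y, T.w (κ y)) := by
      refine MDifferentiableAt.prodMk ?_ ?_
      · exact differentiableAt_fst.mdifferentiableAt
      · exact MDifferentiableAt.comp (θ y, T.w (κ y)) (g := fun b ↦ A.act c₀ (T.κ₀ b)) hκ₀
          differentiableAt_snd.mdifferentiableAt
    exact MDifferentiableAt.comp _ (A.contMDiff_act.mdifferentiable (by simp) _) h1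
  rw [localForm_congr _ hev, localForm_comp A.form (g := fun z ↦ (θ z, T.w (κ z))) hKd
    (hθd.prodMk hud)]
  ext v
  have h1 : fderiv ℝ (fun z ↦ (θ z, T.w (κ z))) y v = (fderiv ℝ θ y v, fderiv ℝ (T.w ∘ κ) y v) := by
    have := (hθd.hasFDerivAt.prodMk hud.hasFDerivAt).fderiv
    have h2 := congrArg (fun l : F' →L[ℝ] ℝ × F ↦ l v) this
    exact h2
  rw [ContinuousLinearMap.comp_apply, ContinuousLinearMap.comp_apply, h1,
    A.localForm_exp hκ₀]
  simp only
  rw [A.Ψ_act, T.Ψ_κ₀ hwm, mul_zero, zero_add,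
    A.localForm_act_const c₀ ((T.contMDiffAt_κ₀ hwm).mdifferentiableAt (by simp))]

theorem exp_mem_slitPlane {t : ℝ} (ht : t ∈ Ioo (-Real.pi) Real.pi) :
    ((Circle.exp t : Circle) : ℂ) ∈ Complex.slitPlane := by
  rw [Complex.mem_slitPlane_iff_arg]
  refine ⟨?_, Circle.coe_ne_zero _⟩
  rw [Circle.arg_exp ht.1 ht.2.le]
  exact ht.2.ne

/-- The chart of `N` by the moment map, the coordinate of the slice and the angle. -/
def box [I.Boundaryless] (c₀ : Circle) : OpenPartialHomeomorph N (ℝ × (F × ℝ)) where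
  toFun m := (A.Ψ m, T.w m, Complex.arg ((T.ang m / c₀ : Circle) : ℂ))
  invFun p := A.act (c₀ * Circle.exp p.2.2) (T.κ (p.1, p.2.1))
  source := {m | m ∈ T.source ∧ ((T.ang m / c₀ : Circle) : ℂ) ∈ Complex.slitPlane}
  target := {p | (p.1, p.2.1) ∈ T.target ∧ p.2.2 ∈ Ioo (-Real.pi) Real.pi}
  map_source' := by
    rintro m ⟨hm, hs⟩
    refine ⟨T.coord_mem m hm, Complex.neg_pi_lt_arg _, ?_⟩
    rw [Complex.mem_slitPlane_iff_arg] at hs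
    exact lt_of_le_of_ne (Complex.arg_le_pi _) hs.1
  map_target' := by
    rintro p ⟨hp, ht⟩
    refine ⟨T.act_mem _ _ (T.κ_mem _ hp), ?_⟩
    rw [T.ang_act _ _ (T.κ_mem _ hp), T.ang_κ _ hp, mul_one, mul_div_cancel_left]
    exact exp_mem_slitPlane ht
  left_inv' := by
    rintro m ⟨hm, hs⟩
    simp only
    rw [Circle.exp_arg, mul_div_cancel, T.act_ang m hm]
  right_inv' := by
    rintro p ⟨hp, ht⟩
    rw [T.ang_act _ _ (T.κ_mem _ hp), T.ang_κ _ hp, mul_one, mul_div_cancel_left,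
      Circle.arg_exp ht.1 ht.2.le, T.w_act _ _ (T.κ_mem _ hp), T.w_κ _ hp, A.Ψ_act, T.Ψ_κ _ hp]
  open_source := by
    have h1 : ContinuousOn (fun m ↦ ((T.ang m / c₀ : Circle) : ℂ)) T.source := by
      simp only [Circle.coe_div]
      exact T.contMDiffOn_ang.continuousOn.div_const _
    exact h1.isOpen_inter_preimage T.isOpen_source Complex.isOpen_slitPlane
  open_target := by
    refine IsOpen.inter ?_ ?_
    · exact T.isOpen_target.preimage (f := fun p : ℝ × (F × ℝ) ↦ (p.1, p.2.1)) (by fun_prop)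
    · exact isOpen_Ioo.preimage (f := fun p : ℝ × (F × ℝ) ↦ p.2.2) (by fun_prop)
  continuousOn_toFun := by
    rintro m ⟨hm, hs⟩
    refine ContinuousAt.continuousWithinAt (ContinuousAt.prodMk ?_ (ContinuousAt.prodMk ?_ ?_))
    · exact A.contMDiff_Ψ.continuous.continuousAt
    · exact (T.contMDiffAt_w hm).continuousAt
    · exact (contMDiffAt_arg_div (T.contMDiffAt_ang hm) hs).continuousAt
  continuousOn_invFun := by
    rintro p ⟨hp, ht⟩
    refine ContinuousAt.continuousWithinAt ?_
    refine A.continuous_act.continuousAt.comp (f := fun p : ℝ × (F × ℝ) ↦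
      (c₀ * Circle.exp p.2.2, T.κ (p.1, p.2.1))) (ContinuousAt.prodMk (by fun_prop) ?_)
    exact ContinuousAt.comp (g := T.κ) (f := fun p : ℝ × (F × ℝ) ↦ (p.1, p.2.1))
      (T.contMDiffAt_κ hp).continuousAt (by fun_prop)

theorem mem_box_source [I.Boundaryless] {m : N} (hm : m ∈ T.source) :
    m ∈ (T.box (T.ang m)).source :=
  ⟨hm, by simp [Complex.one_mem_slitPlane]⟩

theorem box_source_subset [I.Boundaryless] (c₀ : Circle) : (T.box c₀).source ⊆ T.source :=
  fun _ hm ↦ hm.1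

theorem contMDiffOn_box [I.Boundaryless] (c₀ : Circle) :
    ContMDiffOn I 𝓘(ℝ, ℝ × (F × ℝ)) ∞ (T.box c₀) (T.box c₀).source := by
  rintro m ⟨hm, hs⟩
  refine ContMDiffAt.contMDiffWithinAt ?_
  have h1 := A.contMDiff_Ψ.contMDiffAt (x := m)
  have h2 := T.contMDiffAt_w hm
  have h3 := contMDiffAt_arg_div (T.contMDiffAt_ang hm) hs
  exact h1.prodMk_space (h2.prodMk_space h3)

theorem contMDiffOn_box_symm [I.Boundaryless] (c₀ : Circle) :
    ContMDiffOn 𝓘(ℝ, ℝ × (F × ℝ)) I ∞ (T.box c₀).symm (T.box c₀).target := by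
  rintro p ⟨hp, ht⟩
  refine ContMDiffAt.contMDiffWithinAt ?_
  refine A.contMDiffAt_act_comp (g := fun p : ℝ × (F × ℝ) ↦ c₀ * Circle.exp p.2.2)
    (h := fun p ↦ T.κ (p.1, p.2.1)) ?_ ?_
  · have : ContDiff ℝ ∞ (fun p : ℝ × (F × ℝ) ↦ ((c₀ * Circle.exp p.2.2 : Circle) : ℂ)) := by
      simp only [Circle.coe_mul, Circle.coe_exp]
      have h1 : ContDiff ℝ ∞ (fun p : ℝ × (F × ℝ) ↦ (p.2.2 : ℂ)) :=
        Complex.ofRealCLM.contDiff.comp (contDiff_snd.comp contDiff_snd)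
      exact contDiff_const.mul ((h1.mul contDiff_const).cexp)
    exact this.contMDiff.contMDiffAt
  · refine ContMDiffAt.comp p (g := T.κ) (f := fun p : ℝ × (F × ℝ) ↦ (p.1, p.2.1))
      (T.contMDiffAt_κ hp) ?_
    have : ContDiff ℝ ∞ (fun p : ℝ × (F × ℝ) ↦ (p.1, p.2.1)) := by fun_prop
    exact this.contMDiff.contMDiffAt

end Slice

end ContactCut

end

/-! ### Smooth structures from atlases; level sets as submanifolds -/

noncomputable section

namespace ContactCut

open Filter Topology

section Atlas

variable {Q : Type*} [TopologicalSpace Q] {F : Type*} [NormedAddCommGroup F] [NormedSpace ℝ F]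

/-- The charted space structure with a given covering set of charts. -/
abbrev chartedSpaceOfAtlas (C : Set (OpenPartialHomeomorph Q F))
    (h : ∀ x, ∃ c ∈ C, x ∈ c.source) : ChartedSpace F Q where
  atlas := C
  chartAt x := (h x).choose
  mem_chart_source x := (h x).choose_spec.2
  chart_mem_atlas x := (h x).choose_spec.1

theorem isManifold_chartedSpaceOfAtlas (C : Set (OpenPartialHomeomorph Q F))
    (h : ∀ x, ∃ c ∈ C, x ∈ c.source)
    (hC : ∀ c ∈ C, ∀ c' ∈ C, ContDiffOn ℝ ∞ (c.symm.trans c') (c.symm.trans c').source) :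
    letI := chartedSpaceOfAtlas C h
    IsManifold 𝓘(ℝ, F) ∞ Q := by
  let _ := chartedSpaceOfAtlas C h
  refine isManifold_of_contDiffOn _ _ _ fun c c' hc hc' ↦ ?_
  simpa using hC c hc c' hc'

end Atlas

section Submanifold

variable {E : Type*} [NormedAddCommGroup E] [NormedSpace ℝ E] {H : Type*} [TopologicalSpace H]
  {I : ModelWithCorners ℝ E H} {N : Type*} [TopologicalSpace N] [ChartedSpace H N]
  {G : Type*} [NormedAddCommGroup G] [NormedSpace ℝ G] {Z : Set N}

variable (I Z) in
/-- A smooth chart with values in `ℝ × G` in which `Z` is the vanishing set of the first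
coordinate. -/
structure IsAdapted (e : OpenPartialHomeomorph N (ℝ × G)) : Prop where
  contMDiffOn : ContMDiffOn I 𝓘(ℝ, ℝ × G) ∞ e e.source
  contMDiffOn_symm : ContMDiffOn 𝓘(ℝ, ℝ × G) I ∞ e.symm e.target
  mem_iff : ∀ m ∈ e.source, m ∈ Z ↔ (e m).1 = 0

theorem IsAdapted.symm_mem {e : OpenPartialHomeomorph N (ℝ × G)} (he : IsAdapted I Z e) {y : G}
    (hy : ((0 : ℝ), y) ∈ e.target) : e.symm (0, y) ∈ Z := by
  rw [he.mem_iff _ (e.map_target hy), e.right_inv hy]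

open Classical in
/-- The chart of `Z` induced by an adapted chart. -/
def levelChart (e : OpenPartialHomeomorph N (ℝ × G)) (he : IsAdapted I Z e) (z₀ : Z) :
    OpenPartialHomeomorph Z G where
  toFun z := (e z).2
  invFun y := if hy : ((0 : ℝ), y) ∈ e.target then ⟨e.symm (0, y), he.symm_mem hy⟩ else z₀
  source := Subtype.val ⁻¹' e.source
  target := {y | ((0 : ℝ), y) ∈ e.target}
  map_source' := by
    intro z hz
    have h : ((0 : ℝ), (e z).2) = e z := Prod.ext ((he.mem_iff _ hz).1 z.2).symm rfl
    change ((0 : ℝ), (e z).2) ∈ e.target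
    rw [h]
    exact e.map_source hz
  map_target' := by
    intro y hy
    replace hy : ((0 : ℝ), y) ∈ e.target := hy
    simp only [dif_pos hy]
    exact e.map_target hy
  left_inv' := by
    intro z hz
    have h : ((0 : ℝ), (e z).2) = e z := Prod.ext ((he.mem_iff _ hz).1 z.2).symm rfl
    have h' : ((0 : ℝ), (e z).2) ∈ e.target := by rw [h]; exact e.map_source hz
    rw [dif_pos h']
    exact Subtype.ext ((congrArg e.symm h).trans (e.left_inv hz))
  right_inv' := by
    intro y hy
    replace hy : ((0 : ℝ), y) ∈ e.target := hy
    simp only [dif_pos hy, e.right_inv hy]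
  open_source := e.open_source.preimage continuous_subtype_val
  open_target := e.open_target.preimage (Continuous.prodMk_right (0 : ℝ))
  continuousOn_toFun := (continuous_snd.comp_continuousOn e.continuousOn).comp
    continuous_subtype_val.continuousOn (fun _ h ↦ h)
  continuousOn_invFun := by
    rw [Topology.IsInducing.subtypeVal.continuousOn_iff]
    refine ContinuousOn.congr (f := fun y ↦ e.symm (0, y)) ?_ ?_
    · exact e.continuousOn_symm.comp (Continuous.prodMk_right (0 : ℝ)).continuousOn (fun _ h ↦ h)
    · intro y hy
      replace hy : ((0 : ℝ), y) ∈ e.target := hy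
      simp only [Function.comp, dif_pos hy]

theorem levelChart_apply (e : OpenPartialHomeomorph N (ℝ × G)) (he : IsAdapted I Z e) (z₀ z : Z) :
    levelChart e he z₀ z = (e z).2 := rfl

theorem levelChart_symm {e : OpenPartialHomeomorph N (ℝ × G)} (he : IsAdapted I Z e) (z₀ : Z)
    {y : G} (hy : ((0 : ℝ), y) ∈ e.target) :
    ((levelChart e he z₀).symm y : N) = e.symm (0, y) := by
  exact congrArg Subtype.val (dif_pos hy)

variable (I Z G) in
/-- The charts of `Z` induced by adapted charts. -/
def levelAtlas : Set (OpenPartialHomeomorph Z G) :=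
  {c | ∃ (e : OpenPartialHomeomorph N (ℝ × G)) (he : IsAdapted I Z e) (z₀ : Z),
    c = levelChart e he z₀}

/-- Transition maps are restrictions to $\{0\}\times G$ of the smooth ambient ones, followed by the
projection to $G$. -/
theorem contDiffOn_levelChart_trans {e e' : OpenPartialHomeomorph N (ℝ × G)}
    (he : IsAdapted I Z e) (he' : IsAdapted I Z e') (z₀ z₀' : Z) :
    ContDiffOn ℝ ∞ ((levelChart e he z₀).symm.trans (levelChart e' he' z₀'))
      ((levelChart e he z₀).symm.trans (levelChart e' he' z₀')).source := by
  intro y hy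
  have hy1 : ((0 : ℝ), y) ∈ e.target := hy.1
  have hy2 : e.symm (0, y) ∈ e'.source := by
    have : ((levelChart e he z₀).symm y : N) ∈ e'.source := hy.2
    rwa [levelChart_symm he z₀ hy1] at this
  have h1 : ContMDiffAt 𝓘(ℝ, G) I ∞ (fun y : G ↦ e.symm (0, y)) y :=
    ContMDiffAt.comp y (g := e.symm)
      (he.contMDiffOn_symm.contMDiffAt (e.open_target.mem_nhds hy1))
      (contDiffAt_const.prodMk contDiffAt_id).contMDiffAt
  have h2 : ContMDiffAt 𝓘(ℝ, G) 𝓘(ℝ, ℝ × G) ∞ (fun y : G ↦ e' (e.symm (0, y))) y :=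
    ContMDiffAt.comp y (g := e') (he'.contMDiffOn.contMDiffAt (e'.open_source.mem_nhds hy2)) h1
  have h3 : ContDiffAt ℝ ∞ (fun y : G ↦ (e' (e.symm (0, y))).2) y :=
    contDiffAt_snd.comp y (contMDiffAt_iff_contDiffAt.1 h2)
  refine h3.contDiffWithinAt.congr (fun z hz ↦ ?_) ?_
  · change (e' ((levelChart e he z₀).symm z : N)).2 = _
    rw [levelChart_symm he z₀ hz.1]
  · change (e' ((levelChart e he z₀).symm y : N)).2 = _
    rw [levelChart_symm he z₀ hy1]

theorem exists_mem_levelAtlas (hcov : ∀ z ∈ Z, ∃ e : OpenPartialHomeomorph N (ℝ × G),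
    IsAdapted I Z e ∧ z ∈ e.source) (z : Z) : ∃ c ∈ levelAtlas I G Z, z ∈ c.source := by
  obtain ⟨e, he, hz⟩ := hcov z z.2
  exact ⟨levelChart e he z, ⟨e, he, z, rfl⟩, hz⟩

theorem isManifold_levelAtlas (hcov : ∀ z ∈ Z, ∃ e : OpenPartialHomeomorph N (ℝ × G),
    IsAdapted I Z e ∧ z ∈ e.source) :
    letI := chartedSpaceOfAtlas (levelAtlas I G Z) (exists_mem_levelAtlas hcov)
    IsManifold 𝓘(ℝ, G) ∞ Z := by
  refine isManifold_chartedSpaceOfAtlas _ _ ?_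
  rintro _ ⟨e, he, z₀, rfl⟩ _ ⟨e', he', z₀', rfl⟩
  exact contDiffOn_levelChart_trans he he' z₀ z₀'

variable [I.Boundaryless] [IsManifold I ∞ N]

/-- A smooth chart with values in a vector space isomorphic to the model space, as a chart with
values in the model. -/
def toModel {V : Type*} [NormedAddCommGroup V] [NormedSpace ℝ V] (L : E ≃L[ℝ] V)
    (e : OpenPartialHomeomorph N V) : OpenPartialHomeomorph N H :=
  e.transHomeomorph (L.symm.toHomeomorph.trans I.toHomeomorph.symm)

theorem toModel_mem_maximalAtlas {V : Type*} [NormedAddCommGroup V] [NormedSpace ℝ V]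
    (L : E ≃L[ℝ] V) (e : OpenPartialHomeomorph N V) (he : ContMDiffOn I 𝓘(ℝ, V) ∞ e e.source)
    (he' : ContMDiffOn 𝓘(ℝ, V) I ∞ e.symm e.target) :
    toModel (I := I) L e ∈ IsManifold.maximalAtlas I ∞ N := by
  have hI : ContMDiff 𝓘(ℝ, E) I ∞ I.symm := by
    have := I.contMDiffOn_symm (n := ∞)
    rwa [I.range_eq_univ, contMDiffOn_univ] at this
  refine OpenPartialHomeomorph.mem_maximalAtlas_of_contMDiffOn _ ?_ ?_
  · exact (hI.comp L.symm.contDiff.contMDiff).comp_contMDiffOn he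
  · refine he'.comp ((L.contDiff.contMDiff.comp I.contMDiff).contMDiffOn) ?_
    intro x hx
    exact hx

omit [ChartedSpace H N] [IsManifold I ∞ N] in
theorem toModel_extend {V : Type*} [NormedAddCommGroup V] [NormedSpace ℝ V] (L : E ≃L[ℝ] V)
    (e : OpenPartialHomeomorph N V) (m : N) :
    (toModel (I := I) L e).extend I m = L.symm (e m) :=
  I.right_inv (by rw [I.range_eq_univ]; trivial)

/-- In an adapted chart and its induced chart the inclusion is $y\mapsto(0,y)$, a linear inclusion
with complement $\mathbb{R}$. -/
theorem isSmoothEmbedding_levelAtlas (L : E ≃L[ℝ] ℝ × G)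
    (hcov : ∀ z ∈ Z, ∃ e : OpenPartialHomeomorph N (ℝ × G), IsAdapted I Z e ∧ z ∈ e.source) :
    letI := chartedSpaceOfAtlas (levelAtlas I G Z) (exists_mem_levelAtlas hcov)
    Manifold.IsSmoothEmbedding 𝓘(ℝ, G) I ∞ (Subtype.val : Z → N) := by
  let _ := chartedSpaceOfAtlas (levelAtlas I G Z) (exists_mem_levelAtlas hcov)
  have : IsManifold 𝓘(ℝ, G) ∞ Z := isManifold_levelAtlas hcov
  refine ⟨Manifold.IsImmersionOfComplement.isImmersion (F := ℝ) fun z ↦ ?_,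
    Topology.IsEmbedding.subtypeVal⟩
  obtain ⟨e, he, hz⟩ := hcov z z.2
  refine Manifold.IsImmersionAtOfComplement.mk_of_continuousAt continuous_subtype_val.continuousAt
    ((ContinuousLinearEquiv.prodComm ℝ G ℝ).trans L.symm) (levelChart e he z)
    (toModel (I := I) L e) hz hz ?_ ?_ ?_
  · exact IsManifold.subset_maximalAtlas ⟨e, he, z, rfl⟩
  · exact toModel_mem_maximalAtlas L e he.contMDiffOn he.contMDiffOn_symm
  · intro y hy
    have hy' : ((0 : ℝ), y) ∈ e.target :=
      show y ∈ (levelChart e he z).target by simpa using hy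
    change (toModel (I := I) L e).extend I ((levelChart e he z).symm y : N) = L.symm (0, y)
    rw [toModel_extend, levelChart_symm he z hy', e.right_inv hy']

end Submanifold

end ContactCut

end

/-! ### The orbit space of a zero level, its charts and its 1-form -/

noncomputable section

namespace ContactCut

open Filter Topology

variable {E : Type*} [NormedAddCommGroup E] [NormedSpace ℝ E] {H : Type*} [TopologicalSpace H]
  {I : ModelWithCorners ℝ E H} {N : Type*} [TopologicalSpace N] [ChartedSpace H N]
  [IsManifold I ∞ N]

/-- A presentation of `Q` as the orbit space of the zero level set of a moment map. -/
structure Reduction (A : HamAction I N) (Z : Set N) (Q : Type*) [TopologicalSpace Q] where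
  q : Z → Q
  mem_iff : ∀ m, m ∈ Z ↔ A.Ψ m = 0
  continuous_q : Continuous q
  isOpenMap_q : IsOpenMap q
  surjective_q : Function.Surjective q
  q_eq_iff : ∀ z z', q z = q z' ↔ ∃ c, (z : N) = A.act c z'

theorem Slice.contDiffAt_w_κ₀ {A : HamAction I N} {F : Type*} [NormedAddCommGroup F]
    [NormedSpace ℝ F] (T T' : Slice A F) {b : F} (hb : b ∈ T.target₀)
    (hb' : T.κ₀ b ∈ T'.source) : ContDiffAt ℝ ∞ (T'.w ∘ T.κ₀) b :=
  contMDiffAt_iff_contDiffAt.1 (ContMDiffAt.comp b (T'.contMDiffAt_w hb') (T.contMDiffAt_κ₀ hb))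

namespace Reduction

variable {A : HamAction I N} {Z : Set N} {Q : Type*} [TopologicalSpace Q] (R : Reduction A Z Q)
  {F : Type*} [NormedAddCommGroup F] [NormedSpace ℝ F]

include R in
theorem Ψ_eq_zero (z : Z) : A.Ψ z = 0 := (R.mem_iff z).1 z.2

theorem isOpenQuotientMap : IsOpenQuotientMap R.q :=
  ⟨R.surjective_q, R.continuous_q, R.isOpenMap_q⟩

include R in
theorem secondCountableTopology [SecondCountableTopology N] : SecondCountableTopology Q :=
  ((TopologicalSpace.isBasis_countableBasis Z).isQuotientMap R.isOpenQuotientMap.isQuotientMap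
    R.isOpenMap_q).secondCountableTopology
    ((TopologicalSpace.countable_countableBasis Z).image _)

include R in
-- The orbit relation is the projection of a closed subset of `Circle × (Z × Z)`; projecting along a
-- compact factor preserves closedness.
theorem t2Space [T2Space N] : T2Space Q := by
  rw [t2Space_iff_of_isOpenQuotientMap R.isOpenQuotientMap]
  have h1 : IsClosed {p : Circle × (Z × Z) | (p.2.1 : N) = A.act p.1 p.2.2} := by
    refine isClosed_eq (by fun_prop) ?_
    exact A.continuous_act.comp (f := fun p : Circle × (Z × Z) ↦ (p.1, (p.2.2 : N))) (by fun_prop)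
  have h2 := isClosedMap_snd_of_compactSpace (X := Circle) (Y := Z × Z) _ h1
  convert h2 using 1
  ext p
  simp only [mem_image]
  constructor
  · intro h
    obtain ⟨c, hc⟩ := (R.q_eq_iff _ _).1 h
    exact ⟨(c, p), hc, rfl⟩
  · rintro ⟨⟨c, p'⟩, hc, rfl⟩
    exact (R.q_eq_iff _ _).2 ⟨c, hc⟩

/-- The point of the level set on a slice. -/
def pt (T : Slice A F) (b : F) (hb : b ∈ T.target₀) : Z := ⟨T.κ₀ b, (R.mem_iff _).2 (T.Ψ_κ₀ hb)⟩

theorem mem_source_of_q_eq {T : Slice A F} {z z' : Z} (h : R.q z = R.q z')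
    (hz : (z : N) ∈ T.source) : (z' : N) ∈ T.source ∧ T.w z' = T.w z := by
  obtain ⟨c, hc⟩ := (R.q_eq_iff _ _).1 h.symm
  rw [hc]
  exact ⟨T.act_mem c _ hz, T.w_act c _ hz⟩

theorem q_pt_w (T : Slice A F) {z : Z} (hz : (z : N) ∈ T.source) :
    R.q (R.pt T (T.w z) (T.w_mem hz (R.Ψ_eq_zero z))) = R.q z := by
  symm
  rw [R.q_eq_iff]
  exact ⟨T.ang z, (T.act_ang₀ hz (R.Ψ_eq_zero z)).symm⟩

open Classical in
/-- The chart of the orbit space given by a slice. -/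
def chart (T : Slice A F) (z₀ : Z) : OpenPartialHomeomorph Q F where
  -- `w` is invariant, so the chosen representative of the orbit does not matter.
  toFun x := T.w (R.surjective_q x).choose
  invFun b := if hb : b ∈ T.target₀ then R.q (R.pt T b hb) else R.q z₀
  source := R.q '' (Subtype.val ⁻¹' T.source)
  target := T.target₀
  map_source' := by
    rintro _ ⟨z, hz, rfl⟩
    obtain ⟨h1, h2⟩ := R.mem_source_of_q_eq (R.surjective_q (R.q z)).choose_spec.symm hz
    exact T.w_mem h1 (R.Ψ_eq_zero _)
  map_target' := by
    intro b hb
    rw [dif_pos hb]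
    exact ⟨_, T.κ₀_mem hb, rfl⟩
  left_inv' := by
    rintro _ ⟨z, hz, rfl⟩
    obtain ⟨h1, h2⟩ := R.mem_source_of_q_eq (R.surjective_q (R.q z)).choose_spec.symm hz
    rw [dif_pos (T.w_mem h1 (R.Ψ_eq_zero _)), R.q_pt_w T h1, (R.surjective_q (R.q z)).choose_spec]
  right_inv' := by
    intro b hb
    rw [dif_pos hb]
    obtain ⟨h1, h2⟩ := R.mem_source_of_q_eq (z := R.pt T b hb)
      (R.surjective_q (R.q (R.pt T b hb))).choose_spec.symm (T.κ₀_mem hb)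
    rw [h2]
    exact T.w_κ₀ hb
  open_source := R.isOpenMap_q _ (T.isOpen_source.preimage continuous_subtype_val)
  open_target := T.isOpen_target₀
  continuousOn_toFun := by
    rintro _ ⟨z, hz, rfl⟩
    refine ContinuousAt.continuousWithinAt ?_
    rw [← R.isOpenQuotientMap.continuousAt_comp_iff]
    have h1 : ContinuousAt (fun z : Z ↦ T.w z) z :=
      ContinuousAt.comp (f := Subtype.val) (T.contMDiffAt_w hz).continuousAt
        continuous_subtype_val.continuousAt
    refine h1.congr ?_
    filter_upwards [(T.isOpen_source.preimage continuous_subtype_val).mem_nhds hz] with z' hz'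
    exact (R.mem_source_of_q_eq (R.surjective_q (R.q z')).choose_spec.symm hz').2.symm
  continuousOn_invFun := by
    have h1 : ContinuousOn (fun b ↦ T.κ₀ b) T.target₀ := fun b hb ↦
      (T.contMDiffAt_κ₀ hb).continuousAt.continuousWithinAt
    rw [continuousOn_iff_continuous_domRestrict] at h1 ⊢
    have h2 : Continuous fun b : T.target₀ ↦ R.pt T b b.2 := h1.subtype_mk _
    refine (R.continuous_q.comp h2).congr fun b ↦ ?_
    simp [b.2]

theorem chart_q (T : Slice A F) (z₀ : Z) {z : Z} (hz : (z : N) ∈ T.source) :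
    R.chart T z₀ (R.q z) = T.w z :=
  (R.mem_source_of_q_eq (R.surjective_q (R.q z)).choose_spec.symm hz).2

theorem chart_symm (T : Slice A F) (z₀ : Z) {b : F} (hb : b ∈ T.target₀) :
    (R.chart T z₀).symm b = R.q (R.pt T b hb) := dif_pos hb

theorem mem_chart_source_iff (T : Slice A F) (z₀ : Z) {z : Z} :
    R.q z ∈ (R.chart T z₀).source ↔ (z : N) ∈ T.source := by
  refine ⟨?_, fun h ↦ ⟨z, h, rfl⟩⟩
  rintro ⟨z', hz', h⟩
  exact (R.mem_source_of_q_eq h hz').1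

variable (F) in
/-- The charts of the orbit space given by slices. -/
def atlas : Set (OpenPartialHomeomorph Q F) := {c | ∃ (T : Slice A F) (z₀ : Z), c = R.chart T z₀}

/-- The transition from `T` to `T'` is `T'.w ∘ T.κ₀`: lift by one slice and read the invariant
coordinate of the other. -/
theorem contDiffOn_chart_trans (T T' : Slice A F) (z₀ z₀' : Z) :
    ContDiffOn ℝ ∞ ((R.chart T z₀).symm.trans (R.chart T' z₀'))
      ((R.chart T z₀).symm.trans (R.chart T' z₀')).source := by
  have key : ∀ b ∈ ((R.chart T z₀).symm.trans (R.chart T' z₀')).source, b ∈ T.target₀ ∧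
      T.κ₀ b ∈ T'.source ∧ (R.chart T z₀).symm.trans (R.chart T' z₀') b = T'.w (T.κ₀ b) := by
    rintro b ⟨hb, hb'⟩
    replace hb : b ∈ T.target₀ := hb
    replace hb' : (R.chart T z₀).symm b ∈ (R.chart T' z₀').source := hb'
    rw [R.chart_symm T z₀ hb, R.mem_chart_source_iff] at hb'
    refine ⟨hb, hb', ?_⟩
    change R.chart T' z₀' ((R.chart T z₀).symm b) = _
    rw [R.chart_symm T z₀ hb, R.chart_q T' z₀' hb']
    rfl
  intro b hb
  exact (T.contDiffAt_w_κ₀ T' (key b hb).1 (key b hb).2.1).contDiffWithinAt.congr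
    (fun b hb ↦ (key b hb).2.2) (key b hb).2.2

theorem exists_mem_atlas (hcov : ∀ z ∈ Z, ∃ T : Slice A F, z ∈ T.source) (x : Q) :
    ∃ c ∈ R.atlas F, x ∈ c.source := by
  obtain ⟨z, rfl⟩ := R.surjective_q x
  obtain ⟨T, hT⟩ := hcov z z.2
  exact ⟨R.chart T z, ⟨T, z, rfl⟩, (R.mem_chart_source_iff T z).2 hT⟩

/-- The smooth structure of the orbit space. -/
abbrev chartedSpace (hcov : ∀ z ∈ Z, ∃ T : Slice A F, z ∈ T.source) : ChartedSpace F Q :=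
  chartedSpaceOfAtlas (R.atlas F) (R.exists_mem_atlas hcov)

theorem isManifold (hcov : ∀ z ∈ Z, ∃ T : Slice A F, z ∈ T.source) :
    letI := R.chartedSpace hcov
    IsManifold 𝓘(ℝ, F) ∞ Q := by
  refine isManifold_chartedSpaceOfAtlas _ _ ?_
  rintro _ ⟨T, z₀, rfl⟩ _ ⟨T', z₀', rfl⟩
  exact R.contDiffOn_chart_trans T T' z₀ z₀'

theorem chart_mem_maximalAtlas (hcov : ∀ z ∈ Z, ∃ T : Slice A F, z ∈ T.source) (T : Slice A F)
    (z₀ : Z) :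
    letI := R.chartedSpace hcov
    R.chart T z₀ ∈ IsManifold.maximalAtlas 𝓘(ℝ, F) ∞ Q := by
  let _ := R.chartedSpace hcov
  have := R.isManifold hcov
  exact IsManifold.subset_maximalAtlas ⟨T, z₀, rfl⟩

section Form

variable [ChartedSpace F Q] (hcov : ∀ z ∈ Z, ∃ T : Slice A F, z ∈ T.source)

/-- The `1`-form induced on the orbit space. -/
def form : OneForm 𝓘(ℝ, F) Q := fun x ↦
  -- The map $y\mapsto\kappa_0(\mathrm{chart}\,y)$ is a local section of the orbit map, taken from a
  -- slice chosen for `x`. Independence of the choice is `localForm_chart_symm`.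
  pullback 𝓘(ℝ, F) I (fun y ↦ (hcov _ (R.surjective_q x).choose.2).choose.κ₀
    (R.chart (hcov _ (R.surjective_q x).choose.2).choose (R.surjective_q x).choose y)) A.form x

variable [IsManifold 𝓘(ℝ, F) ∞ Q]
  (hat : ∀ (T : Slice A F) (z₀ : Z), R.chart T z₀ ∈ IsManifold.maximalAtlas 𝓘(ℝ, F) ∞ Q)

include hat

omit [IsManifold 𝓘(ℝ, F) ∞ Q] in
theorem contMDiffAt_chart_symm (T : Slice A F) (z₀ : Z) {b : F} (hb : b ∈ T.target₀) :
    ContMDiffAt 𝓘(ℝ, F) 𝓘(ℝ, F) ∞ (R.chart T z₀).symm b :=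
  contMDiffAt_symm_of_mem_maximalAtlas (hat T z₀) hb

omit [IsManifold 𝓘(ℝ, F) ∞ Q] in
theorem contMDiffAt_chart (T : Slice A F) (z₀ : Z) {z : Z} (hz : (z : N) ∈ T.source) :
    ContMDiffAt 𝓘(ℝ, F) 𝓘(ℝ, F) ∞ (R.chart T z₀) (R.q z) :=
  contMDiffAt_of_mem_maximalAtlas (hat T z₀) ((R.mem_chart_source_iff T z₀).2 hz)

omit [IsManifold 𝓘(ℝ, F) ∞ Q] in
-- The chosen slice `T'` and the given `T` are compared by applying `Slice.localForm_eq` to `T.κ₀`,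
-- which lies in the zero level.
theorem localForm_chart_symm (T : Slice A F) (z₀ : Z) {b : F} (hb : b ∈ T.target₀) :
    localForm 𝓘(ℝ, F) (R.chart T z₀).symm (R.form hcov) b = localForm I T.κ₀ A.form b := by
  set x := (R.chart T z₀).symm b with hx
  set z₁ := (R.surjective_q x).choose with hz₁
  set T' := (hcov _ z₁.2).choose with hT'
  have hz₁T' : (z₁ : N) ∈ T'.source := (hcov _ z₁.2).choose_spec
  have hqz₁ : R.q z₁ = x := (R.surjective_q x).choose_spec
  have hxq : x = R.q (R.pt T b hb) := R.chart_symm T z₀ hb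
  have hbT' : T.κ₀ b ∈ T'.source := (R.mem_source_of_q_eq (hqz₁.trans hxq) hz₁T').1
  have hchx : ContMDiffAt 𝓘(ℝ, F) 𝓘(ℝ, F) ∞ (R.chart T' z₁) x := by
    rw [hxq]
    exact R.contMDiffAt_chart hat T' z₁ hbT'
  have hxv : R.chart T' z₁ x = T'.w (T.κ₀ b) := by
    rw [hxq]
    exact R.chart_q T' z₁ hbT'
  have hw : T'.w (T.κ₀ b) ∈ T'.target₀ := T'.w_mem hbT' (T.Ψ_κ₀ hb)
  have hκ' : ContMDiffAt 𝓘(ℝ, F) I ∞ T'.κ₀ (R.chart T' z₁ x) := by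
    rw [hxv]
    exact T'.contMDiffAt_κ₀ hw
  have h1 := pullback_comp (I := 𝓘(ℝ, F)) (fun y ↦ T'.κ₀ (R.chart T' z₁ y)) (R.chart T z₀).symm
    A.form (x := b) ((ContMDiffAt.comp x hκ' hchx).mdifferentiableAt (by simp))
    ((R.contMDiffAt_chart_symm hat T z₀ hb).mdifferentiableAt (by simp))
  have hev : T.target₀ ∩ T.κ₀ ⁻¹' T'.source ∈ 𝓝 b :=
    inter_mem (T.isOpen_target₀.mem_nhds hb)
      ((T.contMDiffAt_κ₀ hb).continuousAt.preimage_mem_nhds (T'.isOpen_source.mem_nhds hbT'))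
  have h2 : (fun y ↦ T'.κ₀ (R.chart T' z₁ y)) ∘ (R.chart T z₀).symm =ᶠ[𝓝 b]
      T'.κ₀ ∘ (T'.w ∘ T.κ₀) := by
    filter_upwards [hev] with b' hb'
    simp only [Function.comp]
    rw [R.chart_symm T z₀ hb'.1, R.chart_q T' z₁ (z := R.pt T b' hb'.1) hb'.2]
    rfl
  have h3 : localForm 𝓘(ℝ, F) (R.chart T z₀).symm (R.form hcov) b =
      localForm I ((fun y ↦ T'.κ₀ (R.chart T' z₁ y)) ∘ (R.chart T z₀).symm) A.form b := h1.symm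
  rw [h3, localForm_congr _ h2, localForm_comp (κ := T'.κ₀) (g := T'.w ∘ T.κ₀) A.form
      ((T'.contMDiffAt_κ₀ hw).mdifferentiableAt (by simp))
      ((T.contDiffAt_w_κ₀ T' hb hbT').differentiableAt (by simp))]
  refine (T'.localForm_eq (T.contMDiffAt_κ₀ hb) ?_ hbT').symm
  filter_upwards [hev] with b' hb' using T.Ψ_κ₀ hb'.1

theorem isSmoothForm_form [I.Boundaryless] : IsSmoothForm 𝓘(ℝ, F) (R.form hcov) := by
  rw [isSmoothForm_iff]
  intro x
  obtain ⟨z, rfl⟩ := R.surjective_q x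
  obtain ⟨T, hT⟩ := hcov z z.2
  have hw : T.w z ∈ T.target₀ := T.w_mem hT (R.Ψ_eq_zero z)
  have h0 : R.chart T z (R.q z) = T.w z := R.chart_q T z hT
  refine contMDiffAt_form_of_localForm (κ := (R.chart T z).symm)
    (R.contMDiffAt_chart hat T z hT) ?_ ?_ ?_
  · rw [h0]
    exact R.contMDiffAt_chart_symm hat T z hw
  · filter_upwards [(R.chart T z).open_source.mem_nhds ((R.mem_chart_source_iff T z).2 hT)]
      with y hy using (R.chart T z).left_inv hy
  · rw [h0]
    refine (contDiffAt_localForm A.smooth_form (T.contMDiffAt_κ₀ hw)).congr_of_eventuallyEq ?_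
    filter_upwards [T.isOpen_target₀.mem_nhds hw] with b hb
    exact R.localForm_chart_symm hcov hat T z hb

end Form

end Reduction

end ContactCut

end

/-! ### The orbit map is a submersion and the form descends -/

noncomputable section

namespace ContactCut

open Filter Topology

variable {E : Type*} [NormedAddCommGroup E] [NormedSpace ℝ E] {H : Type*} [TopologicalSpace H]
  {I : ModelWithCorners ℝ E H} {N : Type*} [TopologicalSpace N] [ChartedSpace H N]
  [IsManifold I ∞ N] {A : HamAction I N} {Z : Set N} {Q : Type*} [TopologicalSpace Q]
  {F : Type*} [NormedAddCommGroup F] [NormedSpace ℝ F]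
  {G : Type*} [NormedAddCommGroup G] [NormedSpace ℝ G] [I.Boundaryless]

namespace Slice

/-- The chart `box` with the last two coordinates read in `G`. -/
def adapted (T : Slice A F) (L : G ≃L[ℝ] F × ℝ) (c₀ : Circle) : OpenPartialHomeomorph N (ℝ × G) :=
  (T.box c₀).transHomeomorph ((ContinuousLinearEquiv.refl ℝ ℝ).prodCongr L.symm).toHomeomorph

theorem adapted_apply (T : Slice A F) (L : G ≃L[ℝ] F × ℝ) (c₀ : Circle) (m : N) :
    T.adapted L c₀ m = (A.Ψ m, L.symm (T.w m, Complex.arg ((T.ang m / c₀ : Circle) : ℂ))) := rfl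

theorem adapted_symm_apply (T : Slice A F) (L : G ≃L[ℝ] F × ℝ) (c₀ : Circle) (p : ℝ × G) :
    (T.adapted L c₀).symm p = A.act (c₀ * Circle.exp (L p.2).2) (T.κ (p.1, (L p.2).1)) := rfl

theorem isAdapted_adapted (T : Slice A F) (L : G ≃L[ℝ] F × ℝ) (c₀ : Circle)
    (hZ : ∀ m, m ∈ Z ↔ A.Ψ m = 0) : IsAdapted I Z (T.adapted L c₀) where
  contMDiffOn :=
    ((ContinuousLinearEquiv.refl ℝ ℝ).prodCongr L.symm).contDiff.contMDiff.comp_contMDiffOn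
      (T.contMDiffOn_box c₀)
  contMDiffOn_symm := (T.contMDiffOn_box_symm c₀).comp
    (((ContinuousLinearEquiv.refl ℝ ℝ).prodCongr L.symm).symm.contDiff.contMDiff.contMDiffOn)
    (fun _ h ↦ h)
  mem_iff m _ := hZ m

theorem mem_target_of_mem_adapted_target {T : Slice A F} {L : G ≃L[ℝ] F × ℝ} {c₀ : Circle} {y : G}
    (hy : ((0 : ℝ), y) ∈ (T.adapted L c₀).target) : (L y).1 ∈ T.target₀ := hy.1

theorem mem_source_of_mem_adapted_target {T : Slice A F} {L : G ≃L[ℝ] F × ℝ} {c₀ : Circle} {y : G}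
    (hy : ((0 : ℝ), y) ∈ (T.adapted L c₀).target) :
    (T.adapted L c₀).symm (0, y) ∈ T.source ∧ T.w ((T.adapted L c₀).symm (0, y)) = (L y).1 := by
  have h := T.κ₀_mem hy.1
  rw [adapted_symm_apply]
  exact ⟨T.act_mem _ _ h, (T.w_act _ _ h).trans (T.w_κ₀ hy.1)⟩

end Slice

namespace Reduction

section Submersion

variable (R : Reduction A Z Q) [ChartedSpace F Q]
  (hcov : ∀ z ∈ Z, ∃ T : Slice A F, z ∈ T.source)
  (hat : ∀ (T : Slice A F) (z₀ : Z), R.chart T z₀ ∈ IsManifold.maximalAtlas 𝓘(ℝ, F) ∞ Q)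

omit [ChartedSpace F Q] in
include R hcov in
theorem exists_isAdapted (L : G ≃L[ℝ] F × ℝ) : ∀ z ∈ Z, ∃ e : OpenPartialHomeomorph N (ℝ × G),
    IsAdapted I Z e ∧ z ∈ e.source := fun z hz ↦ by
  obtain ⟨T, hT⟩ := hcov z hz
  exact ⟨T.adapted L (T.ang z), T.isAdapted_adapted L _ R.mem_iff, T.mem_box_source hT⟩

include hat

/-- In the coordinates ($w$, angle) upstairs and $w$ downstairs the orbit map forgets the angle. -/
theorem isSubmersion_q (L : G ≃L[ℝ] F × ℝ) :
    letI := chartedSpaceOfAtlas (levelAtlas I G Z)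
      (exists_mem_levelAtlas (R.exists_isAdapted hcov L))
    Manifold.IsSubmersion 𝓘(ℝ, G) 𝓘(ℝ, F) ∞ R.q := by
  let _ := chartedSpaceOfAtlas (levelAtlas I G Z)
      (exists_mem_levelAtlas (R.exists_isAdapted hcov L))
  have : IsManifold 𝓘(ℝ, G) ∞ Z := isManifold_levelAtlas (R.exists_isAdapted hcov L)
  refine Manifold.IsSubmersionOfComplement.isSubmersion (F := ℝ) fun z ↦ ?_
  obtain ⟨T, hT⟩ := hcov z z.2
  have he := T.isAdapted_adapted L (T.ang z) R.mem_iff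
  refine Manifold.IsSubmersionAtOfComplement.mk_of_continuousAt R.continuous_q.continuousAt
    L (levelChart _ he z) (R.chart T z) (T.mem_box_source hT) ((R.mem_chart_source_iff T z).2 hT)
    (IsManifold.subset_maximalAtlas ⟨_, he, z, rfl⟩) (hat T z) ?_
  intro y hy
  have hy' : ((0 : ℝ), y) ∈ (T.adapted L (T.ang z)).target :=
    show y ∈ (levelChart _ he z).target by simpa using hy
  have h1 := Slice.mem_source_of_mem_adapted_target hy'
  rw [← levelChart_symm he z hy'] at h1
  change R.chart T z (R.q ((levelChart _ he z).symm y)) = (L y).1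
  rw [R.chart_q T z h1.1, h1.2]

/-- Both maps factor through the same chart `c` of the level set. After cancelling it, the claim
compares forms on $G$, and `Slice.localForm_eq` says that the restricted form only sees the
coordinate $w$. -/
theorem pullback_q_form (L : G ≃L[ℝ] F × ℝ) :
    letI := chartedSpaceOfAtlas (levelAtlas I G Z)
      (exists_mem_levelAtlas (R.exists_isAdapted hcov L))
    pullback 𝓘(ℝ, G) 𝓘(ℝ, F) R.q (R.form hcov) =
      pullback 𝓘(ℝ, G) I (Subtype.val : Z → N) A.form := by
  let _ := chartedSpaceOfAtlas (levelAtlas I G Z)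
      (exists_mem_levelAtlas (R.exists_isAdapted hcov L))
  have : IsManifold 𝓘(ℝ, G) ∞ Z := isManifold_levelAtlas (R.exists_isAdapted hcov L)
  funext z
  obtain ⟨T, hT⟩ := hcov z z.2
  set e := T.adapted L (T.ang z) with he_def
  have he : IsAdapted I Z e := T.isAdapted_adapted L (T.ang z) R.mem_iff
  set c := levelChart e he z with hc
  have hz : z ∈ c.source := T.mem_box_source hT
  have hcm : ContMDiffAt 𝓘(ℝ, G) 𝓘(ℝ, G) ∞ c z := contMDiffAt_of_mem_maximalAtlas
    (IsManifold.subset_maximalAtlas ⟨_, he, z, rfl⟩) hz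
  have hcz : ((0 : ℝ), c z) ∈ e.target := c.map_source hz
  set j : G → N := fun y ↦ e.symm (0, y) with hj
  set g : G → F := fun y ↦ (L y).1 with hg
  have hgd : ∀ y, DifferentiableAt ℝ g y := fun y ↦ by fun_prop
  have hjm : ContMDiffAt 𝓘(ℝ, G) I ∞ j (c z) :=
    ContMDiffAt.comp (c z) (g := e.symm)
      (he.contMDiffOn_symm.contMDiffAt (e.open_target.mem_nhds hcz))
      (contDiffAt_const.prodMk contDiffAt_id).contMDiffAt
  have hb : g (c z) ∈ T.target₀ := Slice.mem_target_of_mem_adapted_target hcz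
  have hsm : MDifferentiableAt 𝓘(ℝ, F) 𝓘(ℝ, F) (R.chart T z).symm (g (c z)) :=
    (R.contMDiffAt_chart_symm hat T z hb).mdifferentiableAt (by simp)
  have h1 : (Subtype.val : Z → N) =ᶠ[𝓝 z] j ∘ c := by
    filter_upwards [c.open_source.mem_nhds hz] with z' hz'
    exact (congrArg Subtype.val (c.left_inv hz')).symm.trans
      (levelChart_symm he z (c.map_source hz'))
  have hnhds : ∀ᶠ y in 𝓝 (c z), ((0 : ℝ), y) ∈ e.target := c.open_target.mem_nhds hcz
  have h2 : R.q =ᶠ[𝓝 z] ((R.chart T z).symm ∘ g) ∘ c := by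
    filter_upwards [c.open_source.mem_nhds hz] with z' hz'
    have hz'T : (z' : N) ∈ T.source := T.box_source_subset _ hz'
    have : g (c z') = T.w z' := by
      simp only [hg, hc, levelChart_apply, he_def, Slice.adapted_apply, L.apply_symm_apply]
    simp only [Function.comp, this]
    rw [← R.chart_q T z hz'T, (R.chart T z).left_inv ((R.mem_chart_source_iff T z).2 hz'T)]
  rw [pullback_congr _ h1, pullback_congr _ h2,
    pullback_comp j c A.form (hjm.mdifferentiableAt (by simp)) (hcm.mdifferentiableAt (by simp)),
    pullback_comp ((R.chart T z).symm ∘ g) c _ (hsm.comp _ (hgd _).mdifferentiableAt)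
      (hcm.mdifferentiableAt (by simp))]
  congr 1
  change localForm 𝓘(ℝ, F) ((R.chart T z).symm ∘ g) (R.form hcov) (c z) = localForm I j A.form (c z)
  have h3 := Slice.mem_source_of_mem_adapted_target hcz
  have h4 : T.w ∘ j =ᶠ[𝓝 (c z)] g := by
    filter_upwards [hnhds] with y hy using (Slice.mem_source_of_mem_adapted_target hy).2
  rw [localForm_comp _ hsm (hgd _), R.localForm_chart_symm hcov hat T z hb,
    T.localForm_eq hjm ?_ h3.1, h4.fderiv_eq,
    show T.w (j (c z)) = g (c z) from h4.eq_of_nhds]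
  filter_upwards [hnhds] with y hy using (R.mem_iff _).1 (he.symm_mem hy)

end Submersion

/-- The two extra dimensions of `E` over the quotient are the moment map value and the angle. -/
theorem descendsTo (R : Reduction A Z Q) {d : ℕ}
    [ChartedSpace (EuclideanSpace ℝ (Fin d)) Q] [IsManifold (𝓡 d) ∞ Q]
    (hcov : ∀ z ∈ Z, ∃ T : Slice A (EuclideanSpace ℝ (Fin d)), z ∈ T.source)
    (hat : ∀ (T : Slice A (EuclideanSpace ℝ (Fin d))) (z₀ : Z),
      R.chart T z₀ ∈ IsManifold.maximalAtlas (𝓡 d) ∞ Q) [FiniteDimensional ℝ E]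
    (hE : Module.finrank ℝ E = d + 2) : DescendsTo I A.form Z R.q (R.form hcov) := by
  have L : EuclideanSpace ℝ (Fin (d + 1)) ≃L[ℝ] EuclideanSpace ℝ (Fin d) × ℝ :=
    ContinuousLinearEquiv.ofFinrankEq (by simp)
  have L' : E ≃L[ℝ] ℝ × EuclideanSpace ℝ (Fin (d + 1)) :=
    ContinuousLinearEquiv.ofFinrankEq (by simp [hE]; omega)
  exact ⟨chartedSpaceOfAtlas (levelAtlas I _ Z) (exists_mem_levelAtlas (R.exists_isAdapted hcov L)),
    isManifold_levelAtlas (R.exists_isAdapted hcov L),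
    isSmoothEmbedding_levelAtlas L' (R.exists_isAdapted hcov L),
    R.isSubmersion_q hcov hat L, R.pullback_q_form hcov hat L⟩

end Reduction

end ContactCut

end

/-! ### The action in a chart: nonvanishing generator and regular moment map -/

noncomputable section

namespace ContactCut

open Filter Topology

/-- The inverse function theorem, with smoothness of the inverse on an open set. -/
theorem exists_openPartialHomeomorph_of_hasFDerivAt {V W : Type*} [NormedAddCommGroup V]
    [NormedSpace ℝ V] [CompleteSpace V] [NormedAddCommGroup W] [NormedSpace ℝ W] {f : V → W}
    {U : Set V} (hU : IsOpen U) (hf : ∀ x ∈ U, ContDiffAt ℝ ∞ f x) {x : V} (hx : x ∈ U)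
    (f' : V ≃L[ℝ] W) (hf' : HasFDerivAt f (f' : V →L[ℝ] W) x) :
    ∃ e : OpenPartialHomeomorph V W, x ∈ e.source ∧ e.source ⊆ U ∧ (∀ y, e y = f y) ∧
      ∀ z ∈ e.target, ContDiffAt ℝ ∞ e.symm z := by
  have h0 := (hf x hx).toOpenPartialHomeomorph_coe hf' (by simp)
  set e₀ := (hf x hx).toOpenPartialHomeomorph f hf' (by simp) with he₀
  have hx₀ : x ∈ e₀.source := (hf x hx).mem_toOpenPartialHomeomorph_source hf' (by simp)
  have hcont : ContinuousOn (fderiv ℝ f) U := fun y hy ↦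
    (((hf y hy).fderiv_right (m := ∞) (by simp)).continuousAt).continuousWithinAt
  -- Restricting to the open set where the derivative is invertible makes the inverse smooth on the
  -- whole target, not only at the image of `x`.
  have hopen : IsOpen (U ∩ fderiv ℝ f ⁻¹' range ((↑) : (V ≃L[ℝ] W) → V →L[ℝ] W)) :=
    hcont.isOpen_inter_preimage hU ContinuousLinearEquiv.isOpen
  refine ⟨e₀.restrOpen _ hopen, ⟨hx₀, hx, f', hf'.fderiv.symm⟩, fun y hy ↦ hy.2.1, fun y ↦ ?_, ?_⟩
  · exact congrFun h0 y
  · intro z hz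
    obtain ⟨hz1, hz2, g, hg⟩ := (e₀.restrOpen _ hopen).map_target hz
    refine e₀.contDiffAt_symm (f₀' := g) hz.1 ?_ ?_
    · have := ((hf _ hz2).differentiableAt (by simp)).hasFDerivAt
      rw [← hg] at this
      rw [h0]
      exact this
    · rw [h0]
      exact hf _ hz2

variable {E : Type*} [NormedAddCommGroup E] [NormedSpace ℝ E] {H : Type*} [TopologicalSpace H]
  {I : ModelWithCorners ℝ E H} {N : Type*} [TopologicalSpace N] [ChartedSpace H N]
  [IsManifold I ∞ N]

theorem exists_wedgePow_ne_zero_of_localForm [I.Boundaryless] {V : Type*} [NormedAddCommGroup V]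
    [NormedSpace ℝ V] {α : OneForm I N} (hα : IsSmoothForm I α) {κ : V → N} {y : V}
    (hκ : ContMDiffAt 𝓘(ℝ, V) I ∞ κ y) {n : ℕ} {u : Fin (2 * n + 1) → V}
    (hu : wedgePow n (localForm I κ α y) (extD (localForm I κ α) y) u ≠ 0) :
    ∃ v : Fin (2 * n + 1) → TangentSpace I (κ y),
      wedgePow n (α (κ y)) (extDerivForm I α (κ y)) v ≠ 0 :=
  ⟨_, by rwa [wedgePow_localForm hα hκ] at hu⟩

theorem exists_localForm_extChartAt_wedgePow_ne_zero [I.Boundaryless] {α : OneForm I N}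
    (hα : IsSmoothForm I α) {n : ℕ}
    (hw : ∀ q, ∃ v : Fin (2 * n + 1) → TangentSpace I q,
      wedgePow n (α q) (extDerivForm I α q) v ≠ 0) (p : N) {y : E}
    (hy : y ∈ (extChartAt I p).target) :
    ∃ u : Fin (2 * n + 1) → E, wedgePow n (localForm I (extChartAt I p).symm α y)
      (extD (localForm I (extChartAt I p).symm α) y) u ≠ 0 := by
  obtain ⟨v, hv⟩ := hw ((extChartAt I p).symm y)
  have h1 := isInvertible_mfderivWithin_extChartAt_symm hy
  rw [I.range_eq_univ, mfderivWithin_univ] at h1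
  obtain ⟨u, hu⟩ : ∃ u : Fin (2 * n + 1) → E,
      ∀ i, mfderiv 𝓘(ℝ, E) I (extChartAt I p).symm y (u i) = v i :=
    ⟨fun i ↦ (h1.bijective.surjective (v i)).choose,
      fun i ↦ (h1.bijective.surjective (v i)).choose_spec⟩
  refine ⟨u, ?_⟩
  rw [wedgePow_localForm hα (contMDiffAt_extChartAt_symm p hy)]
  convert hv using 2
  funext i
  exact hu i

namespace HamAction

variable (A : HamAction I N) (p : N)

/-- The flow of the circle action in the chart around `p`. -/
def flow (z : ℝ × E) : E :=
  extChartAt I p (A.act (Circle.exp z.1) ((extChartAt I p).symm z.2))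

/-- The generator of the circle action at `p`, in the chart around `p`. -/
def gen : E := fderiv ℝ (A.flow p) (0, extChartAt I p p) (1, 0)

/-- The domain of `flow`. -/
def flowDomain : Set (ℝ × E) :=
  {z | z.2 ∈ (extChartAt I p).target ∧
    A.act (Circle.exp z.1) ((extChartAt I p).symm z.2) ∈ (extChartAt I p).source}

theorem mem_flowDomain : (0, extChartAt I p p) ∈ A.flowDomain p := by
  refine ⟨mem_extChartAt_target p, ?_⟩
  simp only
  rw [Circle.exp_zero, A.act_one, extChartAt_to_inv]
  exact mem_extChartAt_source p

theorem flow_zero {y : E} (hy : y ∈ (extChartAt I p).target) : A.flow p (0, y) = y := by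
  simp only [flow, Circle.exp_zero, A.act_one, (extChartAt I p).right_inv hy]

theorem extChartAt_symm_flow {z : ℝ × E} (hz : z ∈ A.flowDomain p) :
    (extChartAt I p).symm (A.flow p z) =
      A.act (Circle.exp z.1) ((extChartAt I p).symm z.2) :=
  (extChartAt I p).left_inv hz.2

variable [I.Boundaryless]

theorem contMDiffAt_act_extChartAt_symm {z : ℝ × E} (hz : z.2 ∈ (extChartAt I p).target) :
    ContMDiffAt 𝓘(ℝ, ℝ × E) I ∞
      (fun z : ℝ × E ↦ A.act (Circle.exp z.1) ((extChartAt I p).symm z.2)) z := by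
  have h1 : ContMDiffAt 𝓘(ℝ, ℝ × E) (𝓘(ℝ, ℝ).prod I) ∞
      (fun p' : ℝ × E ↦ (p'.1, (extChartAt I p).symm p'.2)) z := by
    refine ContMDiffAt.prodMk contDiffAt_fst.contMDiffAt ?_
    exact ContMDiffAt.comp z (g := (extChartAt I p).symm) (contMDiffAt_extChartAt_symm p hz)
      contDiffAt_snd.contMDiffAt
  exact ContMDiffAt.comp z A.contMDiff_act.contMDiffAt h1

theorem isOpen_flowDomain : IsOpen (A.flowDomain p) := by
  have h : ContinuousOn (fun z : ℝ × E ↦ A.act (Circle.exp z.1) ((extChartAt I p).symm z.2))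
      (Prod.snd ⁻¹' (extChartAt I p).target) := fun z hz ↦
    (A.contMDiffAt_act_extChartAt_symm p hz).continuousAt.continuousWithinAt
  exact h.isOpen_inter_preimage ((isOpen_extChartAt_target p).preimage continuous_snd)
    (isOpen_extChartAt_source p)

theorem contDiffAt_flow {z : ℝ × E} (hz : z ∈ A.flowDomain p) : ContDiffAt ℝ ∞ (A.flow p) z := by
  refine contMDiffAt_iff_contDiffAt.1 (ContMDiffAt.comp z (g := extChartAt I p) ?_
    (A.contMDiffAt_act_extChartAt_symm p hz.1))
  exact contMDiffAt_extChartAt' (by simpa using hz.2)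

theorem hasFDerivAt_flow : HasFDerivAt (A.flow p) (fderiv ℝ (A.flow p) (0, extChartAt I p p))
    (0, extChartAt I p p) :=
  ((A.contDiffAt_flow p (A.mem_flowDomain p)).differentiableAt (by simp)).hasFDerivAt

/-- At time $0$ the flow is the identity, so the derivative in the space direction is the identity.
-/
theorem fderiv_flow (v : ℝ × E) :
    fderiv ℝ (A.flow p) (0, extChartAt I p p) v = v.1 • A.gen p + v.2 := by
  have h1 : HasFDerivAt (fun y : E ↦ A.flow p (0, y)) _ (extChartAt I p p) :=
    (A.hasFDerivAt_flow p).comp (f := fun y : E ↦ ((0 : ℝ), y)) (extChartAt I p p)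
      ((hasFDerivAt_const (0 : ℝ) (extChartAt I p p)).prodMk (hasFDerivAt_id _))
  have h2 : HasFDerivAt (fun y : E ↦ A.flow p (0, y)) (ContinuousLinearMap.id ℝ E)
      (extChartAt I p p) := by
    refine (hasFDerivAt_id _).congr_of_eventuallyEq ?_
    filter_upwards [(isOpen_extChartAt_target p).mem_nhds (mem_extChartAt_target (I := I) p)]
      with y hy using A.flow_zero p hy
  have h3 := congrArg (fun l : E →L[ℝ] E ↦ l v.2) (h1.unique h2)
  simp only [ContinuousLinearMap.comp_apply, ContinuousLinearMap.prod_apply,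
    _root_.zero_apply, ContinuousLinearMap.id_apply] at h3
  have h4 : v = v.1 • ((1 : ℝ), (0 : E)) + (0, v.2) := by simp
  conv_lhs => rw [h4, map_add, map_smul, h3]
  rfl

theorem hasFDerivAt_flow_curve : HasDerivAt (fun t : ℝ ↦ A.flow p (t, extChartAt I p p))
    (A.gen p) 0 := by
  have := (A.hasFDerivAt_flow p).comp_hasDerivAt (f := fun t : ℝ ↦ (t, extChartAt I p p)) (0 : ℝ)
    ((hasDerivAt_id (0 : ℝ)).prodMk (hasDerivAt_const (0 : ℝ) (extChartAt I p p)))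
  exact this

/-- If the velocity vanished at time $0$, the group law would make it vanish for all small times.
Then `p` would be fixed by $e^{it}$ for some small $t>0$, contradicting the trivial stabilizer. -/
theorem gen_ne_zero (hp : ∀ c, A.act c p = p → c = 1) : A.gen p ≠ 0 := by
  intro h0
  set y₀ := extChartAt I p p with hy₀
  have h1 : ∀ᶠ t in 𝓝 (0 : ℝ), (t, y₀) ∈ A.flowDomain p :=
    (by fun_prop : Continuous fun t : ℝ ↦ (t, y₀)).continuousAt.eventually_mem
      ((A.isOpen_flowDomain p).mem_nhds (A.mem_flowDomain p))
  obtain ⟨ε, hε, hball⟩ := Metric.eventually_nhds_iff_ball.1 h1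
  have hd : ∀ t ∈ Metric.ball (0 : ℝ) ε, HasDerivAt (fun t : ℝ ↦ A.flow p (t, y₀)) 0 t := by
    intro t ht
    -- Group law: the curve at time $t+s$ is the time-$t$ flow applied to the curve at time $s$, so
    -- its velocity at $t$ is the image of the velocity at $0$.
    have h2 : (fun s : ℝ ↦ A.flow p (t + s, y₀)) =ᶠ[𝓝 0]
        (fun s ↦ A.flow p (t, A.flow p (s, y₀))) := by
      filter_upwards [h1] with s hs
      simp only [flow] at hs ⊢
      rw [(extChartAt I p).left_inv hs.2, ← A.act_mul, ← Circle.exp_add]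
    have h3 : HasFDerivAt (fun y : E ↦ A.flow p (t, y))
        (fderiv ℝ (fun y : E ↦ A.flow p (t, y)) (A.flow p (0, y₀))) (A.flow p (0, y₀)) := by
      rw [A.flow_zero p (mem_extChartAt_target p)]
      refine DifferentiableAt.hasFDerivAt ?_
      refine DifferentiableAt.comp y₀ (g := A.flow p) (f := fun y : E ↦ (t, y))
        ((A.contDiffAt_flow p (hball t ht)).differentiableAt (by simp)) (by fun_prop)
    have h4 := h3.comp_hasDerivAt (0 : ℝ) (A.hasFDerivAt_flow_curve p)
    rw [h0, map_zero] at h4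
    have h5 := h4.congr_of_eventuallyEq h2
    have h6 := HasDerivAt.scomp (x := t) (h := fun s ↦ s - t) (h' := 1)
      (g₁ := fun s : ℝ ↦ A.flow p (t + s, y₀)) (g₁' := 0) (by simpa using h5)
      ((hasDerivAt_id t).sub_const t)
    simpa [Function.comp_def] using h6
  -- The bound $1<\pi$ ensures that `Complex.arg` recovers `t` from $e^{it}$, so that $e^{it}=1$
  -- forces $t=0$.
  have hε' : min (ε / 2) 1 ∈ Metric.ball (0 : ℝ) ε := by
    rw [Metric.mem_ball, dist_zero_right, Real.norm_eq_abs, abs_of_pos (by positivity)]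
    exact (min_le_left _ _).trans_lt (by linarith)
  set t := min (ε / 2) 1 with ht
  have htpos : 0 < t := by positivity
  have ht1 : t ≤ 1 := min_le_right _ _
  have hc : A.flow p (t, y₀) = A.flow p (0, y₀) := by
    refine (convex_ball (0 : ℝ) ε).is_const_of_fderivWithin_eq_zero (𝕜 := ℝ)
      (f := fun t : ℝ ↦ A.flow p (t, y₀)) ?_ ?_ hε' (Metric.mem_ball_self hε)
    · exact fun s hs ↦ (hd s hs).differentiableAt.differentiableWithinAt
    · intro s hs
      rw [fderivWithin_of_isOpen Metric.isOpen_ball hs]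
      have := (hd s hs).hasFDerivAt.fderiv
      rw [this]
      ext; simp
  rw [A.flow_zero p (mem_extChartAt_target p)] at hc
  have h7 := A.extChartAt_symm_flow p (hball _ hε')
  rw [hc] at h7
  simp only [hy₀, extChartAt_to_inv] at h7
  have h8 := hp _ h7.symm
  have h9 : Complex.arg ((Circle.exp t : Circle) : ℂ) = t :=
    Circle.arg_exp (by linarith [Real.pi_pos]) (by linarith [Real.pi_gt_three])
  rw [h8] at h9
  simp at h9
  linarith

theorem contDiffAt_Ψ_chart {y : E} (hy : y ∈ (extChartAt I p).target) :
    ContDiffAt ℝ ∞ (A.Ψ ∘ (extChartAt I p).symm) y :=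
  contMDiffAt_iff_contDiffAt.1
    (A.contMDiff_Ψ.contMDiffAt.comp y (contMDiffAt_extChartAt_symm p hy))

/-- `Ψ` is constant along orbits. -/
theorem fderiv_Ψ_gen :
    fderiv ℝ (A.Ψ ∘ (extChartAt I p).symm) (extChartAt I p p) (A.gen p) = 0 := by
  set y₀ := extChartAt I p p with hy₀
  have h1 : HasFDerivAt (A.Ψ ∘ (extChartAt I p).symm)
      (fderiv ℝ (A.Ψ ∘ (extChartAt I p).symm) y₀) (A.flow p (0, y₀)) := by
    rw [A.flow_zero p (mem_extChartAt_target p)]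
    exact ((A.contDiffAt_Ψ_chart p (mem_extChartAt_target p)).differentiableAt
      (by simp)).hasFDerivAt
  have h2 := h1.comp_hasDerivAt (0 : ℝ) (A.hasFDerivAt_flow_curve p)
  refine h2.unique ((hasDerivAt_const (0 : ℝ) (A.Ψ p)).congr_of_eventuallyEq ?_)
  have h1 : ∀ᶠ t in 𝓝 (0 : ℝ), (t, y₀) ∈ A.flowDomain p :=
    (by fun_prop : Continuous fun t : ℝ ↦ (t, y₀)).continuousAt.eventually_mem
      ((A.isOpen_flowDomain p).mem_nhds (A.mem_flowDomain p))
  filter_upwards [h1] with t ht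
  simp only [Function.comp]
  rw [A.extChartAt_symm_flow p ht, A.Ψ_act]
  simp [hy₀]

theorem localForm_flow : localForm I
      (fun z : ℝ × E ↦ A.act (Circle.exp z.1) ((extChartAt I p).symm z.2)) A.form
      =ᶠ[𝓝 (0, extChartAt I p p)] fun z ↦
        (localForm I (extChartAt I p).symm A.form (A.flow p z)).comp (fderiv ℝ (A.flow p) z) := by
  have h1 : ∀ᶠ z in 𝓝 (0, extChartAt I p p), z ∈ A.flowDomain p :=
    (A.isOpen_flowDomain p).mem_nhds (A.mem_flowDomain p)
  filter_upwards [h1.eventually_nhds] with z hz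
  have h2 := hz.self_of_nhds
  have h3 : (fun z : ℝ × E ↦ A.act (Circle.exp z.1) ((extChartAt I p).symm z.2)) =ᶠ[𝓝 z]
      (extChartAt I p).symm ∘ A.flow p := by
    filter_upwards [hz] with z' hz' using (A.extChartAt_symm_flow p hz').symm
  rw [localForm_congr _ h3, localForm_comp A.form ?_
    ((A.contDiffAt_flow p h2).differentiableAt (by simp))]
  exact (contMDiffAt_extChartAt_symm p ((extChartAt I p).map_source h2.2)).mdifferentiableAt
    (by simp)

theorem localForm_gen :
    localForm I (extChartAt I p).symm A.form (extChartAt I p p) (A.gen p) = A.Ψ p := by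
  have h1 := congrArg (fun l : ℝ × E →L[ℝ] ℝ ↦ l (1, 0)) (A.localForm_flow p).self_of_nhds
  simp only [ContinuousLinearMap.comp_apply] at h1
  rw [A.flow_zero p (mem_extChartAt_target p), A.localForm_exp
    ((contMDiffAt_extChartAt_symm p (mem_extChartAt_target p)).mdifferentiableAt (by simp))] at h1
  simp only [extChartAt_to_inv, one_mul, map_zero, add_zero] at h1
  exact h1.symm

/-- The identity $dA(X,\cdot)=-d\Psi$ read in the chart: the derivative of the flow sends
$\partial_t$ to the generator and is the identity on `E`. -/
theorem extD_gen (v : E) : extD (localForm I (extChartAt I p).symm A.form) (extChartAt I p p)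
    ![A.gen p, v] = -fderiv ℝ (A.Ψ ∘ (extChartAt I p).symm) (extChartAt I p p) v := by
  have hs := contMDiffAt_extChartAt_symm (I := I) p (mem_extChartAt_target p)
  have h1 := A.extD_localForm_exp hs (0, v)
  rw [extD_congr (A.localForm_flow p), extD_pullback ?_
    (A.contDiffAt_flow p (A.mem_flowDomain p))] at h1
  · rw [A.flow_zero p (mem_extChartAt_target p)] at h1
    rw [← h1]
    change _ = extD _ _ _
    congr 1
    funext i
    fin_cases i
    · rfl
    · simpa using (A.fderiv_flow p (0, v)).symm
  · rw [A.flow_zero p (mem_extChartAt_target p)]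
    exact (contDiffAt_localForm A.smooth_form hs).differentiableAt (by simp)

/-- Otherwise the nonzero generator would satisfy $A(X)=\Psi(p)=0$ and $dA(X,\cdot)=-d\Psi=0$, which
kills the contact volume form. -/
theorem fderiv_Ψ_ne_zero {n : ℕ} (hE : Module.finrank ℝ E = 2 * n + 1)
    (hw : ∀ q, ∃ v : Fin (2 * n + 1) → TangentSpace I q,
      wedgePow n (A.form q) (extDerivForm I A.form q) v ≠ 0)
    (h0 : A.Ψ p = 0) (hp : ∀ c, A.act c p = p → c = 1) :
    fderiv ℝ (A.Ψ ∘ (extChartAt I p).symm) (extChartAt I p p) ≠ 0 := by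
  intro h
  obtain ⟨u, hu⟩ := exists_localForm_extChartAt_wedgePow_ne_zero A.smooth_form hw p
    (mem_extChartAt_target p)
  refine hu (wedgePow_eq_zero_of_kernel hE (A.gen_ne_zero p hp) ?_ ?_ u)
  · rw [A.localForm_gen, h0]
  · intro y
    rw [A.extD_gen, h]
    simp

end HamAction

/-- A slice from a transversal that meets each orbit at most once, and local equivariant
coordinates. -/
theorem Slice.exists_of_local {A : HamAction I N} {F : Type*} [NormedAddCommGroup F]
    [NormedSpace ℝ F] {B : Set (ℝ × F)} (hB : IsOpen B) (κ : ℝ × F → N)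
    (hκ : ContMDiffOn 𝓘(ℝ, ℝ × F) I ∞ κ B) (hΨ : ∀ b ∈ B, A.Ψ (κ b) = b.1)
    (hinj : ∀ c, ∀ b ∈ B, ∀ b' ∈ B, A.act c (κ b) = κ b' → c = 1 ∧ b = b')
    (hloc : ∀ b ∈ B, ∃ σ : N → (ℝ × F) × ℝ, ContMDiffAt I 𝓘(ℝ, (ℝ × F) × ℝ) ∞ σ (κ b) ∧
      ∀ᶠ m in 𝓝 (κ b), (σ m).1 ∈ B ∧ A.act (Circle.exp (σ m).2) (κ (σ m).1) = m)
    {b₀ : ℝ × F} (hb₀ : b₀ ∈ B) : ∃ T : Slice A F, κ b₀ ∈ T.source := by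
  classical
  set O : Set N := {m | ∃ x : Circle × (ℝ × F), x.2 ∈ B ∧ A.act x.1 (κ x.2) = m} with hO
  set crd : N → Circle × (ℝ × F) := fun m ↦ if h : m ∈ O then h.choose else (1, 0) with hcrd
  have hcrd1 : ∀ m ∈ O, (crd m).2 ∈ B ∧ A.act (crd m).1 (κ (crd m).2) = m := by
    intro m hm
    simp only [hcrd, dif_pos hm]
    exact hm.choose_spec
  have huniq : ∀ c d, ∀ b ∈ B, ∀ b' ∈ B, A.act c (κ b) = A.act d (κ b') → c = d ∧ b = b' := by
    intro c d b hb b' hb' h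
    have h1 : A.act (d⁻¹ * c) (κ b) = κ b' := by rw [A.act_mul, h, A.act_inv_act]
    obtain ⟨h2, h3⟩ := hinj _ b hb b' hb' h1
    exact ⟨(inv_mul_eq_one.1 h2).symm, h3⟩
  have hcrd2 : ∀ c, ∀ b ∈ B, crd (A.act c (κ b)) = (c, b) := by
    intro c b hb
    obtain ⟨h1, h2⟩ := hcrd1 (A.act c (κ b)) ⟨(c, b), hb, rfl⟩
    obtain ⟨h3, h4⟩ := huniq _ _ _ h1 _ hb h2
    exact Prod.ext h3 h4
  have hmem : ∀ c, ∀ b ∈ B, A.act c (κ b) ∈ O := fun c b hb ↦ ⟨(c, b), hb, rfl⟩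
  have hcrd3 : ∀ b ∈ B, crd (κ b) = (1, b) := fun b hb ↦ by
    have := hcrd2 1 b hb
    rwa [A.act_one] at this
  have hact : ∀ c, ∀ m ∈ O, A.act c m ∈ O ∧ crd (A.act c m) = (c * (crd m).1, (crd m).2) := by
    intro c m hm
    obtain ⟨h1, h2⟩ := hcrd1 m hm
    have h3 : A.act c m = A.act (c * (crd m).1) (κ (crd m).2) := by rw [A.act_mul, h2]
    rw [h3]
    exact ⟨hmem _ _ h1, hcrd2 _ _ h1⟩
  -- local coordinates near an arbitrary point of `O`
  have hloc' : ∀ m₀ ∈ O, ∃ σ : N → (ℝ × F) × ℝ, ContMDiffAt I 𝓘(ℝ, (ℝ × F) × ℝ) ∞ σ m₀ ∧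
      ∃ c, ∀ᶠ m in 𝓝 m₀, m ∈ O ∧ crd m = (c * Circle.exp (σ m).2, (σ m).1) := by
    rintro _ ⟨⟨c, b⟩, hb, rfl⟩
    obtain ⟨σ, hσ, hσ'⟩ := hloc b hb
    have h1 : A.act c⁻¹ (A.act c (κ b)) = κ b := A.act_inv_act _ _
    -- Coordinates near a translate of the transversal are those near the transversal, moved by
    -- `c⁻¹`.
    refine ⟨σ ∘ A.act c⁻¹, ContMDiffAt.comp _ (by rwa [h1])
      (A.contMDiff_act_const c⁻¹).contMDiffAt, c, ?_⟩
    have h2 := (A.contMDiff_act_const c⁻¹).continuous.continuousAt (x := A.act c (κ b))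
    rw [ContinuousAt, h1] at h2
    filter_upwards [h2.eventually hσ'] with m hm
    have h3 : m = A.act (c * Circle.exp (σ (A.act c⁻¹ m)).2) (κ (σ (A.act c⁻¹ m)).1) := by
      rw [A.act_mul, hm.2, A.act_act_inv]
    refine ⟨h3 ▸ hmem _ _ hm.1, ?_⟩
    conv_lhs => rw [h3]
    exact hcrd2 _ _ hm.1
  refine ⟨⟨O, B, κ, fun m ↦ (crd m).2.2, fun m ↦ (crd m).1, ?_, hB, hκ, ?_, ?_, ?_, hΨ, ?_, ?_,
    fun c m hm ↦ (hact c m hm).1, ?_, ?_, ?_, ?_⟩, ?_⟩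
  · rw [isOpen_iff_mem_nhds]
    intro m hm
    obtain ⟨σ, -, c, h⟩ := hloc' m hm
    exact h.mono fun _ h ↦ h.1
  · intro m hm
    obtain ⟨σ, hσ, c, h⟩ := hloc' m hm
    refine ContMDiffAt.contMDiffWithinAt (ContMDiffAt.congr_of_eventuallyEq
      (f := fun m ↦ (σ m).1.2) ?_ ?_)
    · exact ContMDiffAt.comp m (g := fun x : (ℝ × F) × ℝ ↦ x.1.2)
        (contDiff_snd.comp contDiff_fst).contMDiff.contMDiffAt hσ
    · filter_upwards [h] with m' hm'
      rw [hm'.2]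
  · intro m hm
    obtain ⟨σ, hσ, c, h⟩ := hloc' m hm
    refine ContMDiffAt.contMDiffWithinAt (ContMDiffAt.congr_of_eventuallyEq
      (f := fun m ↦ ((c * Circle.exp (σ m).2 : Circle) : ℂ)) ?_ ?_)
    · refine ContMDiffAt.comp m (g := fun x : (ℝ × F) × ℝ ↦ ((c * Circle.exp x.2 : Circle) : ℂ))
        (ContDiff.contMDiff ?_).contMDiffAt hσ
      simp only [Circle.coe_mul, Circle.coe_exp]
      have h1 : ContDiff ℝ ∞ (fun p : (ℝ × F) × ℝ ↦ (p.2 : ℂ)) :=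
        Complex.ofRealCLM.contDiff.comp contDiff_snd
      exact contDiff_const.mul ((h1.mul contDiff_const).cexp)
    · filter_upwards [h] with m' hm'
      rw [hm'.2]
  · intro b hb
    have := hmem 1 b hb
    rwa [A.act_one] at this
  · intro b hb
    simp only [hcrd3 b hb]
  · intro b hb
    simp only [hcrd3 b hb]
  · intro c m hm
    simp only [(hact c m hm).2]
  · intro c m hm
    simp only [(hact c m hm).2]
  · intro m hm
    obtain ⟨h1, h2⟩ := hcrd1 m hm
    have h3 : A.Ψ m = (crd m).2.1 := by
      rw [← hΨ _ h1]
      conv_lhs => rw [← h2]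
      exact A.Ψ_act _ _
    simp only [h3]
    exact h1
  · intro m hm
    obtain ⟨h1, h2⟩ := hcrd1 m hm
    have h3 : A.Ψ m = (crd m).2.1 := by
      rw [← hΨ _ h1]
      conv_lhs => rw [← h2]
      exact A.Ψ_act _ _
    simp only [h3]
    exact h2
  · have := hmem 1 b₀ hb₀
    rwa [A.act_one] at this

end ContactCut

end

/-! ### Existence of slices -/

noncomputable section

namespace ContactCut

open Filter Topology

/-- Linear coordinates adapted to a nonzero covector `D` and a nonzero vector `x` with `D x = 0`. -/
theorem exists_adapted_equiv {E F : Type*} [NormedAddCommGroup E] [NormedSpace ℝ E]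
    [FiniteDimensional ℝ E] [NormedAddCommGroup F] [NormedSpace ℝ F] [FiniteDimensional ℝ F]
    (hEF : Module.finrank ℝ E = Module.finrank ℝ F + 2) {D : E →L[ℝ] ℝ} (hD : D ≠ 0) {x : E}
    (hx : x ≠ 0) (hDx : D x = 0) :
    ∃ B : ((ℝ × F) × ℝ) ≃L[ℝ] E, (∀ v, D (B v) = v.1.1) ∧ B (0, 1) = x := by
  obtain ⟨θ, hθ⟩ := SeparatingDual.exists_eq_one (R := ℝ) hx
  obtain ⟨y₀, hy₀⟩ : ∃ y, D y = 1 := by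
    obtain ⟨y, hy⟩ : ∃ y, D y ≠ 0 := by
      by_contra! h
      exact hD (ContinuousLinearMap.ext h)
    exact ⟨(D y)⁻¹ • y, by simp [hy]⟩
  -- Corrected so that `x` and `y` are dual to `θ` and `D`; the common kernel of the two covectors
  -- then plays the role of `F`.
  set y := y₀ - θ y₀ • x with hy
  have hDy : D y = 1 := by simp [hy, hDx, hy₀]
  have hθy : θ y = 0 := by simp [hy, hθ]
  set Φ : E →ₗ[ℝ] ℝ × ℝ := (D : E →ₗ[ℝ] ℝ).prod (θ : E →ₗ[ℝ] ℝ) with hΦ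
  have hsurj : Function.Surjective Φ := fun a ↦ ⟨a.1 • y + a.2 • x, by
    ext <;> simp [hΦ, hDy, hθy, hDx, hθ]⟩
  have hker : Module.finrank ℝ F = Module.finrank ℝ (LinearMap.ker Φ) := by
    have h1 := Φ.finrank_range_add_finrank_ker
    rw [LinearMap.range_eq_top.2 hsurj, finrank_top] at h1
    simp at h1
    omega
  let ι : F ≃ₗ[ℝ] LinearMap.ker Φ := LinearEquiv.ofFinrankEq _ _ hker
  have hι : ∀ w, D (ι w : E) = 0 ∧ θ (ι w : E) = 0 := fun w ↦ by
    have := (ι w).2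
    rw [LinearMap.mem_ker] at this
    exact ⟨congrArg Prod.fst this, congrArg Prod.snd this⟩
  let B : ((ℝ × F) × ℝ) →ₗ[ℝ] E :=
    ((LinearMap.toSpanSingleton ℝ E y).coprod ((LinearMap.ker Φ).subtype ∘ₗ ι.toLinearMap)).coprod
      (LinearMap.toSpanSingleton ℝ E x)
  have hB : ∀ v, B v = v.1.1 • y + (ι v.1.2 : E) + v.2 • x := fun v ↦ by simp [B]
  have hBD : ∀ v, D (B v) = v.1.1 := fun v ↦ by simp [hB, hDy, hDx, (hι _).1]
  have hBθ : ∀ v, θ (B v) = v.2 := fun v ↦ by simp [hB, hθy, hθ, (hι _).2]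
  have hinj : Function.Injective B := by
    rw [injective_iff_map_eq_zero]
    intro v hv
    have h1 : v.1.1 = 0 := by rw [← hBD, hv, map_zero]
    have h2 : v.2 = 0 := by rw [← hBθ, hv, map_zero]
    have h3 : (ι v.1.2 : E) = 0 := by
      have := hB v
      rw [hv, h1, h2] at this
      simpa using this.symm
    have h4 : v.1.2 = 0 := by simpa using h3
    exact Prod.ext (Prod.ext h1 h4) h2
  let B' : ((ℝ × F) × ℝ) ≃ₗ[ℝ] E := B.linearEquivOfInjective hinj (by simp [hEF]; omega)
  exact ⟨B'.toContinuousLinearEquiv, hBD, (hB (0, 1)).trans (by simp)⟩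

variable {E : Type*} [NormedAddCommGroup E] [NormedSpace ℝ E] {H : Type*} [TopologicalSpace H]
  {I : ModelWithCorners ℝ E H} {N : Type*} [TopologicalSpace N] [ChartedSpace H N]
  [IsManifold I ∞ N] [I.Boundaryless]

/-- Slices exist at points where the action is free and the moment map is regular. -/
theorem HamAction.exists_slice [T2Space N] [FiniteDimensional ℝ E] {F : Type*}
    [NormedAddCommGroup F] [NormedSpace ℝ F] [FiniteDimensional ℝ F] (A : HamAction I N)
    (hEF : Module.finrank ℝ E = Module.finrank ℝ F + 2) (p : N) (h0 : A.Ψ p = 0)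
    (hp : ∀ c, A.act c p = p → c = 1)
    (hD : fderiv ℝ (A.Ψ ∘ (extChartAt I p).symm) (extChartAt I p p) ≠ 0) :
    ∃ T : Slice A F, p ∈ T.source := by
  have : CompleteSpace E := FiniteDimensional.complete ℝ E
  have : CompleteSpace F := FiniteDimensional.complete ℝ F
  set ψ := (extChartAt I p).symm with hψ
  set y₀ := extChartAt I p p with hy₀
  set D := fderiv ℝ (A.Ψ ∘ ψ) y₀ with hD'
  have hψ₀ : ψ y₀ = p := extChartAt_to_inv p
  have hy₀t : y₀ ∈ (extChartAt I p).target := mem_extChartAt_target p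
  obtain ⟨B, hBD, hBx⟩ := exists_adapted_equiv hEF hD (A.gen_ne_zero p hp) (A.fderiv_Ψ_gen p)
  -- Replacing the first linear coordinate by `Ψ` does not change the derivative at `y₀`, because
  -- $D(Bv)$ is the first coordinate of `v`.
  have hPd' : HasFDerivAt (fun y ↦ ((A.Ψ (ψ y), (B.symm (y - y₀)).1.2), (B.symm (y - y₀)).2))
      (B.symm : E →L[ℝ] (ℝ × F) × ℝ) y₀ := by
    have h1 : HasFDerivAt (fun y ↦ B.symm (y - y₀)) (B.symm : E →L[ℝ] (ℝ × F) × ℝ) y₀ :=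
      B.symm.hasFDerivAt.comp y₀ ((hasFDerivAt_id y₀).sub_const y₀)
    have h2 : HasFDerivAt (A.Ψ ∘ ψ) D y₀ :=
      ((A.contDiffAt_Ψ_chart p hy₀t).differentiableAt (by simp)).hasFDerivAt
    have h3 := (h2.prodMk h1.fst.snd).prodMk h1.snd
    have h4 : (D.prod (((ContinuousLinearMap.snd ℝ ℝ F).comp
        ((ContinuousLinearMap.fst ℝ (ℝ × F) ℝ).comp (B.symm : E →L[ℝ] (ℝ × F) × ℝ))))).prod
        ((ContinuousLinearMap.snd ℝ (ℝ × F) ℝ).comp (B.symm : E →L[ℝ] (ℝ × F) × ℝ)) = B.symm := by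
      refine ContinuousLinearMap.ext fun v ↦ Prod.ext (Prod.ext ?_ rfl) rfl
      have := hBD (B.symm v)
      rw [B.apply_symm_apply] at this
      exact this
    rw [h4] at h3
    exact h3
  -- coordinates of the chart domain whose first component is the moment map
  obtain ⟨P, hP₀, hPs, hPf, hPsymm⟩ := exists_openPartialHomeomorph_of_hasFDerivAt
    (f := fun y ↦ ((A.Ψ (ψ y), (B.symm (y - y₀)).1.2), (B.symm (y - y₀)).2))
    (isOpen_extChartAt_target (I := I) p)
    (fun y hy ↦ by
      have h1 : ContDiff ℝ ∞ (fun y ↦ B.symm (y - y₀)) :=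
        B.symm.contDiff.comp (contDiff_id.sub contDiff_const)
      exact ((A.contDiffAt_Ψ_chart p hy).prodMk
        (contDiff_snd.comp (contDiff_fst.comp h1)).contDiffAt).prodMk
        (contDiff_snd.comp h1).contDiffAt) hy₀t B.symm
    hPd'
  have hP0 : P y₀ = 0 := by
    rw [hPf]
    simp [hψ₀, h0]
  have hPt : (0 : (ℝ × F) × ℝ) ∈ P.target := hP0 ▸ P.map_source hP₀
  have hPs0 : P.symm 0 = y₀ := by rw [← hP0, P.left_inv hP₀]
  have hPd : HasFDerivAt P.symm (B : (ℝ × F) × ℝ →L[ℝ] E) 0 := by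
    refine P.hasFDerivAt_symm (f' := B.symm) hPt ?_
    rw [hPs0, show (P : E → (ℝ × F) × ℝ) = _ from funext hPf]
    exact hPd'
  -- The transversal to the orbit: the last coordinate, in the direction of the generator, is set to
  -- $0$, and the first is the value of `Ψ`.
  set κ : ℝ × F → N := fun b ↦ ψ (P.symm (b, 0)) with hκ
  set g : (ℝ × F) × ℝ → ℝ × E := fun x ↦ (x.2, P.symm (x.1, 0)) with hg
  have hgs : ∀ x : (ℝ × F) × ℝ, (x.1, 0) ∈ P.target → ContDiffAt ℝ ∞ g x := by
    intro x hx
    refine contDiffAt_snd.prodMk ?_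
    exact (hPsymm _ hx).comp x (f := fun x : (ℝ × F) × ℝ ↦ (x.1, (0 : ℝ)))
      (contDiffAt_fst.prodMk contDiffAt_const)
  have hg0 : g 0 = (0, y₀) := Prod.ext rfl hPs0
  set V : Set ((ℝ × F) × ℝ) := {x | (x.1, (0 : ℝ)) ∈ P.target} ∩ g ⁻¹' A.flowDomain p with hV
  have hVo : IsOpen V := by
    refine ContinuousOn.isOpen_inter_preimage (fun x hx ↦
      (hgs x hx).continuousAt.continuousWithinAt) ?_ (A.isOpen_flowDomain p)
    exact P.open_target.preimage (f := fun x : (ℝ × F) × ℝ ↦ (x.1, (0 : ℝ))) (by fun_prop)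
  have h0V : (0 : (ℝ × F) × ℝ) ∈ V := ⟨hPt, by
    change g 0 ∈ A.flowDomain p
    rw [hg0]
    exact A.mem_flowDomain p⟩
  -- The flow-out $(b,t)\mapsto e^{it}\kappa(b)$ in the chart. Its derivative at $0$ is `B`, since
  -- $\partial_t$ goes to the generator, which is $B(0,1)$.
  obtain ⟨S, hS₀, hSs, hSf, hSsymm⟩ := exists_openPartialHomeomorph_of_hasFDerivAt
    (f := A.flow p ∘ g) hVo (fun x hx ↦ (A.contDiffAt_flow p hx.2).comp x (hgs x hx.1)) h0V B
    (by
      have h1 : HasFDerivAt g _ 0 := hasFDerivAt_snd.prodMk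
        (HasFDerivAt.comp (0 : (ℝ × F) × ℝ) (f := fun x : (ℝ × F) × ℝ ↦ (x.1, (0 : ℝ))) hPd
          (hasFDerivAt_fst.prodMk (hasFDerivAt_const (0 : ℝ) _)))
      have h2 : HasFDerivAt (A.flow p) (fderiv ℝ (A.flow p) (0, y₀)) (g 0) := by
        rw [hg0]
        exact A.hasFDerivAt_flow p
      refine (h2.comp (0 : (ℝ × F) × ℝ) h1).congr_fderiv (ContinuousLinearMap.ext fun v ↦ ?_)
      rw [ContinuousLinearMap.comp_apply, A.fderiv_flow]
      change v.2 • A.gen p + B (v.1, 0) = B v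
      rw [← hBx, ← map_smul, ← map_add]
      simp)
  -- the flow-out of the transversal, in `N`
  have hact : ∀ x ∈ S.source, ψ (S x) = A.act (Circle.exp x.2) (κ x.1) := by
    intro x hx
    rw [hSf]
    exact A.extChartAt_symm_flow p (hSs hx).2
  set B₁ : Set (ℝ × F) := {b | (b, (0 : ℝ)) ∈ S.source} with hB₁
  have hB₁o : IsOpen B₁ := S.open_source.preimage (Continuous.prodMk_left (0 : ℝ))
  have hB₁0 : (0 : ℝ × F) ∈ B₁ := hS₀
  have hκ0 : κ 0 = p := by
    change ψ (P.symm 0) = p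
    rw [hPs0, hψ₀]
  have hκs : ∀ b ∈ B₁, ContMDiffAt 𝓘(ℝ, ℝ × F) I ∞ κ b := by
    intro b hb
    have h1 : (b, (0 : ℝ)) ∈ P.target := (hSs hb).1
    have h2 : P.symm (b, 0) ∈ (extChartAt I p).target := hPs (P.map_target h1)
    refine ContMDiffAt.comp b (g := ψ) (contMDiffAt_extChartAt_symm p h2)
      (ContDiffAt.contMDiffAt ?_)
    exact (hPsymm _ h1).comp b (f := fun b : ℝ × F ↦ (b, (0 : ℝ)))
      (contDiffAt_id.prodMk contDiffAt_const)
  have hκΨ : ∀ b ∈ B₁, A.Ψ (κ b) = b.1 := by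
    intro b hb
    have h1 := P.right_inv (hSs hb).1
    rw [hPf] at h1
    exact congrArg (fun x : (ℝ × F) × ℝ ↦ x.1.1) h1
  have hκc : ContinuousAt κ 0 := (hκs 0 hB₁0).continuousAt
  -- Points of a small transversal lie on different orbits and have trivial stabilizers. Compactness
  -- of the circle reduces this to a neighbourhood of each `c`.
  have hinj : ∀ᶠ x : (ℝ × F) × (ℝ × F) in 𝓝 (0, 0), ∀ c ∈ (univ : Set Circle),
      A.act c (κ x.1) = κ x.2 → c = 1 ∧ x.1 = x.2 := by
    refine isCompact_univ.eventually_forall_of_forall_eventually fun c _ ↦ ?_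
    have hc1 : ContinuousAt (fun z : ((ℝ × F) × (ℝ × F)) × Circle ↦ κ z.1.1) ((0, 0), c) :=
      ContinuousAt.comp (g := κ) (f := fun z : ((ℝ × F) × (ℝ × F)) × Circle ↦ z.1.1) hκc
        (by fun_prop)
    have hc2 : ContinuousAt (fun z : ((ℝ × F) × (ℝ × F)) × Circle ↦ κ z.1.2) ((0, 0), c) :=
      ContinuousAt.comp (g := κ) (f := fun z : ((ℝ × F) × (ℝ × F)) × Circle ↦ z.1.2) hκc
        (by fun_prop)
    -- Near $c=1$ the flow-out `S` is injective.
    by_cases hc : c = 1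
    · subst hc
      have h1 : ContinuousAt (fun z : ((ℝ × F) × (ℝ × F)) × Circle ↦
          (z.1.1, Complex.arg (z.2 : ℂ))) ((0, 0), 1) := by
        refine ContinuousAt.prodMk (by fun_prop) ?_
        refine ContinuousAt.comp' (g := Complex.arg) ?_ (by fun_prop)
        simpa using Complex.continuousAt_arg Complex.one_mem_slitPlane
      have h2 : ContinuousAt (fun z : ((ℝ × F) × (ℝ × F)) × Circle ↦
          (z.1.2, (0 : ℝ))) ((0, 0), 1) := by fun_prop
      have h3 := h1.eventually_mem (S.open_source.mem_nhds (by
        rw [Circle.coe_one, Complex.arg_one]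
        exact hS₀))
      have h4 := h2.eventually_mem (S.open_source.mem_nhds hS₀)
      filter_upwards [h3, h4] with z hz1 hz2 heq
      have h5 := hact _ hz1
      have h6 := hact _ hz2
      simp only [Circle.exp_arg, Circle.exp_zero, A.act_one] at h5 h6
      rw [heq, ← h6] at h5
      have hm : ∀ x ∈ S.source, S x ∈ (extChartAt I p).target := fun x hx ↦ by
        rw [hSf]
        exact (extChartAt I p).map_source (hSs hx).2.2
      have h7 := (extChartAt I p).symm.injOn (hm _ hz1) (hm _ hz2) h5
      have h8 := S.injOn hz1 hz2 h7
      simp only [Prod.mk.injEq] at h8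
      refine ⟨?_, h8.1⟩
      rw [← Circle.exp_arg z.2, h8.2, Circle.exp_zero]
    -- For $c\neq 1$ freeness gives $c\cdot p\neq p$, and the inequality persists nearby because the
    -- space is Hausdorff.
    · have h1 : ContinuousAt (fun z : ((ℝ × F) × (ℝ × F)) × Circle ↦ A.act z.2 (κ z.1.1))
          ((0, 0), c) :=
        A.continuous_act.continuousAt.comp
          (f := fun z : ((ℝ × F) × (ℝ × F)) × Circle ↦ (z.2, κ z.1.1))
          (continuousAt_snd.prodMk hc1)
      have h2 : ∀ᶠ z : ((ℝ × F) × (ℝ × F)) × Circle in 𝓝 ((0, 0), c),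
          A.act z.2 (κ z.1.1) ≠ κ z.1.2 := by
        refine (h1.ne_iff_eventually_ne hc2).1 ?_
        simp only [hκ0]
        exact fun h ↦ hc (hp c h)
      filter_upwards [h2] with z hz h using absurd h hz
  rw [nhds_prod_eq] at hinj
  obtain ⟨t, ht, ht'⟩ := eventually_prod_self_iff'.1 hinj
  rw [← hκ0]
  refine Slice.exists_of_local (hB₁o.inter isOpen_interior) κ
    (fun b hb ↦ (hκs b hb.1).contMDiffWithinAt) (fun b hb ↦ hκΨ b hb.1) ?_ ?_
    ⟨hB₁0, mem_interior_iff_mem_nhds.2 ht⟩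
  · intro c b hb b' hb'
    exact ht' b (interior_subset hb.2) b' (interior_subset hb'.2) c trivial
  · rintro b ⟨hb, hbt⟩
    have hb' : (b, (0 : ℝ)) ∈ S.source := hb
    have hSt : ∀ x ∈ S.source, S x ∈ (extChartAt I p).target := fun x hx ↦ by
      rw [hSf]
      exact (extChartAt I p).map_source (hSs hx).2.2
    have h1 : ψ (S (b, 0)) = κ b := by
      rw [hact _ hb']
      simp only [Circle.exp_zero, A.act_one]
    have h2 : extChartAt I p (κ b) = S (b, 0) := by
      rw [← h1]
      exact (extChartAt I p).right_inv (hSt _ hb')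
    have h3 : κ b ∈ (extChartAt I p).source := by
      rw [← h1]
      exact (extChartAt I p).map_target (hSt _ hb')
    -- The inverse of the flow-out provides the local equivariant coordinates.
    have hσ : ContMDiffAt I 𝓘(ℝ, (ℝ × F) × ℝ) ∞ (S.symm ∘ extChartAt I p) (κ b) := by
      refine ContMDiffAt.comp (κ b) (ContDiffAt.contMDiffAt ?_)
        (contMDiffAt_extChartAt' (by simpa using h3))
      rw [h2]
      exact hSsymm _ (S.map_source hb')
    refine ⟨S.symm ∘ extChartAt I p, hσ, ?_⟩
    have h4 : (S.symm ∘ extChartAt I p) (κ b) = (b, 0) := by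
      simp only [Function.comp, h2, S.left_inv hb']
    have h5 := hσ.continuousAt.eventually_mem (s := {x | x.1 ∈ B₁ ∩ interior t}) (by
      rw [h4]
      refine IsOpen.mem_nhds ?_ ⟨hb, hbt⟩
      exact (hB₁o.inter isOpen_interior).preimage continuous_fst)
    have h6 : ContinuousAt (extChartAt I p) (κ b) := continuousAt_extChartAt' h3
    have h7 := h6.eventually_mem (s := S.target) (by
      rw [h2]
      exact S.open_target.mem_nhds (S.map_source hb'))
    filter_upwards [h5, h7, (isOpen_extChartAt_source (I := I) p).mem_nhds h3] with m hm5 hm7 hm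
    refine ⟨hm5, ?_⟩
    have h8 := hact _ (S.map_target hm7)
    rw [S.right_inv hm7] at h8
    rw [Function.comp, ← h8]
    exact (extChartAt I p).left_inv hm

end ContactCut

end

/-! ### The plane form and the action on $M\times\mathbb{C}$ -/

noncomputable section

namespace ContactCut

open Filter Topology

section PlaneForm

/-- `planeForm` as a linear map to the dual space. -/
def planeCLM : ℂ →L[ℝ] ℂ →L[ℝ] ℝ :=
  Complex.reCLM.smulRight Complex.imCLM - Complex.imCLM.smulRight Complex.reCLM

theorem planeCLM_apply (z w : ℂ) : planeCLM z w = z.re * w.im - z.im * w.re := by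
  simp [planeCLM]

theorem planeForm_eq (z : ℂ) : (planeForm z : ℂ →L[ℝ] ℝ) = planeCLM z := by
  refine ContinuousLinearMap.ext fun w : ℂ ↦ ?_
  refine Eq.trans ?_ (planeCLM_apply z w).symm
  change Complex.re ((Complex.I / 2) * (z * (starRingEnd ℂ) w - (starRingEnd ℂ) z * w)) = _
  simp
  ring

theorem planeCLM_circle_mul (c : Circle) (z w : ℂ) : planeCLM (c * z) (c * w) = planeCLM z w := by
  have h : (c : ℂ).re ^ 2 + (c : ℂ).im ^ 2 = 1 := by
    have := Circle.normSq_coe c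
    rw [Complex.normSq_apply] at this
    linarith
  simp only [planeCLM_apply, Complex.mul_re, Complex.mul_im]
  linear_combination (z.re * w.im - z.im * w.re) * h

/-- $-iz$ generates $z\mapsto e^{-it}z$; this is the source of the term $-|z|^2$ in the moment map
of $M\times\mathbb{C}$. -/
theorem planeCLM_I_mul (z : ℂ) : planeCLM z (-(Complex.I * z)) = -‖z‖ ^ 2 := by
  rw [planeCLM_apply, ← Complex.normSq_eq_norm_sq, Complex.normSq_apply]
  simp
  ring

end PlaneForm

variable {E : Type*} [NormedAddCommGroup E] [NormedSpace ℝ E] {H : Type*} [TopologicalSpace H]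
  {I : ModelWithCorners ℝ E H} {M : Type*} [TopologicalSpace M] [ChartedSpace H M]
  {E' : Type*} [NormedAddCommGroup E'] [NormedSpace ℝ E'] {H' : Type*} [TopologicalSpace H']
  {J : ModelWithCorners ℝ E' H'} {P : Type*} [TopologicalSpace P] [ChartedSpace H' P]
  {F : Type*} [NormedAddCommGroup F] [NormedSpace ℝ F]

/-- A map into $M\times\mathbb{C}$ is handled through its components, so invariance, the moment map
and the slice formulas split into an $M$-part and an explicit planar part. -/
theorem pullback_extendedForm_apply (α : OneForm I M) {f : P → M} {g : P → ℂ} {x : P}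
    (hf : MDifferentiableAt J I f x) (hg : MDifferentiableAt J 𝓘(ℝ, ℂ) g x)
    (v : TangentSpace J x) :
    pullback J (I.prod 𝓘(ℝ, ℂ)) (fun x ↦ (f x, g x)) (extendedForm I α) x v =
      pullback J I f α x v + planeCLM (g x) (mfderiv J 𝓘(ℝ, ℂ) g x v) := by
  have hfg : MDifferentiableAt J (I.prod 𝓘(ℝ, ℂ)) (fun x ↦ (f x, g x)) x := hf.prodMk hg
  have h1 := pullback_comp (I := J) (Prod.fst : M × ℂ → M) (fun x ↦ (f x, g x)) α
    (mdifferentiableAt_fst (I := I) (I' := 𝓘(ℝ, ℂ))) hfg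
  have h2 := pullback_comp (I := J) (Prod.snd : M × ℂ → ℂ) (fun x ↦ (f x, g x)) planeForm
    (mdifferentiableAt_snd (I := I) (I' := 𝓘(ℝ, ℂ))) hfg
  have h3 := congrArg (fun l : E' →L[ℝ] ℝ ↦ l v) h1
  have h4 := congrArg (fun l : E' →L[ℝ] ℝ ↦ l v) h2
  have h5 : planeCLM (g x) (mfderiv J 𝓘(ℝ, ℂ) g x v) =
      pullback J 𝓘(ℝ, ℂ) g planeForm x v := by
    rw [← planeForm_eq]
    rfl
  rw [h5]
  exact (congrArg₂ (· + ·) h3 h4).symm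

theorem localForm_extendedForm (α : OneForm I M) {f : F → M} {g : F → ℂ} {x : F}
    (hf : MDifferentiableAt 𝓘(ℝ, F) I f x) (hg : DifferentiableAt ℝ g x) :
    localForm (I.prod 𝓘(ℝ, ℂ)) (fun x ↦ (f x, g x)) (extendedForm I α) x =
      localForm I f α x + (planeCLM (g x)).comp (fderiv ℝ g x) := by
  ext v
  have := pullback_extendedForm_apply α hf hg.mdifferentiableAt v
  rw [mfderiv_eq_fderiv] at this
  exact this

variable [IsManifold I ∞ M]

theorem isSmoothForm_extendedForm [I.Boundaryless] {α : OneForm I M} (hα : IsSmoothForm I α) :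
    IsSmoothForm (I.prod 𝓘(ℝ, ℂ)) (extendedForm I α) := by
  rw [isSmoothForm_iff]
  rintro ⟨m, z⟩
  set φ := extChartAt I m
  have hψ : ContMDiffAt 𝓘(ℝ, E) I ∞ φ.symm (φ m) :=
    contMDiffAt_extChartAt_symm m (mem_extChartAt_target m)
  have h1 : ContMDiffAt 𝓘(ℝ, E × ℂ) I ∞ (fun y : E × ℂ ↦ φ.symm y.1) (φ m, z) :=
    ContMDiffAt.comp (φ m, z) (g := φ.symm) hψ contDiffAt_fst.contMDiffAt
  refine contMDiffAt_form_of_localForm (F := E × ℂ) (e := fun p : M × ℂ ↦ (φ p.1, p.2))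
    (κ := fun y : E × ℂ ↦ (φ.symm y.1, y.2)) ?_ ?_ ?_ ?_
  · refine ContMDiffAt.prodMk_space ?_ contMDiffAt_snd
    exact ContMDiffAt.comp (m, z) (g := φ) contMDiffAt_extChartAt contMDiffAt_fst
  · exact h1.prodMk contDiffAt_snd.contMDiffAt
  · have := (continuousAt_fst (p := (m, z))).eventually_mem (extChartAt_source_mem_nhds (I := I) m)
    filter_upwards [this] with p hp
    exact Prod.ext (φ.left_inv hp) rfl
  · have h2 : ∀ᶠ y in 𝓝 (φ m, z),
        MDifferentiableAt 𝓘(ℝ, E × ℂ) I (fun y : E × ℂ ↦ φ.symm y.1) y := by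
      have : ∀ᶠ y in 𝓝 (φ m, z),
          ContMDiffAt 𝓘(ℝ, E × ℂ) I 1 (fun y : E × ℂ ↦ φ.symm y.1) y :=
        (contMDiffAt_iff_contMDiffAt_nhds (by simp)).1 (h1.of_le (by simp))
      exact this.mono fun y hy ↦ hy.mdifferentiableAt (by simp)
    refine ContDiffAt.congr_of_eventuallyEq (f := fun y : E × ℂ ↦
      localForm I (fun y : E × ℂ ↦ φ.symm y.1) α y + (planeCLM y.2).comp
        (ContinuousLinearMap.snd ℝ E ℂ)) ?_ ?_
    · refine (contDiffAt_localForm hα h1).add (ContDiffAt.clm_comp ?_ contDiffAt_const)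
      exact planeCLM.contDiff.contDiffAt.comp (φ m, z) contDiffAt_snd
    · filter_upwards [h2] with y hy
      rw [localForm_extendedForm α hy differentiableAt_snd, fderiv_snd]

namespace HamAction

theorem contMDiff_extended_act (A : HamAction I M) :
    ContMDiff (𝓘(ℝ, ℝ).prod (I.prod 𝓘(ℝ, ℂ))) (I.prod 𝓘(ℝ, ℂ)) ∞
      (fun p : ℝ × (M × ℂ) ↦
        (A.act (Circle.exp p.1) p.2.1, (((Circle.exp p.1)⁻¹ : Circle) : ℂ) * p.2.2)) := by
  refine ContMDiff.prodMk ?_ ?_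
  · exact A.contMDiff_act.comp (contMDiff_fst.prodMk (contMDiff_fst.comp contMDiff_snd))
  · have h1 : ContDiff ℝ ∞ (fun x : ℝ × ℂ ↦ (((Circle.exp x.1)⁻¹ : Circle) : ℂ) * x.2) := by
      simp only [← Circle.exp_neg, Circle.coe_exp]
      have h2 : ContDiff ℝ ∞ (fun x : ℝ × ℂ ↦ ((-x.1 : ℝ) : ℂ)) :=
        Complex.ofRealCLM.contDiff.comp contDiff_fst.neg
      exact ((h2.mul contDiff_const).cexp).mul contDiff_snd
    exact ContMDiff.comp (g := fun x : ℝ × ℂ ↦ (((Circle.exp x.1)⁻¹ : Circle) : ℂ) * x.2)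
      (f := fun p : ℝ × (M × ℂ) ↦ (p.1, p.2.2)) h1.contMDiff
      (contMDiff_fst.prodMk_space (contMDiff_snd.comp contMDiff_snd))

theorem pullback_extended_act (A : HamAction I M) (c : Circle) :
    pullback (I.prod 𝓘(ℝ, ℂ)) (I.prod 𝓘(ℝ, ℂ))
      (fun p : M × ℂ ↦ (A.act c p.1, ((c⁻¹ : Circle) : ℂ) * p.2)) (extendedForm I A.form) =
      extendedForm I A.form := by
  funext p
  ext v
  have h1 : MDifferentiableAt I I (A.act c) p.1 :=
    (A.contMDiff_act_const c).mdifferentiable (by simp) _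
  have h2 : MDifferentiableAt (I.prod 𝓘(ℝ, ℂ)) I (Prod.fst : M × ℂ → M) p :=
    mdifferentiableAt_fst
  have h4 : HasFDerivAt (fun z : ℂ ↦ ((c⁻¹ : Circle) : ℂ) * z)
      (((c⁻¹ : Circle) : ℂ) • ContinuousLinearMap.id ℝ ℂ) p.2 :=
    (hasFDerivAt_id p.2).const_smul ((c⁻¹ : Circle) : ℂ)
  have h5 : HasMFDerivAt (I.prod 𝓘(ℝ, ℂ)) 𝓘(ℝ, ℂ)
      (fun p : M × ℂ ↦ ((c⁻¹ : Circle) : ℂ) * p.2) p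
      ((((c⁻¹ : Circle) : ℂ) • ContinuousLinearMap.id ℝ ℂ).comp (ContinuousLinearMap.snd ℝ E ℂ)) :=
    HasMFDerivAt.comp p h4.hasMFDerivAt (hasMFDerivAt_snd p)
  have e1 := pullback_extendedForm_apply A.form (f := fun p : M × ℂ ↦ A.act c p.1)
    (g := fun p : M × ℂ ↦ ((c⁻¹ : Circle) : ℂ) * p.2) (h1.comp p h2) h5.mdifferentiableAt v
  have e3 := pullback_comp (A.act c) (Prod.fst : M × ℂ → M) A.form h1 h2
  rw [A.pullback_act] at e3
  rw [e1, h5.mfderiv]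
  have e4 : planeCLM (((c⁻¹ : Circle) : ℂ) * p.2) (((c⁻¹ : Circle) : ℂ) * v.2) =
    planeCLM p.2 v.2 := planeCLM_circle_mul _ _ _
  have e5 : extendedForm I A.form p v =
      pullback (I.prod 𝓘(ℝ, ℂ)) I Prod.fst A.form p v + planeCLM p.2 v.2 := by
    rw [← planeForm_eq]
    have : mfderiv (I.prod 𝓘(ℝ, ℂ)) 𝓘(ℝ, ℂ) (Prod.snd : M × ℂ → ℂ) p =
      ContinuousLinearMap.snd ℝ E ℂ := mfderiv_snd
    have h : pullback (I.prod 𝓘(ℝ, ℂ)) 𝓘(ℝ, ℂ) (Prod.snd : M × ℂ → ℂ) planeForm p =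
        (planeForm p.2 : ℂ →L[ℝ] ℝ).comp (ContinuousLinearMap.snd ℝ E ℂ) := by
      rw [pullback, this]
      rfl
    exact congrArg (fun l : E × ℂ →L[ℝ] ℝ ↦
      (pullback (I.prod 𝓘(ℝ, ℂ)) I Prod.fst A.form p : E × ℂ →L[ℝ] ℝ) v + l v) h
  rw [e5]
  refine congrArg₂ (· + ·) ?_ e4
  exact congrArg (fun l : E × ℂ →L[ℝ] ℝ ↦ l v) e3

theorem extendedForm_gen (A : HamAction I M) (m : M) (z : ℂ) :
    extendedForm I A.form (m, z) (mfderiv 𝓘(ℝ, ℝ) (I.prod 𝓘(ℝ, ℂ))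
      (fun t : ℝ ↦ (A.act (Circle.exp t) m, (((Circle.exp t)⁻¹ : Circle) : ℂ) * z)) 0 (1 : ℝ)) =
      A.Ψ m - ‖z‖ ^ 2 := by
  have h1 : MDifferentiableAt 𝓘(ℝ, ℝ) I (fun t : ℝ ↦ A.act (Circle.exp t) m) 0 := by
    have : ContMDiff 𝓘(ℝ, ℝ) I ∞ (fun s : ℝ ↦ A.act (Circle.exp s) m) :=
      A.contMDiff_act.comp (contMDiff_id.prodMk contMDiff_const)
    exact this.mdifferentiable (by simp) 0
  have h2 : HasDerivAt (fun t : ℝ ↦ (((Circle.exp t)⁻¹ : Circle) : ℂ) * z)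
      (-(Complex.I * z)) 0 := by
    simp only [← Circle.exp_neg, Circle.coe_exp]
    have h3 : HasDerivAt (fun t : ℝ ↦ ((-t : ℝ) : ℂ)) (-1) 0 := by
      simpa using (hasDerivAt_neg (0 : ℝ)).ofReal_comp
    have h4 := ((h3.mul_const Complex.I).cexp).mul_const z
    simpa using h4
  have h3 := pullback_extendedForm_apply A.form h1 h2.differentiableAt.mdifferentiableAt (1 : ℝ)
  rw [mfderiv_eq_fderiv, h2.hasFDerivAt.fderiv] at h3
  have h4 : ∀ z, z = m → (A.form z : E →L[ℝ] ℝ) = A.form m := fun z hz ↦ by rw [hz]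
  have h5 : ∀ p, p = (m, z) → (extendedForm I A.form p : E × ℂ →L[ℝ] ℝ) =
    extendedForm I A.form (m, z) := fun z hz ↦ by rw [hz]
  have h6 : pullback 𝓘(ℝ, ℝ) I (fun t : ℝ ↦ A.act (Circle.exp t) m) A.form 0 (1 : ℝ) =
      A.Ψ m := by
    rw [← A.form_gen]
    exact congrArg (fun l : E →L[ℝ] ℝ ↦ l _) (h4 (A.act (Circle.exp 0) m)
      (by rw [Circle.exp_zero, A.act_one]))
  rw [h6] at h3
  have h7 := congrArg (fun l : E × ℂ →L[ℝ] ℝ ↦ l (mfderiv 𝓘(ℝ, ℝ) (I.prod 𝓘(ℝ, ℂ))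
    (fun t : ℝ ↦ (A.act (Circle.exp t) m, (((Circle.exp t)⁻¹ : Circle) : ℂ) * z)) 0 (1 : ℝ)))
    (h5 (A.act (Circle.exp 0) m, (((Circle.exp 0)⁻¹ : Circle) : ℂ) * z)
      (by simp [A.act_one]))
  have h8 : planeCLM ((((Circle.exp 0)⁻¹ : Circle) : ℂ) * z) (-(Complex.I * z)) = -‖z‖ ^ 2 := by
    simpa using planeCLM_I_mul z
  refine (h7.symm.trans h3).trans ?_
  rw [sub_eq_add_neg]
  refine congrArg (A.Ψ m + ·) (Eq.trans ?_ h8)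
  exact congrArg _ (one_smul ℝ _)

/-- The action `c • (m, z) = (c • m, c⁻¹ z)` on `M × ℂ`, with the moment map `Ψ m - |z|²`. -/
def extended [I.Boundaryless] (A : HamAction I M) : HamAction (I.prod 𝓘(ℝ, ℂ)) (M × ℂ) where
  act c p := (A.act c p.1, ((c⁻¹ : Circle) : ℂ) * p.2)
  act_one p := by simp [A.act_one]
  act_mul c d p := by
    simp only [A.act_mul, mul_inv_rev, Circle.coe_mul, Prod.mk.injEq, true_and]
    ring
  contMDiff_act := A.contMDiff_extended_act
  form := extendedForm I A.form
  smooth_form := isSmoothForm_extendedForm A.smooth_form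
  pullback_act := A.pullback_extended_act
  Ψ p := A.Ψ p.1 - ‖p.2‖ ^ 2
  form_gen p := A.extendedForm_gen p.1 p.2

theorem extended_act [I.Boundaryless] (A : HamAction I M) (c : Circle) (p : M × ℂ) :
    A.extended.act c p = (A.act c p.1, ((c⁻¹ : Circle) : ℂ) * p.2) := rfl

theorem extended_Ψ [I.Boundaryless] (A : HamAction I M) (p : M × ℂ) :
    A.extended.Ψ p = A.Ψ p.1 - ‖p.2‖ ^ 2 := rfl

/-- A smooth circle action preserving a `1`-form. -/
def ofSMul [MulAction Circle M] [ContMDiffSMul (𝓡 1) I ∞ Circle M] {α : OneForm I M}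
    (hα : IsSmoothForm I α) (hinv : IsInvariantForm I α) : HamAction I M where
  act c m := c • m
  act_one := one_smul _
  act_mul := mul_smul
  contMDiff_act := by
    have h1 : ContMDiff 𝓘(ℝ, ℝ) (𝓡 1) ∞ Circle.exp := contMDiff_circleExp
    exact (ContMDiffSMul.contMDiff_smul (I := 𝓡 1) (I' := I) (n := ∞) (G := Circle)
      (M := M)).comp ((h1.comp contMDiff_fst).prodMk contMDiff_snd)
  form := α
  smooth_form := hα
  pullback_act := hinv
  Ψ := momentMap I α
  form_gen _ := rfl

end HamAction

end ContactCut

end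

/-! ### The reduced space and the cut as topological orbit spaces -/

noncomputable section

namespace ContactCut

open Filter Topology

section Phase

/-- The phase `z / |z|` of a complex number, equal to `1` for `z = 0`. -/
def phase (z : ℂ) : Circle := Circle.exp z.arg

theorem norm_mul_phase (z : ℂ) : (‖z‖ : ℂ) * (phase z : ℂ) = z := by
  rw [phase, Circle.coe_exp, Complex.norm_mul_exp_arg_mul_I]

theorem phase_eq {z : ℂ} (hz : z ≠ 0) : (phase z : ℂ) = ((‖z‖⁻¹ : ℝ) : ℂ) * z := by
  have h : (‖z‖ : ℂ) ≠ 0 := by simpa using hz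
  conv_rhs => rw [← norm_mul_phase z]
  rw [← mul_assoc, Complex.ofReal_inv, norm_mul, Complex.norm_real, Circle.norm_coe, norm_norm,
    mul_one, inv_mul_cancel₀ h, one_mul]

theorem phase_ofReal {r : ℝ} (hr : 0 ≤ r) : phase (r : ℂ) = 1 := by
  rw [phase, Complex.arg_ofReal_of_nonneg hr, Circle.exp_zero]

theorem phase_circle_mul (c : Circle) {z : ℂ} (hz : z ≠ 0) : phase (c * z) = c * phase z := by
  have h : (c : ℂ) * z ≠ 0 := mul_ne_zero (Circle.coe_ne_zero c) hz
  refine Circle.ext ?_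
  rw [Circle.coe_mul, phase_eq h, phase_eq hz, norm_mul, Circle.norm_coe, one_mul]
  ring

theorem contDiffAt_phase {z : ℂ} (hz : z ≠ 0) : ContDiffAt ℝ ∞ (fun z ↦ (phase z : ℂ)) z := by
  have h1 : ContDiffAt ℝ ∞ (fun z : ℂ ↦ ((‖z‖⁻¹ : ℝ) : ℂ) * z) z := by
    refine ContDiffAt.mul ?_ contDiffAt_id
    exact Complex.ofRealCLM.contDiff.contDiffAt.comp z
      ((contDiffAt_norm ℝ hz).inv (by simpa using hz))
  refine h1.congr_of_eventuallyEq ?_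
  filter_upwards [isOpen_ne.mem_nhds hz] with w hw using phase_eq hw

end Phase

variable {E : Type*} [NormedAddCommGroup E] [NormedSpace ℝ E] {H : Type*} [TopologicalSpace H]
  {I : ModelWithCorners ℝ E H} {M : Type*} [TopologicalSpace M] [ChartedSpace H M]
  [IsManifold I ∞ M]
  {F : Type*} [NormedAddCommGroup F] [NormedSpace ℝ F]
  {F' : Type*} [NormedAddCommGroup F'] [NormedSpace ℝ F']

/-- The saturation of an open set is a union of its translates by the group. -/
theorem isOpenMap_of_isQuotientMap (A : HamAction I M) {Z : Set M} {Q : Type*} [TopologicalSpace Q]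
    {q : Z → Q} (hq : IsQuotientMap q) (hZ : ∀ m, m ∈ Z ↔ A.Ψ m = 0)
    (h : ∀ z z', q z = q z' ↔ ∃ c, (z : M) = A.act c z') : IsOpenMap q := by
  have hact : ∀ c, ∀ z : Z, A.act c z ∈ Z := fun c z ↦ by
    rw [hZ, A.Ψ_act, ← hZ]
    exact z.2
  intro U hU
  rw [← hq.isOpen_preimage]
  have : q ⁻¹' (q '' U) = ⋃ c, (fun z : Z ↦ (⟨A.act c z, hact c z⟩ : Z)) ⁻¹' U := by
    ext z
    simp only [mem_preimage, mem_image, mem_iUnion]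
    constructor
    · rintro ⟨z', hz', hzz'⟩
      obtain ⟨c, hc⟩ := (h z' z).1 hzz'
      exact ⟨c, by simpa [← hc] using hz'⟩
    · rintro ⟨c, hc⟩
      exact ⟨_, hc, (h _ _).2 ⟨c, rfl⟩⟩
  rw [this]
  refine isOpen_iUnion fun c ↦ hU.preimage ?_
  exact ((A.contMDiff_act_const c).continuous.comp continuous_subtype_val).subtype_mk _

section Quotients

variable [MulAction Circle M] (A : HamAction I M) (hA : ∀ c m, A.act c m = c • m)

/-- The reduced space as a reduction. -/
def reducedReduction : Reduction A {m | A.Ψ m = 0} (ReducedSpace A.Ψ) where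
  q := ReducedSpace.mk A.Ψ
  mem_iff _ := Iff.rfl
  continuous_q := continuous_quotient_mk'
  isOpenMap_q := isOpenMap_of_isQuotientMap A isQuotientMap_quotient_mk' (fun _ ↦ Iff.rfl)
    (fun z z' ↦ by
      simp only [hA]
      exact Quotient.eq (r := levelSetoid A.Ψ))
  surjective_q := Quotient.mk_surjective
  q_eq_iff z z' := by
    simp only [hA]
    exact Quotient.eq (r := levelSetoid A.Ψ)

variable {A}

include hA in
theorem Ψ_smul (c : Circle) (m : M) : A.Ψ (c • m) = A.Ψ m := by rw [← hA, A.Ψ_act]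

omit [MulAction Circle M] in
theorem Ψ_eq_of_mem (p : extendedLevel A.Ψ) : A.Ψ p.1.1 = ‖p.1.2‖ ^ 2 := sub_eq_zero.1 p.2

omit [MulAction Circle M] in
theorem Ψ_nonneg_of_mem (p : extendedLevel A.Ψ) : 0 ≤ A.Ψ p.1.1 := by
  rw [Ψ_eq_of_mem]
  positivity

/-- The quotient map `(m, z) ↦ [(z / |z|) • m]` onto the cut. -/
def cutMap (p : extendedLevel A.Ψ) : Cut A.Ψ :=
  Cut.mk A.Ψ (phase p.1.2 • p.1.1) (by rw [Ψ_smul hA]; exact Ψ_nonneg_of_mem p)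

omit [TopologicalSpace M] in
theorem cut_mk_eq_iff {f : M → ℝ} {m m' : M} (hm : 0 ≤ f m) (hm' : 0 ≤ f m') :
    Cut.mk f m hm = Cut.mk f m' hm' ↔ m = m' ∨ (f m = 0 ∧ f m' = 0 ∧ ∃ c : Circle, m = c • m') := by
  refine (Quotient.eq (r := cutSetoid f)).trans ?_
  exact or_congr_left Subtype.ext_iff

omit [TopologicalSpace M] in
theorem cut_mk_congr {f : M → ℝ} {m m' : M} (hm : 0 ≤ f m) (h : m = m') :
    Cut.mk f m hm = Cut.mk f m' (h ▸ hm) := by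
  subst h
  rfl

/-- The section `m ↦ (m, √(Ψ m))`. -/
def sqrtSection (x : {m : M // 0 ≤ A.Ψ m}) : extendedLevel A.Ψ :=
  ⟨(x, (Real.sqrt (A.Ψ x) : ℂ)), by
    simp [extendedLevel, Real.sq_sqrt x.2]⟩

theorem cutMap_of_eq_ofReal (p : extendedLevel A.Ψ) {r : ℝ} (hr : 0 ≤ r) (h : p.1.2 = (r : ℂ)) :
    cutMap hA p = Cut.mk A.Ψ p.1.1 (Ψ_nonneg_of_mem p) := by
  refine cut_mk_congr _ ?_
  rw [h, phase_ofReal hr, one_smul]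

theorem cutMap_sqrtSection (x : {m : M // 0 ≤ A.Ψ m}) :
    cutMap hA (sqrtSection x) = Cut.mk A.Ψ x x.2 :=
  cutMap_of_eq_ofReal hA _ (Real.sqrt_nonneg _) rfl

/-- For $z\ne 0$ an orbit of $\Psi^{-1}(0)$ has exactly one point with $z>0$, namely
$(\mathrm{phase}(z)\cdot m,|z|)$. For $z=0$ the orbit is one in $f^{-1}(0)$, which the cut
collapses. -/
theorem cutMap_eq_iff (p p' : extendedLevel A.Ψ) : cutMap hA p = cutMap hA p' ↔
    ∃ c : Circle, p.1.1 = c • p'.1.1 ∧ p.1.2 = ((c⁻¹ : Circle) : ℂ) * p'.1.2 := by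
  rw [cutMap, cutMap, cut_mk_eq_iff]
  obtain ⟨⟨m, z⟩, hp⟩ := p
  obtain ⟨⟨m', z'⟩, hp'⟩ := p'
  have hz : A.Ψ m = ‖z‖ ^ 2 := sub_eq_zero.1 hp
  have hz' : A.Ψ m' = ‖z'‖ ^ 2 := sub_eq_zero.1 hp'
  simp only [Ψ_smul hA]
  constructor
  · rintro (h | ⟨h1, h2, c, hc⟩)
    · have h1 : m = ((phase z)⁻¹ * phase z') • m' := by
        rw [mul_smul, ← h, inv_smul_smul]
      refine ⟨_, h1, ?_⟩
      have h2 : ‖z‖ = ‖z'‖ := by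
        have : ‖z‖ ^ 2 = ‖z'‖ ^ 2 := by rw [← hz, ← hz', h1, Ψ_smul hA]
        exact (pow_left_inj₀ (norm_nonneg _) (norm_nonneg _) two_ne_zero).1 this
      have h3 : phase z = ((phase z)⁻¹ * phase z')⁻¹ * phase z' := by
        rw [mul_inv_rev, inv_inv, mul_right_comm, inv_mul_cancel, one_mul]
      set c := ((phase z)⁻¹ * phase z')⁻¹
      calc z = (‖z'‖ : ℂ) * (c * phase z') := by
            rw [← h2, ← Circle.coe_mul, ← h3, norm_mul_phase]
        _ = c * ((‖z'‖ : ℂ) * phase z') := by ring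
        _ = c * z' := by rw [norm_mul_phase]
    · have e1 : z = 0 := by simpa [hz] using h1
      have e2 : z' = 0 := by simpa [hz'] using h2
      refine ⟨(phase z)⁻¹ * (c * phase z'), ?_, by simp [e1, e2]⟩
      rw [mul_smul, mul_smul, ← hc, inv_smul_smul]
  · rintro ⟨c, rfl, rfl⟩
    by_cases h : z' = 0
    · subst h
      right
      simp only [Ψ_smul hA] at hz ⊢
      refine ⟨by simpa using hz, by simpa using hz, phase (((c⁻¹ : Circle) : ℂ) * 0) * c *
        (phase 0)⁻¹, ?_⟩
      rw [mul_smul, mul_smul, inv_smul_smul]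
    · left
      rw [phase_circle_mul _ h, mul_smul, smul_comm, inv_smul_smul]

theorem surjective_cutMap : Function.Surjective (cutMap hA) := by
  intro x
  obtain ⟨x, rfl⟩ := Quotient.mk_surjective (s := cutSetoid A.Ψ) x
  exact ⟨sqrtSection x, cutMap_sqrtSection hA x⟩

variable [I.Boundaryless]

theorem cutMap_eq_iff_act (p p' : extendedLevel A.Ψ) : cutMap hA p = cutMap hA p' ↔
    ∃ c, (p : M × ℂ) = A.extended.act c p' := by
  rw [cutMap_eq_iff]
  simp only [HamAction.extended_act, hA, Prod.ext_iff]

/-- The phase is discontinuous at $z=0$, so the formula does not give continuity. Instead, the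
preimage of a closed set consists of the points some translate of which lies in the closed set `K`
of normalised points $z=\sqrt{\Psi}$; it is closed because the circle is compact. -/
theorem continuous_cutMap : Continuous (cutMap hA) := by
  rw [continuous_iff_isClosed]
  intro C hC
  set r : extendedLevel A.Ψ → {m : M // 0 ≤ A.Ψ m} := fun p ↦ ⟨p.1.1, Ψ_nonneg_of_mem p⟩ with hr
  have hrc : Continuous r := (continuous_fst.comp continuous_subtype_val).subtype_mk _
  set K : Set (extendedLevel A.Ψ) :=
    {p | p.1.2 = (Real.sqrt (A.Ψ p.1.1) : ℂ)} ∩ {p | Cut.mk A.Ψ (r p) (r p).2 ∈ C} with hK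
  have hmk : Continuous fun x : {m : M // 0 ≤ A.Ψ m} ↦ Cut.mk A.Ψ x x.2 :=
    continuous_quotient_mk'
  have hΨ : Continuous A.Ψ := A.contMDiff_Ψ.continuous
  have hKc : IsClosed K := by
    refine IsClosed.inter ?_ (hC.preimage (hmk.comp hrc))
    refine isClosed_eq (continuous_snd.comp continuous_subtype_val) ?_
    exact Complex.continuous_ofReal.comp (Real.continuous_sqrt.comp
      (hΨ.comp (continuous_fst.comp continuous_subtype_val)))
  have hact : ∀ c, ∀ p : extendedLevel A.Ψ, A.extended.act c p ∈ extendedLevel A.Ψ := by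
    intro c p
    have h := A.extended.Ψ_act c p
    rw [A.extended_Ψ, A.extended_Ψ] at h
    exact h.trans p.2
  have h1 : IsClosed {x : Circle × extendedLevel A.Ψ |
      (⟨A.extended.act x.1 x.2, hact x.1 x.2⟩ : extendedLevel A.Ψ) ∈ K} := by
    refine hKc.preimage (Continuous.subtype_mk ?_ _)
    exact A.extended.continuous_act.comp
      (f := fun x : Circle × extendedLevel A.Ψ ↦ (x.1, (x.2 : M × ℂ))) (by fun_prop)
  have h2 := isClosedMap_snd_of_compactSpace (X := Circle) (Y := extendedLevel A.Ψ) _ h1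
  convert h2 using 1
  ext p
  simp only [mem_preimage, mem_image]
  constructor
  · intro h
    refine ⟨(phase p.1.2, p), ⟨?_, ?_⟩, rfl⟩
    · change (((phase p.1.2)⁻¹ : Circle) : ℂ) * p.1.2 = (Real.sqrt (A.Ψ (A.act _ p.1.1)) : ℂ)
      rw [A.Ψ_act, Ψ_eq_of_mem, Real.sqrt_sq (norm_nonneg _), Circle.coe_inv]
      conv_lhs => rw [← norm_mul_phase p.1.2]
      have := Circle.coe_ne_zero (phase p.1.2)
      rw [norm_mul_phase]
      nth_rw 2 [← norm_mul_phase p.1.2]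
      field_simp
    · change Cut.mk A.Ψ (A.act (phase p.1.2) p.1.1) _ ∈ C
      have := cut_mk_congr (f := A.Ψ) (m := A.act (phase p.1.2) p.1.1)
        (m' := phase p.1.2 • p.1.1) (by rw [A.Ψ_act]; exact Ψ_nonneg_of_mem p) (hA _ _)
      rw [this]
      exact h
  · rintro ⟨⟨c, p'⟩, ⟨h3, h4⟩, rfl⟩
    have h5 : cutMap hA ⟨A.extended.act c p', hact c p'⟩ = cutMap hA p' :=
      (cutMap_eq_iff_act hA _ _).2 ⟨c, rfl⟩
    rw [← h5, cutMap_of_eq_ofReal hA _ (Real.sqrt_nonneg _) h3]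
    exact h4

/-- The cut as a reduction. -/
def cutReduction : Reduction A.extended (extendedLevel A.Ψ) (Cut A.Ψ) where
  q := cutMap hA
  mem_iff _ := Iff.rfl
  continuous_q := continuous_cutMap hA
  isOpenMap_q := by
    have hs : Continuous (sqrtSection (A := A)) := by
      refine Continuous.subtype_mk (continuous_subtype_val.prodMk ?_) _
      exact Complex.continuous_ofReal.comp (Real.continuous_sqrt.comp
        (A.contMDiff_Ψ.continuous.comp continuous_subtype_val))
    -- The section turns `cutMap` into the defining quotient map of the cut, so the quotient
    -- topology from $\Psi^{-1}(0)$ agrees with that from $\{f\ge 0\}$.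
    have h1 : IsQuotientMap (cutMap hA ∘ sqrtSection) := by
      have : cutMap hA ∘ sqrtSection = Quotient.mk (cutSetoid A.Ψ) :=
        funext fun x ↦ cutMap_sqrtSection hA x
      rw [this]
      exact isQuotientMap_quotient_mk'
    exact isOpenMap_of_isQuotientMap A.extended
      (IsQuotientMap.of_comp hs (continuous_cutMap hA) h1) (fun _ ↦ Iff.rfl) (cutMap_eq_iff_act hA)
  surjective_q := surjective_cutMap hA
  q_eq_iff := cutMap_eq_iff_act hA

end Quotients

end ContactCut

end

/-! ### Explicit slices of $M\times\mathbb{C}$ -/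

noncomputable section

namespace ContactCut

open Filter Topology

variable {E : Type*} [NormedAddCommGroup E] [NormedSpace ℝ E] {H : Type*} [TopologicalSpace H]
  {I : ModelWithCorners ℝ E H} {M : Type*} [TopologicalSpace M] [ChartedSpace H M]
  [IsManifold I ∞ M] [I.Boundaryless] {A : HamAction I M}
  {F : Type*} [NormedAddCommGroup F] [NormedSpace ℝ F]
  {F' : Type*} [NormedAddCommGroup F'] [NormedSpace ℝ F']

namespace Slice

theorem contDiff_normSq : ContDiff ℝ ∞ (fun z : ℂ ↦ ‖z‖ ^ 2) := contDiff_norm_sq ℝ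

/-- The slice of `M × ℂ` over a slice of `M`. -/
def extended (T : Slice A F) (L : (F × ℂ) ≃L[ℝ] F') : Slice A.extended F' where
  source := {p | p.1 ∈ T.source}
  target := {b | (b.1 + ‖(L.symm b.2).2‖ ^ 2, (L.symm b.2).1) ∈ T.target}
  -- For $f-|z|^2$ to take the value `b.1`, the slice of $M$ must be entered at height `b.1`
  -- $+|z|^2$.
  κ b := (T.κ (b.1 + ‖(L.symm b.2).2‖ ^ 2, (L.symm b.2).1), (L.symm b.2).2)
  -- The product of `ang` and $z$ is invariant: the action multiplies one by `c` and the other by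
  -- `c⁻¹`.
  w p := L (T.w p.1, T.ang p.1 * p.2)
  ang p := T.ang p.1
  isOpen_source := T.isOpen_source.preimage continuous_fst
  isOpen_target := T.isOpen_target.preimage
    (f := fun b : ℝ × F' ↦ (b.1 + ‖(L.symm b.2).2‖ ^ 2, (L.symm b.2).1)) (by fun_prop)
  contMDiffOn_κ := by
    intro b hb
    refine ContMDiffAt.contMDiffWithinAt ?_
    have hL : ContDiff ℝ ∞ (fun b : ℝ × F' ↦ L.symm b.2) := L.symm.contDiff.comp contDiff_snd
    have hL2 : ContDiff ℝ ∞ (fun b : ℝ × F' ↦ (L.symm b.2).2) := contDiff_snd.comp hL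
    refine ContMDiffAt.prodMk ?_ hL2.contMDiff.contMDiffAt
    refine ContMDiffAt.comp b (g := T.κ)
      (f := fun b : ℝ × F' ↦ (b.1 + ‖(L.symm b.2).2‖ ^ 2, (L.symm b.2).1)) (T.contMDiffAt_κ hb) ?_
    exact ((contDiff_fst.add (contDiff_normSq.comp hL2)).prodMk
      (contDiff_fst.comp hL)).contMDiff.contMDiffAt
  contMDiffOn_w := by
    intro p hp
    refine ContMDiffAt.contMDiffWithinAt ?_
    refine L.contDiff.contMDiff.contMDiffAt.comp p ?_
    refine ContMDiffAt.prodMk_space ?_ ?_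
    · exact ContMDiffAt.comp p (T.contMDiffAt_w hp) contMDiffAt_fst
    · have h1 : ContMDiffAt (I.prod 𝓘(ℝ, ℂ)) 𝓘(ℝ, ℂ × ℂ) ∞
          (fun p : M × ℂ ↦ ((T.ang p.1 : ℂ), p.2)) p :=
        ContMDiffAt.prodMk_space (ContMDiffAt.comp p (g := fun m ↦ (T.ang m : ℂ))
          (T.contMDiffAt_ang hp) contMDiffAt_fst) contMDiffAt_snd
      exact ContMDiffAt.comp p (g := fun x : ℂ × ℂ ↦ x.1 * x.2)
        (contDiff_fst.mul contDiff_snd).contMDiff.contMDiffAt h1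
  contMDiffOn_ang := by
    intro p hp
    exact (ContMDiffAt.comp p (g := fun m ↦ (T.ang m : ℂ)) (f := Prod.fst)
          (T.contMDiffAt_ang hp) contMDiffAt_fst).contMDiffWithinAt
  κ_mem b hb := T.κ_mem _ hb
  Ψ_κ b hb := by
    rw [A.extended_Ψ]
    simp only [T.Ψ_κ _ hb, add_sub_cancel_right]
  w_κ b hb := by
    simp only [T.w_κ _ hb, T.ang_κ _ hb, Circle.coe_one, one_mul, Prod.mk.eta, L.apply_symm_apply]
  ang_κ b hb := T.ang_κ _ hb
  act_mem c p hp := T.act_mem c _ hp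
  w_act c p hp := by
    simp only [A.extended_act, T.w_act c _ hp, T.ang_act c _ hp, Circle.coe_mul, Circle.coe_inv]
    have := Circle.coe_ne_zero c
    congr 2
    field_simp
  ang_act c p hp := T.ang_act c _ hp
  coord_mem p hp := by
    simp only [mem_ofPred_eq, L.symm_apply_apply, A.extended_Ψ, norm_mul, Circle.norm_coe, one_mul,
      sub_add_cancel]
    exact T.coord_mem _ hp
  act_ang p hp := by
    simp only [L.symm_apply_apply, A.extended_Ψ, norm_mul, Circle.norm_coe, one_mul,
      sub_add_cancel, A.extended_act, T.act_ang _ hp]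
    refine Prod.ext rfl ?_
    simp

theorem mem_extended_target₀ (T : Slice A F) (L : (F × ℂ) ≃L[ℝ] F') {b : F'} :
    b ∈ (T.extended L).target₀ ↔ (‖(L.symm b).2‖ ^ 2, (L.symm b).1) ∈ T.target := by
  change (0 + ‖(L.symm b).2‖ ^ 2, (L.symm b).1) ∈ T.target ↔ _
  rw [zero_add]

theorem extended_κ₀ (T : Slice A F) (L : (F × ℂ) ≃L[ℝ] F') (b : F') :
    (T.extended L).κ₀ b = (T.κ (‖(L.symm b).2‖ ^ 2, (L.symm b).1), (L.symm b).2) := by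
  change (T.κ (0 + ‖(L.symm b).2‖ ^ 2, (L.symm b).1), (L.symm b).2) = _
  rw [zero_add]

theorem extended_w (T : Slice A F) (L : (F × ℂ) ≃L[ℝ] F') (p : M × ℂ) :
    (T.extended L).w p = L (T.w p.1, T.ang p.1 * p.2) := rfl

variable (A) in
/-- The slice `z > 0` of `M × ℂ` with the coordinates of a chart of `M`. -/
def ofChart (p : M) : Slice A.extended E where
  source := {x | x.2 ≠ 0 ∧ A.act (phase x.2) x.1 ∈ (extChartAt I p).source}
  target := {b | b.2 ∈ (extChartAt I p).target ∧ 0 < A.Ψ ((extChartAt I p).symm b.2) - b.1}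
  -- The root is the positive solution $z$ of $\Psi-z^2=$ `b.1`.
  κ b := ((extChartAt I p).symm b.2, (Real.sqrt (A.Ψ ((extChartAt I p).symm b.2) - b.1) : ℂ))
  w x := extChartAt I p (A.act (phase x.2) x.1)
  -- Acting by `phase z` makes $z$ positive, so the inverse phase leads back from the slice to the
  -- point.
  ang x := (phase x.2)⁻¹
  isOpen_source := by
    have h : ContinuousOn (fun x : M × ℂ ↦ A.act (phase x.2) x.1) {x | x.2 ≠ 0} := fun x hx ↦
      (A.contMDiffAt_act_comp (J := I.prod 𝓘(ℝ, ℂ)) (g := fun x : M × ℂ ↦ phase x.2)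
        (ContMDiffAt.comp x (g := fun z : ℂ ↦ (phase z : ℂ)) (contDiffAt_phase hx).contMDiffAt
          contMDiffAt_snd) contMDiffAt_fst).continuousAt.continuousWithinAt
    exact h.isOpen_inter_preimage (isOpen_ne.preimage continuous_snd) (isOpen_extChartAt_source p)
  isOpen_target := by
    have h : ContinuousOn (fun b : ℝ × E ↦ A.Ψ ((extChartAt I p).symm b.2) - b.1)
        (Prod.snd ⁻¹' (extChartAt I p).target) := fun b hb ↦
      (((A.contDiffAt_Ψ_chart p hb).continuousAt.comp (f := Prod.snd) continuousAt_snd).sub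
        continuousAt_fst).continuousWithinAt
    exact h.isOpen_inter_preimage ((isOpen_extChartAt_target p).preimage continuous_snd) isOpen_Ioi
  contMDiffOn_κ := by
    rintro b ⟨hb, hb'⟩
    refine ContMDiffAt.contMDiffWithinAt (ContMDiffAt.prodMk ?_ ?_)
    · exact ContMDiffAt.comp b (g := (extChartAt I p).symm) (contMDiffAt_extChartAt_symm p hb)
        contDiffAt_snd.contMDiffAt
    · refine ContDiffAt.contMDiffAt (Complex.ofRealCLM.contDiff.contDiffAt.comp b ?_)
      refine ContDiffAt.sqrt (ContDiffAt.sub ?_ contDiffAt_fst) hb'.ne'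
      exact (A.contDiffAt_Ψ_chart p hb).comp b contDiffAt_snd
  contMDiffOn_w := by
    rintro x ⟨hx, hx'⟩
    refine ContMDiffAt.contMDiffWithinAt ?_
    refine ContMDiffAt.comp x (g := extChartAt I p)
      (f := fun x : M × ℂ ↦ A.act (phase x.2) x.1) (contMDiffAt_extChartAt' (by simpa using hx')) ?_
    exact A.contMDiffAt_act_comp (g := fun x : M × ℂ ↦ phase x.2)
        (ContMDiffAt.comp x (g := fun z : ℂ ↦ (phase z : ℂ)) (contDiffAt_phase hx).contMDiffAt
          contMDiffAt_snd) contMDiffAt_fst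
  contMDiffOn_ang := by
    rintro x ⟨hx, hx'⟩
    refine ContMDiffAt.contMDiffWithinAt ?_
    have h1 : ContDiffAt ℝ ∞ (fun z : ℂ ↦ (((phase z)⁻¹ : Circle) : ℂ)) x.2 := by
      simp only [Circle.coe_inv_eq_conj]
      exact Complex.conjCLE.contDiff.contDiffAt.comp x.2 (contDiffAt_phase hx)
    exact ContMDiffAt.comp x (g := fun z : ℂ ↦ (((phase z)⁻¹ : Circle) : ℂ)) h1.contMDiffAt
      contMDiffAt_snd
  κ_mem := by
    rintro b ⟨hb, hb'⟩
    refine ⟨by simpa using (Real.sqrt_pos.2 hb').ne', ?_⟩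
    simp only
    rw [phase_ofReal (Real.sqrt_nonneg _), A.act_one]
    exact (extChartAt I p).map_target hb
  Ψ_κ := by
    rintro b ⟨hb, hb'⟩
    rw [A.extended_Ψ]
    simp only [Complex.norm_real, Real.norm_eq_abs, sq_abs, Real.sq_sqrt hb'.le, sub_sub_cancel]
  w_κ := by
    rintro b ⟨hb, hb'⟩
    simp only
    rw [phase_ofReal (Real.sqrt_nonneg _), A.act_one, (extChartAt I p).right_inv hb]
  ang_κ := by
    rintro b ⟨hb, hb'⟩
    simp only
    rw [phase_ofReal (Real.sqrt_nonneg _), inv_one]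
  act_mem := by
    rintro c x ⟨hx, hx'⟩
    refine ⟨mul_ne_zero (Circle.coe_ne_zero _) hx, ?_⟩
    rw [A.extended_act]
    simp only
    rwa [phase_circle_mul _ hx, mul_comm, A.act_mul, A.act_inv_act]
  w_act := by
    rintro c x ⟨hx, hx'⟩
    simp only [A.extended_act]
    rw [phase_circle_mul _ hx, mul_comm, A.act_mul, A.act_inv_act]
  ang_act := by
    rintro c x ⟨hx, hx'⟩
    simp only [A.extended_act]
    rw [phase_circle_mul _ hx, mul_inv, inv_inv]
  coord_mem := by
    rintro x ⟨hx, hx'⟩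
    refine ⟨(extChartAt I p).map_source hx', ?_⟩
    simp only [(extChartAt I p).left_inv hx', A.Ψ_act, A.extended_Ψ, sub_sub_cancel]
    exact pow_pos (norm_pos_iff.2 hx) 2
  act_ang := by
    rintro x ⟨hx, hx'⟩
    simp only [(extChartAt I p).left_inv hx', A.Ψ_act, A.extended_Ψ, sub_sub_cancel,
      A.extended_act, inv_inv, A.act_inv_act, Real.sqrt_sq (norm_nonneg _)]
    refine Prod.ext rfl ?_
    rw [mul_comm]
    exact norm_mul_phase x.2

theorem mem_ofChart_source {p : M} {x : M × ℂ} : x ∈ (ofChart A p).source ↔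
    x.2 ≠ 0 ∧ A.act (phase x.2) x.1 ∈ (extChartAt I p).source := Iff.rfl

theorem mem_ofChart_target₀ {p : M} {b : E} : b ∈ (ofChart A p).target₀ ↔
    b ∈ (extChartAt I p).target ∧ 0 < A.Ψ ((extChartAt I p).symm b) := by
  change _ ∧ 0 < A.Ψ ((extChartAt I p).symm b) - 0 ↔ _
  rw [sub_zero]

theorem ofChart_κ₀ (p : M) (b : E) : (ofChart A p).κ₀ b =
    ((extChartAt I p).symm b, (Real.sqrt (A.Ψ ((extChartAt I p).symm b)) : ℂ)) := by
  change (_, ((Real.sqrt (A.Ψ ((extChartAt I p).symm b) - 0) : ℝ) : ℂ)) = _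
  rw [sub_zero]

theorem ofChart_w (p : M) (x : M × ℂ) :
    (ofChart A p).w x = extChartAt I p (A.act (phase x.2) x.1) := rfl

end Slice

/-- Slices of `M × ℂ` exist at the points of the zero level set if slices of `M` do. -/
theorem exists_extended_slice (hcov : ∀ m, A.Ψ m = 0 → ∃ T : Slice A F, m ∈ T.source)
    (hL : ∀ m, A.Ψ m = 0 → Nonempty ((F × ℂ) ≃L[ℝ] E)) :
    ∀ x ∈ extendedLevel A.Ψ, ∃ T : Slice A.extended E, x ∈ T.source := by
  intro x hx
  by_cases h : x.2 = 0
  · have h1 : A.Ψ x.1 = 0 := by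
      have : A.Ψ x.1 - ‖x.2‖ ^ 2 = 0 := hx
      simpa [h] using this
    obtain ⟨T, hT⟩ := hcov x.1 h1
    obtain ⟨L⟩ := hL x.1 h1
    exact ⟨T.extended L, hT⟩
  · exact ⟨Slice.ofChart A (A.act (phase x.2) x.1), h, mem_extChartAt_source _⟩

/-- The plane form vanishes on the real axis, so the section $z=\sqrt{f}$ adds nothing to `α`. -/
theorem planeCLM_ofReal (r s : ℝ) : planeCLM (r : ℂ) (s : ℂ) = 0 := by
  simp [planeCLM_apply]

/-- Over $\{f>0\}$ the quotient form, in the coordinates of a chart of $M$, is `α` itself. Both the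
contact condition there and the contactomorphism rest on this. -/
theorem localForm_ofChart_κ₀ {p : M} {b : E} (hb : b ∈ (Slice.ofChart A p).target₀) :
    localForm (I.prod 𝓘(ℝ, ℂ)) (Slice.ofChart A p).κ₀ A.extended.form b =
      localForm I (extChartAt I p).symm A.form b := by
  obtain ⟨hb1, hb2⟩ := Slice.mem_ofChart_target₀.1 hb
  have h1 : ContDiffAt ℝ ∞ (fun b ↦ Real.sqrt (A.Ψ ((extChartAt I p).symm b))) b :=
    (A.contDiffAt_Ψ_chart p hb1).sqrt hb2.ne'
  have h2 : HasFDerivAt (fun b ↦ (Real.sqrt (A.Ψ ((extChartAt I p).symm b)) : ℂ))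
      (Complex.ofRealCLM.comp (fderiv ℝ (fun b ↦ Real.sqrt (A.Ψ ((extChartAt I p).symm b))) b)) b :=
    Complex.ofRealCLM.hasFDerivAt.comp b (h1.differentiableAt (by simp)).hasFDerivAt
  rw [show (Slice.ofChart A p).κ₀ = _ from funext (Slice.ofChart_κ₀ p)]
  refine (localForm_extendedForm A.form
    ((contMDiffAt_extChartAt_symm p hb1).mdifferentiableAt (by simp)) h2.differentiableAt).trans ?_
  rw [h2.fderiv]
  ext v
  simp [planeCLM_ofReal]

theorem localForm_extended_κ₀ {T : Slice A F} {L : (F × ℂ) ≃L[ℝ] F'} {b : F'}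
    (hb : b ∈ (T.extended L).target₀) :
    localForm (I.prod 𝓘(ℝ, ℂ)) (T.extended L).κ₀ A.extended.form b =
      localForm I (fun b ↦ T.κ (‖(L.symm b).2‖ ^ 2, (L.symm b).1)) A.form b +
        (planeCLM (L.symm b).2).comp ((ContinuousLinearMap.snd ℝ F ℂ).comp
          (L.symm : F' →L[ℝ] F × ℂ)) := by
  have hL2 : HasFDerivAt (fun b : F' ↦ (L.symm b).2)
      ((ContinuousLinearMap.snd ℝ F ℂ).comp (L.symm : F' →L[ℝ] F × ℂ)) b :=
    hasFDerivAt_snd.comp b L.symm.hasFDerivAt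
  have hg : DifferentiableAt ℝ (fun b : F' ↦ (‖(L.symm b).2‖ ^ 2, (L.symm b).1)) b := by
    have h1 : ContDiff ℝ ∞ (fun b : F' ↦ (L.symm b).2) := contDiff_snd.comp L.symm.contDiff
    have h2 : ContDiff ℝ ∞ (fun b : F' ↦ (L.symm b).1) := contDiff_fst.comp L.symm.contDiff
    exact (((Slice.contDiff_normSq.comp h1).prodMk h2).differentiable (by simp)) b
  rw [show (T.extended L).κ₀ = _ from funext (Slice.extended_κ₀ T L), ← hL2.fderiv]
  refine localForm_extendedForm A.form ?_ hL2.differentiableAt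
  exact MDifferentiableAt.comp b (g := T.κ)
    (f := fun b : F' ↦ (‖(L.symm b).2‖ ^ 2, (L.symm b).1))
    ((T.contMDiffAt_κ ((T.mem_extended_target₀ L).1 hb)).mdifferentiableAt (by simp))
    hg.mdifferentiableAt

end ContactCut

end

/-! ### Nondegeneracy of the quotient forms in slices -/

noncomputable section

namespace ContactCut

open Filter Topology

section Wedge

variable {V W : Type*} [NormedAddCommGroup V] [NormedSpace ℝ V] [NormedAddCommGroup W]
  [NormedSpace ℝ W]

/-- A family of `2k + 1` vectors extended by two more. -/
def extendTuple {V : Type*} {k : ℕ} (e : Fin (2 * k + 1) → V) (x y : V) :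
    Fin (2 * (k + 1) + 1) → V :=
  Fin.snoc (α := fun _ ↦ V) (Fin.snoc (α := fun _ ↦ V) e x) y

theorem wedgePow_extendTuple {k : ℕ} {a : V →L[ℝ] ℝ} {b : V [⋀^Fin 2]→L[ℝ] ℝ}
    {e : Fin (2 * k + 1) → V} {x y : V} (ha : a x = 0) (hb : ∀ i, b ![x, e i] = 0) :
    wedgePow (k + 1) a b (extendTuple e x y) = (k + 1) * b ![x, y] * wedgePow k a b e := by
  have h1 : ∀ i : Fin (2 * k + 1), extendTuple e x y (i.castLE (by omega)) = e i := by
    intro i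
    change Fin.snoc (α := fun _ ↦ V) (Fin.snoc (α := fun _ ↦ V) e x) y i.castSucc.castSucc = _
    rw [Fin.snoc_castSucc, Fin.snoc_castSucc]
  have h2 : extendTuple e x y ⟨2 * k + 1, by omega⟩ = x := by
    change Fin.snoc (α := fun _ ↦ V) (Fin.snoc (α := fun _ ↦ V) e x) y
      (Fin.last (2 * k + 1)).castSucc = _
    rw [Fin.snoc_castSucc, Fin.snoc_last]
  have h3 : extendTuple e x y ⟨2 * k + 2, by omega⟩ = y :=
    Fin.snoc_last (α := fun _ ↦ V) y (Fin.snoc (α := fun _ ↦ V) e x)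
  rw [wedgePow_succ h2 h3 ha (fun i ↦ by rw [h1]; exact hb i)]
  simp only [h1]

theorem linearIndependent_extendTuple {k : ℕ} {e : Fin (2 * k + 1) → V} {x y : V}
    (he : LinearIndependent ℝ e) (hx : x ∉ Submodule.span ℝ (range e))
    (hy : y ∉ Submodule.span ℝ (insert x (range e))) :
    LinearIndependent ℝ (extendTuple e x y) := by
  refine linearIndependent_finSnoc.2 ⟨linearIndependent_finSnoc.2 ⟨he, hx⟩, ?_⟩
  rwa [Fin.range_snoc]

theorem wedgePow_comp (k : ℕ) (a : V →L[ℝ] ℝ) (b : V [⋀^Fin 2]→L[ℝ] ℝ) (l : W →L[ℝ] V)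
    (v : Fin (2 * k + 1) → W) : wedgePow k (a.comp l) (b.compContinuousLinearMap l) v =
      wedgePow k a b (fun i ↦ l (v i)) := by
  simp only [wedgePow]
  congr 1
  refine Finset.sum_congr rfl fun σ _ ↦ ?_
  congr 2
  refine Finset.prod_congr rfl fun i _ ↦ ?_
  change b _ = _
  congr 1
  funext j
  fin_cases j <;> rfl

theorem wedgePow_pullback (k : ℕ) {a : V → V →L[ℝ] ℝ} {a' : W → W →L[ℝ] ℝ} {g : W → V} {y : W}
    (ha : DifferentiableAt ℝ a (g y)) (hg : ContDiffAt ℝ ∞ g y)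
    (h : a' =ᶠ[𝓝 y] fun y ↦ (a (g y)).comp (fderiv ℝ g y)) (v : Fin (2 * k + 1) → W) :
    wedgePow k (a' y) (extD a' y) v =
      wedgePow k (a (g y)) (extD a (g y)) (fun i ↦ fderiv ℝ g y (v i)) := by
  rw [extD_congr h, h.eq_of_nhds, extD_pullback ha hg, wedgePow_comp]

end Wedge

variable {E : Type*} [NormedAddCommGroup E] [NormedSpace ℝ E] {H : Type*} [TopologicalSpace H]
  {I : ModelWithCorners ℝ E H} {M : Type*} [TopologicalSpace M] [ChartedSpace H M]
  [IsManifold I ∞ M] [I.Boundaryless]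
  {F : Type*} [NormedAddCommGroup F] [NormedSpace ℝ F]

/-- The right inverse `e` makes the derivative of `κ` surjective, so the vectors detecting
nondegeneracy can be lifted. -/
theorem exists_localForm_wedgePow_ne_zero {V : Type*} [NormedAddCommGroup V] [NormedSpace ℝ V]
    {α : OneForm I M} (hα : IsSmoothForm I α) {n : ℕ}
    (hw : ∀ q, ∃ v : Fin (2 * n + 1) → TangentSpace I q,
      wedgePow n (α q) (extDerivForm I α q) v ≠ 0) {κ : V → M} {e : M → V} {y : V}
    (hκ : ContMDiffAt 𝓘(ℝ, V) I ∞ κ y) (he : MDifferentiableAt I 𝓘(ℝ, V) e (κ y))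
    (hey : e (κ y) = y) (h : ∀ᶠ m in 𝓝 (κ y), κ (e m) = m) :
    ∃ u : Fin (2 * n + 1) → V,
      wedgePow n (localForm I κ α y) (extD (localForm I κ α) y) u ≠ 0 := by
  obtain ⟨v, hv⟩ := hw (κ y)
  have h1 : (mfderiv 𝓘(ℝ, V) I κ y : V →L[ℝ] E).comp
      (mfderiv I 𝓘(ℝ, V) e (κ y) : E →L[ℝ] V) = ContinuousLinearMap.id ℝ E := by
    have h2 : MDifferentiableAt 𝓘(ℝ, V) I κ (e (κ y)) := by
      rw [hey]
      exact hκ.mdifferentiableAt (by simp)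
    have h3 := mfderiv_comp (κ y) h2 he
    have h4 : (mfderiv I I (κ ∘ e) (κ y) : E →L[ℝ] E) = ContinuousLinearMap.id ℝ E := by
      have h5 : κ ∘ e =ᶠ[𝓝 (κ y)] id := h
      have h6 : (mfderiv I I (κ ∘ e) (κ y) : E →L[ℝ] E) = mfderiv I I (id : M → M) (κ y) :=
        h5.mfderiv_eq
      rw [h6]
      exact mfderiv_id
    have h5 : ∀ z, z = y → (mfderiv 𝓘(ℝ, V) I κ z : V →L[ℝ] E) = mfderiv 𝓘(ℝ, V) I κ y :=
      fun z hz ↦ by rw [hz]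
    rw [← h4, ← h5 _ hey]
    exact h3.symm
  obtain ⟨u, hu⟩ : ∃ u : Fin (2 * n + 1) → V, ∀ i, mfderiv 𝓘(ℝ, V) I κ y (u i) = v i :=
    ⟨fun i ↦ (mfderiv I 𝓘(ℝ, V) e (κ y) : E →L[ℝ] V) (v i),
      fun i ↦ congrArg (fun l : E →L[ℝ] E ↦ l (v i)) h1⟩
  refine ⟨u, ?_⟩
  rw [wedgePow_localForm hα hκ]
  convert hv using 2
  funext i
  exact hu i

namespace Slice

variable {A : HamAction I M} (T : Slice A F)

/-- The reduced form is a contact form. -/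
theorem exists_wedgePow_κ₀_ne_zero [FiniteDimensional ℝ F] {k : ℕ}
    (hF : Module.finrank ℝ F = 2 * k + 1)
    (hw : ∀ q, ∃ v : Fin (2 * (k + 1) + 1) → TangentSpace I q,
      wedgePow (k + 1) (A.form q) (extDerivForm I A.form q) v ≠ 0) {b : F} (hb : b ∈ T.target₀) :
    ∃ u : Fin (2 * k + 1) → F,
      wedgePow k (localForm I T.κ₀ A.form b) (extD (localForm I T.κ₀ A.form) b) u ≠ 0 := by
  -- Coordinates $(t,s,b)$: angle, value of the moment map, invariant coordinate.
  set K : ℝ × (ℝ × F) → M := fun p ↦ A.act (Circle.exp p.1) (T.κ p.2) with hK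
  have hbt : ((0 : ℝ), b) ∈ T.target := hb
  have hKs : ContMDiffAt 𝓘(ℝ, ℝ × (ℝ × F)) I ∞ K (0, (0, b)) := by
    have h1 : ContMDiffAt 𝓘(ℝ, ℝ × (ℝ × F)) (𝓘(ℝ, ℝ).prod I) ∞
        (fun p : ℝ × (ℝ × F) ↦ (p.1, T.κ p.2)) (0, (0, b)) := by
      refine ContMDiffAt.prodMk contDiffAt_fst.contMDiffAt ?_
      exact ContMDiffAt.comp (0, (0, b)) (g := T.κ) (T.contMDiffAt_κ hbt) contDiffAt_snd.contMDiffAt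
    exact ContMDiffAt.comp (0, (0, b)) A.contMDiff_act.contMDiffAt h1
  have hK0 : K (0, (0, b)) = T.κ₀ b := by
    simp only [hK, Circle.exp_zero, A.act_one]
    rfl
  have hmem := T.κ₀_mem hb
  have hang : T.ang (T.κ₀ b) = 1 := T.ang_κ _ hb
  set e : M → ℝ × (ℝ × F) := fun m ↦ (Complex.arg (T.ang m : ℂ), (A.Ψ m, T.w m)) with he
  have hes : ContMDiffAt I 𝓘(ℝ, ℝ × (ℝ × F)) ∞ e (T.κ₀ b) := by
    refine ContMDiffAt.prodMk_space ?_
      (ContMDiffAt.prodMk_space A.contMDiff_Ψ.contMDiffAt (T.contMDiffAt_w hmem))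
    refine ContMDiffAt.comp _ (g := Complex.arg) (contDiffAt_arg ?_).contMDiffAt
      (T.contMDiffAt_ang hmem)
    rw [hang]
    exact Complex.one_mem_slitPlane
  have hKe : ∀ m ∈ T.source, K (e m) = m := by
    intro m hm
    simp only [hK, he, Circle.exp_arg, T.act_ang m hm]
  obtain ⟨u, hu⟩ := exists_localForm_wedgePow_ne_zero A.smooth_form hw hKs (e := e)
    (by rw [hK0]; exact hes.mdifferentiableAt (by simp))
    (by
      rw [hK0]
      simp only [he, hang, T.Ψ_κ₀ hb, T.w_κ₀ hb]
      simp)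
    (by
      rw [hK0]
      filter_upwards [T.isOpen_source.mem_nhds hmem] with m hm using hKe m hm)
  let B := Module.finBasisOfFinrankEq ℝ F hF
  set x : ℝ × (ℝ × F) := (1, 0) with hx
  set y : ℝ × (ℝ × F) := (0, (1, 0)) with hy
  set v : Fin (2 * k + 1) → ℝ × (ℝ × F) := fun i ↦ (0, (0, B i)) with hv
  have hspan : ∀ z ∈ Submodule.span ℝ (insert x (range v)), z.2.1 = 0 := by
    intro z hz
    have : Submodule.span ℝ (insert x (range v)) ≤ LinearMap.ker
        ((LinearMap.fst ℝ ℝ F).comp (LinearMap.snd ℝ ℝ (ℝ × F))) := by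
      rw [Submodule.span_le]
      rintro _ (rfl | ⟨i, rfl⟩) <;> simp [hx, hv]
    exact this hz
  have hspan' : ∀ z ∈ Submodule.span ℝ (range v), z.1 = 0 := by
    intro z hz
    have : Submodule.span ℝ (range v) ≤ LinearMap.ker (LinearMap.fst ℝ ℝ (ℝ × F)) := by
      rw [Submodule.span_le]
      rintro _ ⟨i, rfl⟩
      simp [hv]
    exact this hz
  have hli : LinearIndependent ℝ v := by
    refine B.linearIndependent.map' ((LinearMap.inr ℝ ℝ (ℝ × F)).comp (LinearMap.inr ℝ ℝ F)) ?_
    rw [LinearMap.ker_eq_bot]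
    intro a b h
    simpa using h
  have hli' : LinearIndependent ℝ (extendTuple v x y) := by
    refine linearIndependent_extendTuple hli (fun h ↦ ?_) (fun h ↦ ?_)
    · simpa [hx] using hspan' _ h
    · simpa [hy] using hspan _ h
  -- The contact volume is nonzero on the frame consisting of a basis of `F`, then $\partial_t$,
  -- $\partial_s$.
  have h1 := wedgePow_ne_zero_of_linearIndependent (by simp [hF]; ring) hu hli'
  have hΨκ : A.Ψ ∘ T.κ =ᶠ[𝓝 (0, b)] Prod.fst := by
    filter_upwards [T.isOpen_target.mem_nhds hbt] with z hz using T.Ψ_κ z hz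
  -- In these coordinates $dA(\partial_t,\cdot)=-ds$, which vanishes on `F`; also $A(\partial_t)=0$
  -- on the zero level. These are the hypotheses of the contraction formula.
  have hdx : ∀ w : ℝ × (ℝ × F), extD (localForm I K A.form) (0, (0, b)) ![x, w] = -w.2.1 := by
    intro w
    rw [A.extD_localForm_exp (T.contMDiffAt_κ hbt), hΨκ.fderiv_eq, fderiv_fst]
    rfl
  rw [wedgePow_extendTuple ?_ ?_] at h1
  · refine ⟨B, ?_⟩
    have h2 := right_ne_zero_of_mul h1
    have hj : HasFDerivAt (fun w : F ↦ ((0 : ℝ), ((0 : ℝ), w)))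
        ((ContinuousLinearMap.inr ℝ ℝ (ℝ × F)).comp (ContinuousLinearMap.inr ℝ ℝ F)) b :=
      ((ContinuousLinearMap.inr ℝ ℝ (ℝ × F)).comp (ContinuousLinearMap.inr ℝ ℝ F)).hasFDerivAt
    rw [wedgePow_pullback k (a := localForm I K A.form)
      (g := fun w : F ↦ ((0 : ℝ), ((0 : ℝ), w)))
      ((contDiffAt_localForm A.smooth_form hKs).differentiableAt (by simp)) (by fun_prop) ?_,
      hj.fderiv]
    · exact h2
    · have h3 : T.κ₀ = K ∘ fun w : F ↦ ((0 : ℝ), ((0 : ℝ), w)) := by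
        funext w
        simp only [hK, Function.comp, Circle.exp_zero, A.act_one]
        rfl
      have h4 : ∀ᶠ w in 𝓝 b, w ∈ T.target₀ := T.isOpen_target₀.mem_nhds hb
      filter_upwards [h4] with w hw
      rw [h3]
      refine localForm_comp A.form ?_ (by fun_prop)
      have hwt : ((0 : ℝ), w) ∈ T.target := hw
      have h5 : MDifferentiableAt 𝓘(ℝ, ℝ × (ℝ × F)) (𝓘(ℝ, ℝ).prod I)
          (fun p : ℝ × (ℝ × F) ↦ (p.1, T.κ p.2)) (0, (0, w)) := by
        refine MDifferentiableAt.prodMk differentiableAt_fst.mdifferentiableAt ?_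
        exact MDifferentiableAt.comp (0, (0, w)) (g := T.κ)
          ((T.contMDiffAt_κ hwt).mdifferentiableAt (by simp)) differentiableAt_snd.mdifferentiableAt
      exact MDifferentiableAt.comp (0, (0, w)) (A.contMDiff_act.mdifferentiable (by simp) _) h5
  · rw [A.localForm_exp ((T.contMDiffAt_κ hbt).mdifferentiableAt (by simp)), T.Ψ_κ _ hbt]
    simp [hx]
  · intro i
    rw [hdx]
    simp [hv]

/-- The form of the cut is a contact form at the points of the reduced space. -/
theorem exists_wedgePow_extended_ne_zero {k : ℕ} {b : F} (hb : b ∈ T.target₀)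
    {u : Fin (2 * k + 1) → F}
    (hu : wedgePow k (localForm I T.κ₀ A.form b) (extD (localForm I T.κ₀ A.form) b) u ≠ 0)
    {c : F × ℂ → F × ℂ →L[ℝ] ℝ}
    (hc : c =ᶠ[𝓝 (b, 0)] fun v ↦ localForm I (fun v : F × ℂ ↦ T.κ (‖v.2‖ ^ 2, v.1)) A.form v +
      (planeCLM v.2).comp (ContinuousLinearMap.snd ℝ F ℂ)) :
    ∃ v : Fin (2 * (k + 1) + 1) → F × ℂ,
      wedgePow (k + 1) (c (b, 0)) (extD c (b, 0)) v ≠ 0 := by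
  have hbt : ((0 : ℝ), b) ∈ T.target := hb
  set g : F × ℂ → ℝ × F := fun v ↦ (‖v.2‖ ^ 2, v.1) with hg
  have hgs : ContDiff ℝ ∞ g := (contDiff_normSq.comp contDiff_snd).prodMk contDiff_fst
  have hg0 : g (b, 0) = (0, b) := by simp [hg]
  -- $|z|^2$ has zero derivative at $z=0$, so to first order the height in the slice stays $0$.
  have hgd : fderiv ℝ g (b, 0) = (0 : F × ℂ →L[ℝ] ℝ).prod (ContinuousLinearMap.fst ℝ F ℂ) := by
    have h1 : HasFDerivAt (fun z : ℂ ↦ ‖z‖ ^ 2) (0 : ℂ →L[ℝ] ℝ) 0 := by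
      have := (hasStrictFDerivAt_norm_sq (0 : ℂ)).hasFDerivAt
      simpa using this
    have h2 : HasFDerivAt (fun v : F × ℂ ↦ ‖v.2‖ ^ 2) (0 : F × ℂ →L[ℝ] ℝ) (b, 0) := by
      have := HasFDerivAt.comp (b, (0 : ℂ)) (f := Prod.snd) h1 hasFDerivAt_snd
      rw [ContinuousLinearMap.zero_comp] at this
      exact this
    exact (h2.prodMk hasFDerivAt_fst).fderiv
  set c₁ : F × ℂ → F × ℂ →L[ℝ] ℝ := fun v ↦ (localForm I T.κ A.form (g v)).comp (fderiv ℝ g v)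
    with hc₁
  set c₂ : F × ℂ → F × ℂ →L[ℝ] ℝ := fun v ↦
    (planeCLM v.2).comp (ContinuousLinearMap.snd ℝ F ℂ) with hc₂
  have hT : ∀ᶠ v in 𝓝 (b, (0 : ℂ)), g v ∈ T.target :=
    hgs.continuous.continuousAt.eventually_mem (by rw [hg0]; exact T.isOpen_target.mem_nhds hbt)
  have hcc : c =ᶠ[𝓝 (b, 0)] fun v ↦ c₁ v + c₂ v := by
    filter_upwards [hc, hT] with v hv hvT
    rw [hv]
    congr 1
    exact localForm_comp A.form (κ := T.κ) (g := g)
      ((T.contMDiffAt_κ hvT).mdifferentiableAt (by simp)) (hgs.differentiable (by simp) v)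
  have hκd : ContDiffAt ℝ ∞ (localForm I T.κ A.form) (g (b, 0)) := by
    rw [hg0]
    exact contDiffAt_localForm A.smooth_form (T.contMDiffAt_κ hbt)
  have hc₁d : DifferentiableAt ℝ c₁ (b, 0) :=
    (((hκd.comp (b, (0 : ℂ)) hgs.contDiffAt).clm_comp
      (hgs.contDiffAt.fderiv_right (m := ∞) (by simp))).differentiableAt (by simp))
  have hc₂f : HasFDerivAt c₂ (((ContinuousLinearMap.compL ℝ (F × ℂ) ℂ ℝ).flip
      (ContinuousLinearMap.snd ℝ F ℂ)).comp (planeCLM.comp (ContinuousLinearMap.snd ℝ F ℂ)))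
      (b, 0) :=
    (((ContinuousLinearMap.compL ℝ (F × ℂ) ℂ ℝ).flip
      (ContinuousLinearMap.snd ℝ F ℂ)).comp
      (planeCLM.comp (ContinuousLinearMap.snd ℝ F ℂ))).hasFDerivAt
  have hcd : DifferentiableAt ℝ c (b, 0) :=
    (hc₁d.add hc₂f.differentiableAt).congr_of_eventuallyEq hcc
  -- At $z=0$ the exterior derivative is $d\alpha_0+2\,dx\wedge dy$ with no mixed terms.
  have hext : ∀ v w : F × ℂ, extD c (b, 0) ![v, w] =
      extD (localForm I T.κ A.form) (0, b) ![((0 : ℝ), v.1), (0, w.1)] +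
        2 * planeCLM v.2 w.2 := by
    intro v w
    rw [extD_congr hcc, extD_add hc₁d hc₂f.differentiableAt]
    change extD c₁ (b, 0) ![v, w] + extD c₂ (b, 0) ![v, w] = _
    rw [extD_apply hc₂f.differentiableAt, hc₂f.fderiv,
      extD_pullback (hκd.differentiableAt (by simp)) hgs.contDiffAt]
    congr 1
    · rw [hgd, hg0]
      change extD _ _ _ = extD _ _ _
      congr 1
      funext i
      fin_cases i <;> rfl
    · simp [planeCLM_apply]
      ring
  have hca : ∀ v : F × ℂ, c (b, 0) v = localForm I T.κ A.form (0, b) (0, v.1) := by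
    intro v
    rw [hcc.eq_of_nhds]
    simp only [hc₁, hc₂]
    rw [hgd, hg0]
    simp
  have hz : ∀ w, extD (localForm I T.κ A.form) (0, b) ![((0 : ℝ), (0 : F)), w] = 0 :=
    fun w ↦ ContinuousAlternatingMap.map_coord_zero _ (0 : Fin 2) rfl
  -- A frame detecting $\alpha_0\wedge(d\alpha_0)^k$, extended by $\partial_x$ and $\partial_y$.
  refine ⟨extendTuple (fun i ↦ (u i, 0)) (0, 1) (0, Complex.I), ?_⟩
  rw [wedgePow_extendTuple ?_ ?_]
  · refine mul_ne_zero (mul_ne_zero (by positivity) ?_) ?_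
    · rw [hext, hz]
      simp [planeCLM_apply]
    · have hj : fderiv ℝ (fun w : F ↦ (w, (0 : ℂ))) b = ContinuousLinearMap.inl ℝ F ℂ :=
        (ContinuousLinearMap.inl ℝ F ℂ).hasFDerivAt.fderiv
      rw [wedgePow_pullback k (a := c) (g := fun w : F ↦ (w, (0 : ℂ))) hcd (by fun_prop) ?_,
        hj] at hu
      · exact hu
      · have h1 : ContinuousAt (fun w : F ↦ (w, (0 : ℂ))) b := by fun_prop
        filter_upwards [h1.eventually hcc, T.isOpen_target₀.mem_nhds hb] with w hw hwT
        have hj : HasFDerivAt (fun w : F ↦ (w, (0 : ℂ))) (ContinuousLinearMap.inl ℝ F ℂ) w :=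
          (ContinuousLinearMap.inl ℝ F ℂ).hasFDerivAt
        have hwt : g (w, 0) ∈ T.target := by
          have : g (w, 0) = (0, w) := by simp [hg]
          rw [this]
          exact hwT
        have h2 : T.κ₀ = (T.κ ∘ g) ∘ fun w : F ↦ (w, (0 : ℂ)) := by
          funext w
          simp [κ₀, hg]
        have h3 : MDifferentiableAt 𝓘(ℝ, ℝ × F) I T.κ (g (w, 0)) :=
          (T.contMDiffAt_κ hwt).mdifferentiableAt (by simp)
        have h4 : DifferentiableAt ℝ g (w, 0) := hgs.differentiable (by simp) _
        rw [hw, h2, localForm_comp A.form (κ := T.κ ∘ g) (g := fun w : F ↦ (w, (0 : ℂ))) (y := w)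
          (MDifferentiableAt.comp (w, (0 : ℂ)) h3 h4.mdifferentiableAt) hj.differentiableAt,
          localForm_comp A.form h3 h4, hj.fderiv]
        ext z
        simp [hc₁, hc₂]
  · rw [hca]
    exact map_zero _
  · intro i
    rw [hext, hz]
    simp

end Slice

end ContactCut

end

/-! ### The contact condition on the quotients -/

noncomputable section

namespace ContactCut

open Filter Topology

variable {E : Type*} [NormedAddCommGroup E] [NormedSpace ℝ E] {H : Type*} [TopologicalSpace H]
  {I : ModelWithCorners ℝ E H} {M : Type*} [TopologicalSpace M] [ChartedSpace H M]
  [IsManifold I ∞ M] {A : HamAction I M}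
  {F : Type*} [NormedAddCommGroup F] [NormedSpace ℝ F]

namespace Reduction

variable {Z : Set M} {Q : Type*} [TopologicalSpace Q]

/-- The reduced form is a contact form if it is one in slices. -/
theorem exists_wedgePow_form_ne_zero [I.Boundaryless] (R : Reduction A Z Q) [ChartedSpace F Q]
    [IsManifold 𝓘(ℝ, F) ∞ Q] (hcov : ∀ z ∈ Z, ∃ T : Slice A F, z ∈ T.source)
    (hat : ∀ (T : Slice A F) (z₀ : Z), R.chart T z₀ ∈ IsManifold.maximalAtlas 𝓘(ℝ, F) ∞ Q)
    {n : ℕ} (h : ∀ z ∈ Z, ∃ T : Slice A F, z ∈ T.source ∧ ∃ u : Fin (2 * n + 1) → F,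
      wedgePow n (localForm I T.κ₀ A.form (T.w z)) (extD (localForm I T.κ₀ A.form) (T.w z)) u ≠ 0)
    (x : Q) : ∃ v : Fin (2 * n + 1) → TangentSpace 𝓘(ℝ, F) x,
      wedgePow n (R.form hcov x) (extDerivForm 𝓘(ℝ, F) (R.form hcov) x) v ≠ 0 := by
  obtain ⟨z, rfl⟩ := R.surjective_q x
  obtain ⟨T, hT, u, hu⟩ := h z z.2
  have hb : T.w z ∈ T.target₀ := T.w_mem hT (R.Ψ_eq_zero z)
  have hx : R.q z = (R.chart T z).symm (T.w z) := by
    rw [R.chart_symm T z hb, R.q_pt_w T hT]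
  rw [hx]
  have h1 : localForm 𝓘(ℝ, F) (R.chart T z).symm (R.form hcov) =ᶠ[𝓝 (T.w z)]
      localForm I T.κ₀ A.form := by
    filter_upwards [T.isOpen_target₀.mem_nhds hb] with b hb
    exact R.localForm_chart_symm hcov hat T z hb
  refine exists_wedgePow_ne_zero_of_localForm (R.isSmoothForm_form hcov hat)
    (R.contMDiffAt_chart_symm hat T z hb) (u := u) ?_
  rw [extD_congr h1, h1.eq_of_nhds]
  exact hu

end Reduction

variable [I.Boundaryless]

theorem exists_slice_extended_wedgePow_ne_zero [FiniteDimensional ℝ F] {k : ℕ}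
    (hF : Module.finrank ℝ F = 2 * k + 1)
    (hw : ∀ q, ∃ v : Fin (2 * (k + 1) + 1) → TangentSpace I q,
      wedgePow (k + 1) (A.form q) (extDerivForm I A.form q) v ≠ 0)
    (L : (F × ℂ) ≃L[ℝ] E) {T : Slice A F} {m : M} (hm : m ∈ T.source) (h0 : A.Ψ m = 0) :
    ∃ u : Fin (2 * (k + 1) + 1) → E,
      wedgePow (k + 1) (localForm (I.prod 𝓘(ℝ, ℂ)) (T.extended L).κ₀ A.extended.form
        ((T.extended L).w (m, 0)))
        (extD (localForm (I.prod 𝓘(ℝ, ℂ)) (T.extended L).κ₀ A.extended.form)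
          ((T.extended L).w (m, 0))) u ≠ 0 := by
  have hb : T.w m ∈ T.target₀ := T.w_mem hm h0
  have hbw : (T.extended L).w (m, 0) = L (T.w m, 0) := by
    rw [Slice.extended_w, mul_zero]
  have hbt : ((0 : ℝ), T.w m) ∈ T.target := hb
  have hb' : L (T.w m, 0) ∈ (T.extended L).target₀ := by
    rw [Slice.mem_extended_target₀, L.symm_apply_apply]
    simpa using hbt
  set a := localForm (I.prod 𝓘(ℝ, ℂ)) (T.extended L).κ₀ A.extended.form with ha
  obtain ⟨u, hu⟩ := T.exists_wedgePow_κ₀_ne_zero hF hw hb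
  have hLc : ContinuousAt L (T.w m, (0 : ℂ)) := L.continuous.continuousAt
  obtain ⟨v, hv⟩ := T.exists_wedgePow_extended_ne_zero hb hu
    (c := fun v ↦ (a (L v)).comp (fderiv ℝ L v)) (by
      filter_upwards [hLc.eventually_mem ((T.extended L).isOpen_target₀.mem_nhds hb')] with v hv
      have hv' := (T.mem_extended_target₀ L).1 hv
      have h1 : ContDiff ℝ ∞ (fun b : E ↦ (L.symm b).2) := contDiff_snd.comp L.symm.contDiff
      have h2 : ContDiff ℝ ∞ (fun b : E ↦ (L.symm b).1) := contDiff_fst.comp L.symm.contDiff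
      have h3 : DifferentiableAt ℝ (fun b : E ↦ (‖(L.symm b).2‖ ^ 2, (L.symm b).1)) (L v) :=
        (((Slice.contDiff_normSq.comp h1).prodMk h2).differentiable (by simp)) _
      rw [ha, localForm_extended_κ₀ hv, ContinuousLinearMap.add_comp, L.symm_apply_apply,
        ← localForm_comp (κ := fun b : E ↦ T.κ (‖(L.symm b).2‖ ^ 2, (L.symm b).1)) A.form
          (MDifferentiableAt.comp (L v) (g := T.κ)
            ((T.contMDiffAt_κ hv').mdifferentiableAt (by simp)) h3.mdifferentiableAt)
          L.differentiableAt, L.fderiv]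
      congr 1
      · congr 1
        funext v
        simp
      · ext w <;> simp)
  refine ⟨fun i ↦ fderiv ℝ L (T.w m, (0 : ℂ)) (v i), ?_⟩
  rw [wedgePow_pullback (k + 1) (a := a) (g := L)
    ((contDiffAt_localForm A.extended.smooth_form
      ((T.extended L).contMDiffAt_κ₀ hb')).differentiableAt (by simp)) L.contDiff.contDiffAt
    (Eventually.of_forall fun _ ↦ rfl)] at hv
  rw [hbw]
  exact hv

theorem exists_wedgePow_ofChart_ne_zero {n : ℕ}
    (hw : ∀ q, ∃ v : Fin (2 * n + 1) → TangentSpace I q,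
      wedgePow n (A.form q) (extDerivForm I A.form q) v ≠ 0) {p : M} {b : E}
    (hb : b ∈ (Slice.ofChart A p).target₀) :
    ∃ u : Fin (2 * n + 1) → E,
      wedgePow n (localForm (I.prod 𝓘(ℝ, ℂ)) (Slice.ofChart A p).κ₀ A.extended.form b)
        (extD (localForm (I.prod 𝓘(ℝ, ℂ)) (Slice.ofChart A p).κ₀ A.extended.form) b) u ≠ 0 := by
  have h1 : localForm (I.prod 𝓘(ℝ, ℂ)) (Slice.ofChart A p).κ₀ A.extended.form =ᶠ[𝓝 b]
      localForm I (extChartAt I p).symm A.form := by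
    filter_upwards [(Slice.ofChart A p).isOpen_target₀.mem_nhds hb] with b hb
    exact localForm_ofChart_κ₀ hb
  rw [extD_congr h1, h1.eq_of_nhds]
  exact exists_localForm_extChartAt_wedgePow_ne_zero A.smooth_form hw p
    (Slice.mem_ofChart_target₀.1 hb).1

/-- The slices of `M × ℂ` show that the form of the cut is a contact form. -/
theorem exists_slice_extendedLevel_wedgePow_ne_zero {n : ℕ}
    (hw : ∀ q, ∃ v : Fin (2 * n + 1) → TangentSpace I q,
      wedgePow n (A.form q) (extDerivForm I A.form q) v ≠ 0)
    (hcov : ∀ m, A.Ψ m = 0 → ∃ T : Slice A F, m ∈ T.source) [FiniteDimensional ℝ F]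
    (hL : ∀ m, A.Ψ m = 0 → Module.finrank ℝ F + 2 = 2 * n + 1 ∧ Nonempty ((F × ℂ) ≃L[ℝ] E)) :
    ∀ x ∈ extendedLevel A.Ψ, ∃ T : Slice A.extended E, x ∈ T.source ∧
      ∃ u : Fin (2 * n + 1) → E,
        wedgePow n (localForm (I.prod 𝓘(ℝ, ℂ)) T.κ₀ A.extended.form (T.w x))
          (extD (localForm (I.prod 𝓘(ℝ, ℂ)) T.κ₀ A.extended.form) (T.w x)) u ≠ 0 := by
  rintro ⟨m, z⟩ hx
  have hΨ : A.Ψ m = ‖z‖ ^ 2 := sub_eq_zero.1 hx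
  by_cases hz : z = 0
  · subst hz
    have h1 : A.Ψ m = 0 := by simpa using hΨ
    obtain ⟨T, hT⟩ := hcov m h1
    obtain ⟨hF, ⟨L⟩⟩ := hL m h1
    obtain ⟨k, rfl⟩ : ∃ k, n = k + 1 := ⟨n - 1, by omega⟩
    exact ⟨T.extended L, hT,
      exists_slice_extended_wedgePow_ne_zero (by omega) hw L hT h1⟩
  · have hs : (m, z) ∈ (Slice.ofChart A (A.act (phase z) m)).source :=
      ⟨hz, mem_extChartAt_source _⟩
    exact ⟨_, hs, exists_wedgePow_ofChart_ne_zero hw (Slice.w_mem _ hs hx)⟩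

end ContactCut

end

/-! ### The reduced space inside the cut -/

noncomputable section

namespace ContactCut

open Filter Topology

variable {E : Type*} [NormedAddCommGroup E] [NormedSpace ℝ E] {H : Type*} [TopologicalSpace H]
  {I : ModelWithCorners ℝ E H} {M : Type*} [TopologicalSpace M] [ChartedSpace H M]
  [IsManifold I ∞ M] {A : HamAction I M}
  {F : Type*} [NormedAddCommGroup F] [NormedSpace ℝ F]

/-- For closed maps: a closed set of orbits corresponds to a closed saturated subset of $f^{-1}(0)$,
which is also closed and saturated in $\{f\ge 0\}$, hence has closed image in the cut. -/
theorem isClosedEmbedding_reducedToCut [MulAction Circle M] {f : M → ℝ} (hf : Continuous f) :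
    IsClosedEmbedding (reducedToCut f) := by
  have hc : Continuous (reducedToCut f) := by
    refine Continuous.quotient_lift (s := levelSetoid f)
      (f := fun m : {m : M | f m = 0} ↦ Cut.mk f m (le_of_eq m.2.symm)) ?_ _
    exact continuous_quotient_mk'.comp (continuous_subtype_val.subtype_mk _)
  have hinj : Function.Injective (reducedToCut f) := by
    rintro ⟨m⟩ ⟨m'⟩ h
    refine Quotient.sound (s := levelSetoid f) ?_
    rcases (cut_mk_eq_iff _ _).1 h with h | ⟨_, _, h⟩
    · exact ⟨1, by rw [h, one_smul]⟩
    · exact h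
  refine IsClosedEmbedding.of_continuous_injective_isClosedMap hc hinj fun C hC ↦ ?_
  have hq : IsQuotientMap (Quotient.mk (cutSetoid f)) := isQuotientMap_quotient_mk'
  refine hq.isClosed_preimage.1 ?_
  have h1 : IsClosed (ReducedSpace.mk f ⁻¹' C) := hC.preimage continuous_quotient_mk'
  have hZ : IsClosed {m : M | f m = 0} := isClosed_eq hf continuous_const
  have h2 := (hZ.isClosedEmbedding_subtypeVal.isClosedMap _ h1).preimage
    (continuous_subtype_val : Continuous (Subtype.val : {m : M // 0 ≤ f m} → M))
  convert h2 using 1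
  ext x
  constructor
  · rintro ⟨⟨m⟩, hm, h⟩
    have h3 : Cut.mk f m (le_of_eq m.2.symm) = Cut.mk f x x.2 := h
    rcases (cut_mk_eq_iff _ _).1 h3 with h4 | ⟨_, h5, c, h4⟩
    · exact ⟨m, hm, h4⟩
    · refine ⟨⟨x, h5⟩, ?_, rfl⟩
      have h6 : ReducedSpace.mk f ⟨x, h5⟩ = ReducedSpace.mk f m :=
        Quotient.sound (s := levelSetoid f) ⟨c⁻¹, by rw [h4, inv_smul_smul]⟩
      rw [mem_preimage, h6]
      exact hm
  · rintro ⟨m, hm, h⟩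
    exact ⟨ReducedSpace.mk f m, hm, cut_mk_congr _ h⟩

section Reduced

variable [I.Boundaryless] [MulAction Circle M] (hA : ∀ c m, A.act c m = c • m)

/-- The inclusion of the zero level set of the moment map of `M` in that of `M × ℂ`. -/
def zeroSection (z : {m | A.Ψ m = 0}) : extendedLevel A.Ψ :=
  ⟨(z, 0), by
    have : A.Ψ z = 0 := z.2
    simp [extendedLevel, this]⟩

theorem reducedToCut_q (z : {m | A.Ψ m = 0}) :
    reducedToCut A.Ψ ((reducedReduction A hA).q z) = (cutReduction hA).q (zeroSection z) :=
  (cutMap_of_eq_ofReal hA (zeroSection z) le_rfl (by simp [zeroSection])).symm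

omit [MulAction Circle M] in
theorem zeroSection_mem {T : Slice A F} (L : (F × ℂ) ≃L[ℝ] E) {z : {m | A.Ψ m = 0}}
    (hz : (z : M) ∈ T.source) : (zeroSection z : M × ℂ) ∈ (T.extended L).source := hz

/-- In matching charts the natural map is $b\mapsto L(b,0)$; this yields the immersion, with
complement $\mathbb{C}$, and the comparison of forms. -/
theorem chart_reducedToCut_q {T : Slice A F} (L : (F × ℂ) ≃L[ℝ] E) (x₀ : extendedLevel A.Ψ)
    {z : {m | A.Ψ m = 0}} (hz : (z : M) ∈ T.source) :
    (cutReduction hA).chart (T.extended L) x₀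
      (reducedToCut A.Ψ ((reducedReduction A hA).q z)) = L (T.w z, 0) := by
  rw [reducedToCut_q, (cutReduction hA).chart_q _ _ (zeroSection_mem L hz), Slice.extended_w]
  simp [zeroSection]

theorem reducedToCut_q_mem {T : Slice A F} (L : (F × ℂ) ≃L[ℝ] E) (x₀ : extendedLevel A.Ψ)
    {z : {m | A.Ψ m = 0}} (hz : (z : M) ∈ T.source) :
    reducedToCut A.Ψ ((reducedReduction A hA).q z) ∈
      ((cutReduction hA).chart (T.extended L) x₀).source := by
  rw [reducedToCut_q]
  exact ((cutReduction hA).mem_chart_source_iff _ _).2 (zeroSection_mem L hz)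

variable [ChartedSpace E (Cut A.Ψ)] [ChartedSpace F (ReducedSpace A.Ψ)]
  (hcovM : ∀ z ∈ {m | A.Ψ m = 0}, ∃ T : Slice A F, z ∈ T.source)
  (hatM : ∀ (T : Slice A F) (z₀ : {m | A.Ψ m = 0}), (reducedReduction A hA).chart T z₀ ∈
    IsManifold.maximalAtlas 𝓘(ℝ, F) ∞ (ReducedSpace A.Ψ))
  (hcovC : ∀ x ∈ extendedLevel A.Ψ, ∃ T : Slice A.extended E, x ∈ T.source)
  (hatC : ∀ (T : Slice A.extended E) (x₀ : extendedLevel A.Ψ), (cutReduction hA).chart T x₀ ∈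
    IsManifold.maximalAtlas 𝓘(ℝ, E) ∞ (Cut A.Ψ))
  (hL : ∀ m, A.Ψ m = 0 → Nonempty ((F × ℂ) ≃L[ℝ] E))

include hcovM hatM hatC hL

theorem isSmoothEmbedding_reducedToCut :
    Manifold.IsSmoothEmbedding 𝓘(ℝ, F) 𝓘(ℝ, E) ∞ (reducedToCut A.Ψ) := by
  have he := (isClosedEmbedding_reducedToCut A.contMDiff_Ψ.continuous).isEmbedding
  refine ⟨Manifold.IsImmersionOfComplement.isImmersion (F := ℂ) fun x ↦ ?_, he⟩
  obtain ⟨z, rfl⟩ := (reducedReduction A hA).surjective_q x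
  obtain ⟨T, hT⟩ := hcovM z z.2
  obtain ⟨L⟩ := hL z z.2
  refine Manifold.IsImmersionAtOfComplement.mk_of_continuousAt he.continuous.continuousAt
    L ((reducedReduction A hA).chart T z) ((cutReduction hA).chart (T.extended L) (zeroSection z))
    (((reducedReduction A hA).mem_chart_source_iff T z).2 hT) (reducedToCut_q_mem hA L _ hT)
    (hatM T z) (hatC _ _) ?_
  intro b hb
  have hb' : b ∈ T.target₀ :=
    show b ∈ ((reducedReduction A hA).chart T z).target by simpa using hb
  change (cutReduction hA).chart (T.extended L) (zeroSection z)
    (reducedToCut A.Ψ (((reducedReduction A hA).chart T z).symm b)) = L (b, 0)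
  rw [(reducedReduction A hA).chart_symm T z hb']
  refine (chart_reducedToCut_q hA L _ (T.κ₀_mem hb')).trans ?_
  congr 2
  exact T.w_κ₀ hb'

theorem pullback_reducedToCut : pullback 𝓘(ℝ, F) 𝓘(ℝ, E) (reducedToCut A.Ψ)
    ((cutReduction hA).form hcovC) = (reducedReduction A hA).form hcovM := by
  funext x
  obtain ⟨z, rfl⟩ := (reducedReduction A hA).surjective_q x
  obtain ⟨T, hT⟩ := hcovM z z.2
  obtain ⟨L⟩ := hL z z.2
  set x := (reducedReduction A hA).q z with hx
  set φ := (reducedReduction A hA).chart T z with hφ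
  set ψ := (cutReduction hA).chart (T.extended L) (zeroSection z) with hψ
  have hb : T.w z ∈ T.target₀ := T.w_mem hT z.2
  have hφx : φ x = T.w z := (reducedReduction A hA).chart_q T z hT
  have hxs : x ∈ φ.source := ((reducedReduction A hA).mem_chart_source_iff T z).2 hT
  set g : F → E := fun b ↦ L (b, 0) with hg
  have hgf : HasFDerivAt g ((L : F × ℂ →L[ℝ] E).comp (ContinuousLinearMap.inl ℝ F ℂ)) (φ x) :=
    ((L : F × ℂ →L[ℝ] E).comp (ContinuousLinearMap.inl ℝ F ℂ)).hasFDerivAt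
  have hgb : g (φ x) ∈ (T.extended L).target₀ := by
    have hbt : ((0 : ℝ), T.w z) ∈ T.target := hb
    rw [Slice.mem_extended_target₀, hφx]
    simpa [hg] using hbt
  have hφm : MDifferentiableAt 𝓘(ℝ, F) 𝓘(ℝ, F) φ x :=
    ((reducedReduction A hA).contMDiffAt_chart hatM T z hT).mdifferentiableAt (by simp)
  have hφsm : MDifferentiableAt 𝓘(ℝ, F) 𝓘(ℝ, F) φ.symm (φ x) := by
    rw [hφx]
    exact ((reducedReduction A hA).contMDiffAt_chart_symm hatM T z hb).mdifferentiableAt (by simp)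
  have hψsm : MDifferentiableAt 𝓘(ℝ, E) 𝓘(ℝ, E) ψ.symm (g (φ x)) :=
    ((cutReduction hA).contMDiffAt_chart_symm hatC _ _ hgb).mdifferentiableAt (by simp)
  have h1 : reducedToCut A.Ψ =ᶠ[𝓝 x] (ψ.symm ∘ g) ∘ φ := by
    filter_upwards [φ.open_source.mem_nhds hxs] with y hy
    obtain ⟨z', rfl⟩ := (reducedReduction A hA).surjective_q y
    have hz' : (z' : M) ∈ T.source := ((reducedReduction A hA).mem_chart_source_iff T z).1 hy
    have h2 := chart_reducedToCut_q hA L (zeroSection z) hz'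
    have h3 : φ ((reducedReduction A hA).q z') = T.w z' :=
      (reducedReduction A hA).chart_q T z hz'
    simp only [Function.comp, h3, hg]
    rw [← h2, ψ.left_inv (reducedToCut_q_mem hA L _ hz')]
  have h2 : (id : ReducedSpace A.Ψ → ReducedSpace A.Ψ) =ᶠ[𝓝 x] φ.symm ∘ φ := by
    filter_upwards [φ.open_source.mem_nhds hxs] with y hy using (φ.left_inv hy).symm
  have h3 : (reducedReduction A hA).form hcovM x =
      pullback 𝓘(ℝ, F) 𝓘(ℝ, F) id ((reducedReduction A hA).form hcovM) x := by
    ext v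
    rw [pullback_apply, mfderiv_id]
    rfl
  rw [h3, pullback_congr _ h1, pullback_congr _ h2,
    pullback_comp (ψ.symm ∘ g) φ _ (hψsm.comp _ hgf.differentiableAt.mdifferentiableAt) hφm,
    pullback_comp φ.symm φ _ hφsm hφm]
  congr 1
  change localForm 𝓘(ℝ, E) (ψ.symm ∘ g) _ (φ x) = localForm 𝓘(ℝ, F) φ.symm _ (φ x)
  rw [localForm_comp _ hψsm hgf.differentiableAt,
    (cutReduction hA).localForm_chart_symm hcovC hatC _ _ hgb,
    (reducedReduction A hA).localForm_chart_symm hcovM hatM T z (hφx ▸ hb),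
    ← localForm_comp (κ := (T.extended L).κ₀) A.extended.form
      (((T.extended L).contMDiffAt_κ₀ hgb).mdifferentiableAt (by simp)) hgf.differentiableAt]
  -- The locus $z=0$ of the extended slice is the slice of $M$, and there the plane form contributes
  -- nothing.
  have h4 : (T.extended L).κ₀ ∘ g = fun b ↦ (T.κ₀ b, (0 : ℂ)) := by
    funext b
    simp only [Function.comp, Slice.extended_κ₀, hg, L.symm_apply_apply, norm_zero]
    simp [Slice.κ₀]
  rw [h4]
  refine (localForm_extendedForm A.form (g := fun _ ↦ (0 : ℂ))
    ((T.contMDiffAt_κ₀ (hφx ▸ hb)).mdifferentiableAt (by simp))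
    (differentiableAt_const _)).trans ?_
  simp

end Reduced

end ContactCut

end

/-! ### The open part $\{f>0\}$ of the cut -/

noncomputable section

namespace ContactCut

open Filter Topology

variable {E : Type*} [NormedAddCommGroup E] [NormedSpace ℝ E] {H : Type*} [TopologicalSpace H]
  {I : ModelWithCorners ℝ E H} {M : Type*} [TopologicalSpace M] [ChartedSpace H M]
  [IsManifold I ∞ M] {A : HamAction I M} [I.Boundaryless] [MulAction Circle M]

variable (A) in
/-- The open set where the moment map is positive. -/
def positiveOpens : TopologicalSpace.Opens M :=
  ⟨{m | 0 < A.Ψ m}, isOpen_lt continuous_const A.contMDiff_Ψ.continuous⟩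

variable (A) in
/-- The complement of the reduced space in the cut. -/
def cutOpens : TopologicalSpace.Opens (Cut A.Ψ) :=
  ⟨(range (reducedToCut A.Ψ))ᶜ,
    (isClosedEmbedding_reducedToCut A.contMDiff_Ψ.continuous).isClosed_range.isOpen_compl⟩

theorem cut_mk_mem_cutOpens {m : M} (hm : 0 < A.Ψ m) : Cut.mk A.Ψ m hm.le ∈ cutOpens A := by
  rintro ⟨⟨m'⟩, h⟩
  have h' : A.Ψ m' = 0 := m'.2
  rcases (cut_mk_eq_iff (f := A.Ψ) (le_of_eq h'.symm) hm.le).1 h with h1 | ⟨_, h1, _⟩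
  · rw [← h1, h'] at hm
    exact hm.false
  · exact hm.ne' h1

/-- The bijection from `{Ψ > 0}` to the complement of the reduced space in the cut. -/
def positiveEquiv : positiveOpens A ≃ cutOpens A :=
  Equiv.ofBijective (fun m ↦ ⟨Cut.mk A.Ψ m (le_of_lt m.2), cut_mk_mem_cutOpens m.2⟩) (by
    constructor
    · intro m m' h
      have hm : 0 < A.Ψ m := m.2
      rcases (cut_mk_eq_iff (f := A.Ψ) hm.le (le_of_lt m'.2)).1 (congrArg Subtype.val h) with
        h | ⟨h, _⟩
      · exact Subtype.ext h
      · exact absurd h hm.ne'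
    · rintro ⟨⟨⟨m, hm⟩⟩, hv⟩
      refine ⟨⟨m, lt_of_le_of_ne hm fun h ↦ hv ⟨ReducedSpace.mk A.Ψ ⟨m, h.symm⟩, rfl⟩⟩, rfl⟩)

variable (hA : ∀ c m, A.act c m = c • m)

theorem cutReduction_q_sqrtSection (m : positiveOpens A) :
    (cutReduction hA).q (sqrtSection ⟨m, le_of_lt m.2⟩) = positiveEquiv m :=
  cutMap_sqrtSection hA _

omit [MulAction Circle M] in
theorem sqrtSection_mem_iff (p : M) (m : positiveOpens A) :
    (sqrtSection (A := A) ⟨m, le_of_lt m.2⟩ : M × ℂ) ∈ (Slice.ofChart A p).source ↔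
      (m : M) ∈ (extChartAt I p).source := by
  have hm : 0 < A.Ψ m := m.2
  rw [Slice.mem_ofChart_source]
  simp only [sqrtSection, phase_ofReal (Real.sqrt_nonneg _), A.act_one]
  simp [(Real.sqrt_pos.2 hm).ne']

theorem positiveEquiv_mem_iff (p : M) (x₀ : extendedLevel A.Ψ) (m : positiveOpens A) :
    (positiveEquiv m : Cut A.Ψ) ∈ ((cutReduction hA).chart (Slice.ofChart A p) x₀).source ↔
      (m : M) ∈ (extChartAt I p).source := by
  rw [← cutReduction_q_sqrtSection hA, (cutReduction hA).mem_chart_source_iff,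
    sqrtSection_mem_iff]

/-- The section $z=\sqrt{f}$ has phase $1$, so the class of `m` has the same coordinates in the cut
as `m` has in $M$. -/
theorem chart_positiveEquiv (p : M) (x₀ : extendedLevel A.Ψ) {m : positiveOpens A}
    (hm : (m : M) ∈ (extChartAt I p).source) :
    (cutReduction hA).chart (Slice.ofChart A p) x₀ (positiveEquiv m : Cut A.Ψ) =
      extChartAt I p m := by
  rw [← cutReduction_q_sqrtSection hA,
    (cutReduction hA).chart_q _ _ ((sqrtSection_mem_iff p m).2 hm), Slice.ofChart_w]
  simp only [sqrtSection, phase_ofReal (Real.sqrt_nonneg _), A.act_one]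

theorem positiveEquiv_eventuallyEq (x₀ : extendedLevel A.Ψ) (m : positiveOpens A) :
    (fun m : positiveOpens A ↦ (positiveEquiv m : Cut A.Ψ)) =ᶠ[𝓝 m]
      (((cutReduction hA).chart (Slice.ofChart A m) x₀).symm ∘ extChartAt I (m : M)) ∘
        Subtype.val := by
  filter_upwards [((isOpen_extChartAt_source (I := I) (m : M)).preimage
    (continuous_subtype_val (p := (· ∈ positiveOpens A)))).mem_nhds
      (mem_extChartAt_source (I := I) (m : M))] with m' hm'
  simp only [Function.comp]
  rw [← chart_positiveEquiv hA m x₀ hm', OpenPartialHomeomorph.left_inv]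
  exact (positiveEquiv_mem_iff hA m x₀ m').2 hm'

variable [ChartedSpace E (Cut A.Ψ)]
  (hcov : ∀ x ∈ extendedLevel A.Ψ, ∃ T : Slice A.extended E, x ∈ T.source)
  (hat : ∀ (T : Slice A.extended E) (x₀ : extendedLevel A.Ψ), (cutReduction hA).chart T x₀ ∈
    IsManifold.maximalAtlas 𝓘(ℝ, E) ∞ (Cut A.Ψ))

omit [MulAction Circle M] in
theorem extChartAt_mem_ofChart_target₀ (m : positiveOpens A) :
    extChartAt I (m : M) m ∈ (Slice.ofChart A m).target₀ := by
  have hm : 0 < A.Ψ m := m.2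
  rw [Slice.mem_ofChart_target₀, extChartAt_to_inv]
  exact ⟨mem_extChartAt_target _, hm⟩

include hat in
theorem contMDiffAt_positiveChart (x₀ : extendedLevel A.Ψ) (m : positiveOpens A) :
    ContMDiffAt I 𝓘(ℝ, E) ∞
      (((cutReduction hA).chart (Slice.ofChart A m) x₀).symm ∘ extChartAt I (m : M)) m :=
  ContMDiffAt.comp (m : M) ((cutReduction hA).contMDiffAt_chart_symm hat _ x₀
    (extChartAt_mem_ofChart_target₀ m)) contMDiffAt_extChartAt

variable [IsManifold 𝓘(ℝ, E) ∞ (Cut A.Ψ)]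

/-- The diffeomorphism from `{Ψ > 0}` to the complement of the reduced space in the cut. -/
def positiveDiffeomorph : Diffeomorph I 𝓘(ℝ, E) (positiveOpens A) (cutOpens A) ∞ where
  toEquiv := positiveEquiv
  contMDiff_toFun := by
    intro m
    refine (ContMDiffAt.subtypeVal_comp_iff (cutOpens A) _ m).1 ?_
    refine ContMDiffAt.congr_of_eventuallyEq ?_
      (positiveEquiv_eventuallyEq hA (sqrtSection ⟨m, le_of_lt m.2⟩) m)
    exact ContMDiffAt.comp m (contMDiffAt_positiveChart hA hat _ m) (contMDiff_subtype_val m)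
  contMDiff_invFun := by
    intro v
    refine (ContMDiffAt.subtypeVal_comp_iff (positiveOpens A) _ v).1 ?_
    obtain ⟨m, rfl⟩ := (positiveEquiv (A := A)).surjective v
    have hm : (m : M) ∈ (extChartAt I (m : M)).source := mem_extChartAt_source _
    set x₀ := sqrtSection (A := A) ⟨m, le_of_lt m.2⟩ with hx₀
    set ψ := (cutReduction hA).chart (Slice.ofChart A (m : M)) x₀ with hψ
    have hψm : (positiveEquiv m : Cut A.Ψ) ∈ ψ.source := (positiveEquiv_mem_iff hA m x₀ m).2 hm
    have h1 : Subtype.val ∘ (positiveEquiv (A := A)).symm =ᶠ[𝓝 (positiveEquiv m)]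
        (extChartAt I (m : M)).symm ∘ (ψ ∘ Subtype.val) := by
      filter_upwards [(ψ.open_source.preimage continuous_subtype_val).mem_nhds hψm] with v hv
      obtain ⟨m', rfl⟩ := (positiveEquiv (A := A)).surjective v
      have hm' := (positiveEquiv_mem_iff hA m x₀ m').1 hv
      simp only [Function.comp, Equiv.symm_apply_apply]
      rw [hψ, chart_positiveEquiv hA m x₀ hm', (extChartAt I (m : M)).left_inv hm']
    refine ContMDiffAt.congr_of_eventuallyEq ?_ h1
    refine ContMDiffAt.comp _ (g := (extChartAt I (m : M)).symm) ?_
      (ContMDiffAt.comp _ (g := ψ) (contMDiffAt_of_mem_maximalAtlas (hat _ _) hψm)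
        (contMDiff_subtype_val _))
    simp only [Function.comp]
    rw [hψ, chart_positiveEquiv hA m x₀ hm]
    exact contMDiffAt_extChartAt_symm (m : M) (mem_extChartAt_target _)

omit [IsManifold 𝓘(ℝ, E) ∞ (Cut A.Ψ)] in
include hat in
-- The chart of the cut and the chart of $M$ carry the same local form by `localForm_ofChart_κ₀`;
-- composing with the chart of $M$ gives `A.form`.
theorem pullback_positiveEquiv :
    pullback I 𝓘(ℝ, E) (fun m : positiveOpens A ↦ (positiveEquiv m : Cut A.Ψ))
      ((cutReduction hA).form hcov) =
    pullback I I (fun m : positiveOpens A ↦ (m : M)) A.form := by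
  funext m
  set x₀ := sqrtSection (A := A) ⟨m, le_of_lt m.2⟩ with hx₀
  set ψ := (cutReduction hA).chart (Slice.ofChart A (m : M)) x₀ with hψ
  have hb := extChartAt_mem_ofChart_target₀ m
  have hc : MDifferentiableAt I 𝓘(ℝ, E) (extChartAt I (m : M)) m :=
    (contMDiffAt_extChartAt (n := ∞)).mdifferentiableAt (by simp)
  rw [pullback_congr _ (positiveEquiv_eventuallyEq hA x₀ m),
    pullback_comp (J := I) _ _ _
      ((contMDiffAt_positiveChart hA hat x₀ m).mdifferentiableAt (by simp))
      ((contMDiff_subtype_val (n := ∞) m).mdifferentiableAt (by simp))]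
  have h1 : pullback I 𝓘(ℝ, E) (ψ.symm ∘ extChartAt I (m : M)) ((cutReduction hA).form hcov) m =
      A.form m := by
    have h2 : (id : M → M) =ᶠ[𝓝 (m : M)] (extChartAt I (m : M)).symm ∘ extChartAt I (m : M) := by
      filter_upwards [extChartAt_source_mem_nhds (I := I) (m : M)] with y hy
      exact ((extChartAt I (m : M)).left_inv hy).symm
    have h3 : A.form m = pullback I I id A.form m := by
      ext v
      rw [pullback_apply, mfderiv_id]
      rfl
    rw [h3, pullback_congr _ h2, pullback_comp _ _ _ (((cutReduction hA).contMDiffAt_chart_symm hat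
        _ x₀ hb).mdifferentiableAt (by simp)) hc,
      pullback_comp _ _ _ ((contMDiffAt_extChartAt_symm (m : M)
        (mem_extChartAt_target _)).mdifferentiableAt (by simp)) hc]
    congr 1
    exact ((cutReduction hA).localForm_chart_symm hcov hat _ x₀ hb).trans
      (localForm_ofChart_κ₀ hb)
  rw [h1]
  rfl

end ContactCut

end

/-! ### Dimension bookkeeping and the theorem -/

noncomputable section

namespace ContactCut

open Filter Topology

/-- Covers an empty zero level, in particular $n=0$, where `n - 1` is truncated and the dimension
count of `Reduction.descendsTo` fails. -/
theorem descendsTo_of_isEmpty {E : Type*} [NormedAddCommGroup E] [NormedSpace ℝ E] {H : Type*}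
    [TopologicalSpace H] (I : ModelWithCorners ℝ E H) {N : Type*} [TopologicalSpace N]
    [ChartedSpace H N] (α : OneForm I N) (Z : Set N) [IsEmpty Z] {d : ℕ} {Q : Type*}
    [TopologicalSpace Q] [ChartedSpace (EuclideanSpace ℝ (Fin d)) Q] (q : Z → Q)
    (β : OneForm (𝓡 d) Q) : DescendsTo I α Z q β := by
  let C : ChartedSpace (EuclideanSpace ℝ (Fin (d + 1))) Z :=
    ChartedSpace.empty _ _
  refine ⟨C, inferInstance, ⟨?_, Topology.IsEmbedding.subtypeVal⟩, ?_, ?_⟩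
  · exact Manifold.IsImmersionOfComplement.isImmersion (F := ℝ) fun z ↦ isEmptyElim z
  · exact Manifold.IsSubmersionOfComplement.isSubmersion (F := ℝ) fun z ↦ isEmptyElim z
  · funext z
    exact isEmptyElim z

section Contact

variable {n : ℕ} {M : Type*} [TopologicalSpace M]
  [ChartedSpace (EuclideanSpace ℝ (Fin (2 * n + 1))) M] [IsManifold (𝓡 (2 * n + 1)) ∞ M]
  {A : HamAction (𝓡 (2 * n + 1)) M}
  (hw : ∀ q, ∃ v : Fin (2 * n + 1) → TangentSpace (𝓡 (2 * n + 1)) q,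
    wedgePow n (A.form q) (extDerivForm (𝓡 (2 * n + 1)) A.form q) v ≠ 0)

include hw

/-- In dimension one the generator spans the tangent line and $d\Psi$ kills it, which contradicts
regularity of `Ψ`. -/
theorem HamAction.pos_of_zero_level {m : M} (h0 : A.Ψ m = 0)
    (hm : ∀ c, A.act c m = m → c = 1) : 0 < n := by
  rcases Nat.eq_zero_or_pos n with rfl | hn
  · exfalso
    refine A.fderiv_Ψ_ne_zero m (n := 0) (by simp) hw h0 hm ?_
    ext v
    obtain ⟨c, hc⟩ := exists_smul_eq_of_finrank_eq_one (K := ℝ) (by simp) (A.gen_ne_zero m hm) v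
    rw [← hc, map_smul, A.fderiv_Ψ_gen]
    simp
  · exact hn

theorem HamAction.exists_slice_of_contact [T2Space M] {m : M} (h0 : A.Ψ m = 0)
    (hm : ∀ c, A.act c m = m → c = 1) :
    ∃ T : Slice A (EuclideanSpace ℝ (Fin (2 * (n - 1) + 1))), m ∈ T.source := by
  have hn := A.pos_of_zero_level hw h0 hm
  exact A.exists_slice (by simp; omega) m h0 hm (A.fderiv_Ψ_ne_zero m (by simp) hw h0 hm)

end Contact

end ContactCut

end

theorem mainTheorem3 (n : ℕ) {M : Type*} [TopologicalSpace M] [T2Space M]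
    [SecondCountableTopology M] [ChartedSpace (EuclideanSpace ℝ (Fin (2 * n + 1))) M]
    [IsManifold (𝓡 (2 * n + 1)) ∞ M]
    [MulAction Circle M] [ContMDiffSMul (𝓡 1) (𝓡 (2 * n + 1)) ∞ Circle M]
    (α : ContactCut.OneForm (𝓡 (2 * n + 1)) M) (hα : ContactCut.IsContactForm n α)
    (hinv : ContactCut.IsInvariantForm (𝓡 (2 * n + 1)) α)
    (f : M → ℝ) (hf : f = ContactCut.momentMap (𝓡 (2 * n + 1)) α)
    (hfree : ∀ m : M, f m = 0 → ∀ c : Circle, c • m = m → c = 1) :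
    -- the smooth structure and the contact form `β` of the cut
    ∃ (_ : ChartedSpace (EuclideanSpace ℝ (Fin (2 * n + 1))) (ContactCut.Cut f))
      (_ : IsManifold (𝓡 (2 * n + 1)) ∞ (ContactCut.Cut f))
      (β : ContactCut.OneForm (𝓡 (2 * n + 1)) (ContactCut.Cut f))
      -- the smooth structure and the contact form `α₀` of the reduced space
      (_ : ChartedSpace (EuclideanSpace ℝ (Fin (2 * (n - 1) + 1))) (ContactCut.ReducedSpace f))
      (_ : IsManifold (𝓡 (2 * (n - 1) + 1)) ∞ (ContactCut.ReducedSpace f))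
      (α₀ : ContactCut.OneForm (𝓡 (2 * (n - 1) + 1)) (ContactCut.ReducedSpace f)),
      -- the cut is a contact manifold
      T2Space (ContactCut.Cut f) ∧ SecondCountableTopology (ContactCut.Cut f) ∧
      ContactCut.IsContactForm n β ∧
      -- it is the contact quotient `Ψ⁻¹(0)/S¹` of `M × ℂ`, by means of `[m] ↦ [(m, √(f m))]`
      (∃ q : ContactCut.extendedLevel f → ContactCut.Cut f,
        (∀ p p' : ContactCut.extendedLevel f, q p = q p' ↔
          ∃ c : Circle, p.1.1 = c • p'.1.1 ∧ p.1.2 = ((c⁻¹ : Circle) : ℂ) * p'.1.2) ∧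
        (∀ (p : ContactCut.extendedLevel f) (hp : 0 ≤ f p.1.1),
          p.1.2 = (Real.sqrt (f p.1.1) : ℂ) → q p = ContactCut.Cut.mk f p.1.1 hp) ∧
        ContactCut.DescendsTo ((𝓡 (2 * n + 1)).prod 𝓘(ℝ, ℂ))
          (ContactCut.extendedForm (𝓡 (2 * n + 1)) α) (ContactCut.extendedLevel f) q β) ∧
      -- the reduced space is the contact quotient of `M`
      T2Space (ContactCut.ReducedSpace f) ∧
      SecondCountableTopology (ContactCut.ReducedSpace f) ∧
      ContactCut.IsContactForm (n - 1) α₀ ∧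
      ContactCut.DescendsTo (𝓡 (2 * n + 1)) α {m : M | f m = 0}
        (ContactCut.ReducedSpace.mk f) α₀ ∧
      -- the natural map from the reduced space to the cut is a contact embedding
      Manifold.IsSmoothEmbedding (𝓡 (2 * (n - 1) + 1)) (𝓡 (2 * n + 1)) ∞
        (ContactCut.reducedToCut f) ∧
      ContactCut.pullback (𝓡 (2 * (n - 1) + 1)) (𝓡 (2 * n + 1)) (ContactCut.reducedToCut f) β
        = α₀ ∧
      -- the natural map from `{f > 0}` to the complement of the reduced space is a diffeomorphism
      -- of open submanifolds, under which `β` pulls back to `α`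
      ∃ (U : TopologicalSpace.Opens M) (V : TopologicalSpace.Opens (ContactCut.Cut f))
        (Φ : Diffeomorph (𝓡 (2 * n + 1)) (𝓡 (2 * n + 1)) U V ∞),
        (U : Set M) = {m : M | 0 < f m} ∧
        (V : Set (ContactCut.Cut f)) = (Set.range (ContactCut.reducedToCut f))ᶜ ∧
        (∀ (m : U) (hm : 0 < f m), (Φ m : ContactCut.Cut f) = ContactCut.Cut.mk f m hm.le) ∧
        ContactCut.pullback (𝓡 (2 * n + 1)) (𝓡 (2 * n + 1))
            (fun m : U ↦ (Φ m : ContactCut.Cut f)) β =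
          ContactCut.pullback (𝓡 (2 * n + 1)) (𝓡 (2 * n + 1)) (fun m : U ↦ (m : M)) α := by
  obtain ⟨A, hA, rfl, rfl⟩ : ∃ A : ContactCut.HamAction (𝓡 (2 * n + 1)) M,
      (∀ c m, A.act c m = c • m) ∧ A.form = α ∧ A.Ψ = f :=
    ⟨ContactCut.HamAction.ofSMul hα.smooth hinv, fun _ _ ↦ rfl, rfl, hf.symm⟩
  have hw : ∀ q, ∃ v : Fin (2 * n + 1) → TangentSpace (𝓡 (2 * n + 1)) q,
      ContactCut.wedgePow n (A.form q)
        (ContactCut.extDerivForm (𝓡 (2 * n + 1)) A.form q) v ≠ 0 := hα.wedge_ne_zero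
  have hpos : ∀ m, A.Ψ m = 0 → 0 < n := fun m h ↦
    A.pos_of_zero_level hw h (by simpa only [hA] using hfree m h)
  have hcovM : ∀ m ∈ {m | A.Ψ m = 0},
      ∃ T : ContactCut.Slice A (EuclideanSpace ℝ (Fin (2 * (n - 1) + 1))), m ∈ T.source :=
    fun m h ↦ A.exists_slice_of_contact hw h (by simpa only [hA] using hfree m h)
  -- The dimension identity needs $n>0$, because `n - 1` is truncated; it is therefore only asserted
  -- in the presence of a point of the zero level.
  have hL : ∀ m, A.Ψ m = 0 →
      Module.finrank ℝ (EuclideanSpace ℝ (Fin (2 * (n - 1) + 1))) + 2 = 2 * n + 1 ∧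
      Nonempty ((EuclideanSpace ℝ (Fin (2 * (n - 1) + 1)) × ℂ) ≃L[ℝ]
        EuclideanSpace ℝ (Fin (2 * n + 1))) := by
    intro m h
    have hn := hpos m h
    have h1 : Module.finrank ℝ (EuclideanSpace ℝ (Fin (2 * (n - 1) + 1))) + 2 = 2 * n + 1 := by
      simp
      omega
    refine ⟨h1, ⟨ContinuousLinearEquiv.ofFinrankEq ?_⟩⟩
    rw [Module.finrank_prod, Complex.finrank_real_complex, h1, finrank_euclideanSpace_fin]
  have hcovC := ContactCut.exists_extended_slice hcovM fun m h ↦ (hL m h).2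
  let RM := ContactCut.reducedReduction A hA
  let RC := ContactCut.cutReduction hA
  let cC : ChartedSpace (EuclideanSpace ℝ (Fin (2 * n + 1))) (ContactCut.Cut A.Ψ) :=
    RC.chartedSpace hcovC
  let cM : ChartedSpace (EuclideanSpace ℝ (Fin (2 * (n - 1) + 1)))
      (ContactCut.ReducedSpace A.Ψ) := RM.chartedSpace hcovM
  have mC : IsManifold (𝓡 (2 * n + 1)) ∞ (ContactCut.Cut A.Ψ) := RC.isManifold hcovC
  have mM : IsManifold (𝓡 (2 * (n - 1) + 1)) ∞ (ContactCut.ReducedSpace A.Ψ) :=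
    RM.isManifold hcovM
  have hatC := RC.chart_mem_maximalAtlas hcovC
  have hatM := RM.chart_mem_maximalAtlas hcovM
  refine ⟨cC, mC, RC.form hcovC, cM, mM, RM.form hcovM, RC.t2Space, RC.secondCountableTopology,
    ⟨RC.isSmoothForm_form hcovC hatC, RC.exists_wedgePow_form_ne_zero hcovC hatC
      (ContactCut.exists_slice_extendedLevel_wedgePow_ne_zero hw hcovM hL)⟩,
    ⟨RC.q, ContactCut.cutMap_eq_iff hA, fun p hp h ↦ ContactCut.cutMap_of_eq_ofReal hA p
      (Real.sqrt_nonneg _) h, RC.descendsTo hcovC hatC (by simp)⟩,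
    RM.t2Space, RM.secondCountableTopology,
    ⟨RM.isSmoothForm_form hcovM hatM, RM.exists_wedgePow_form_ne_zero hcovM hatM fun m h ↦ ?_⟩, ?_,
    ContactCut.isSmoothEmbedding_reducedToCut hA hcovM hatM hatC fun m h ↦ (hL m h).2,
    ContactCut.pullback_reducedToCut hA hcovM hatM hcovC hatC fun m h ↦ (hL m h).2,
    ContactCut.positiveOpens A, ContactCut.cutOpens A,
    ContactCut.positiveDiffeomorph hA hatC, rfl, rfl, fun _ _ ↦ rfl,
    ContactCut.pullback_positiveEquiv hA hcovC hatC⟩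
  · obtain ⟨k, rfl⟩ : ∃ k, n = k + 1 := ⟨n - 1, by have := hpos m h; omega⟩
    obtain ⟨T, hT⟩ := hcovM m h
    exact ⟨T, hT, T.exists_wedgePow_κ₀_ne_zero (by simp) hw (T.w_mem hT h)⟩
  -- A point of the zero level forces $n>0$, so the dimensions match; otherwise the claim is
  -- vacuous.
  · rcases isEmpty_or_nonempty {m | A.Ψ m = 0} with hZ | ⟨⟨m, hm⟩⟩
    · exact ContactCut.descendsTo_of_isEmpty (𝓡 (2 * n + 1)) A.form {m | A.Ψ m = 0} _ _
    · exact RM.descendsTo hcovM hatM (by have := hpos m hm; simp; omega)
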